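/- Let $T$ be a field of characteristic $0$ and $n\ge 1$. For $1\le j,k\le n$ let $m_j,d_j,d_{jk}$ be positive integers and $m_{jk}$ integers with $\gcd(m_j,d_j)=\gcd(m_{jk},d_{jk})=1$, $d_{jk}=d_{kj}$, $m_{jk}=-m_{kj}$. Let $D$ be the least common multiple of all $d_j$ and $d_{jk}$, assume that $T$ contains a primitive $D$-th root of unity $\epsilon$, and put $\epsilon_j=\epsilon^{Dm_j/d_j}$, $\beta_{jk}=\epsilon^{Dm_{jk}/d_{jk}}$. Assume that $\epsilon_j\ne 1$ for all $j$, and that $d_j\mid d_l$ and $d_{jk}\mid d_l$ for all $j\le l$ and all $k$ (so $D=d_n$). Let $A$ be the quantized Weyl algebra: the unital $T$-algebra with generators $x_1,y_1,\dots,x_n,y_n$ and relations $$y_jy_k=\beta_{jk}y_ky_j\ (\forall j,k),\quad x_jx_k=\epsilon_j\beta_{jk}x_kx_j\ (j<k),\quad x_jy_k=\beta_{kj}y_kx_j\ (j<k),$$ $$x_jy_k=\epsilon_k\beta_{kj}y_kx_j\ (j>k),\quad x_jy_j-\epsilon_jy_jx_j=1+\sum_{i<j}(\epsilon_i-1)y_ix_i\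 (\forall j).$$ Let $A_q$ be the $T[q^{\pm1}]$-algebra with the same generators and relations in which $\epsilon_j,\beta_{jk}$ are replaced by $q^{Dm_j/d_j},q^{Dm_{jk}/d_{jk}}$, and let $\sigma\colon A_q\to A$ be the specialization $q\mapsto\epsilon$, which sends generators to generators. Then $\sigma$ is surjective, and the rule $$\{z_1,z_2\}=\sigma\big((c_1c_2-c_2c_1)/(q-\epsilon)\big),\qquad c_i\in\sigma^{-1}(z_i),$$ gives a well-defined Poisson bracket on the center $\mathcal Z(A)$. The elements $X_j=x_j^{d_j}$ and $Y_j=y_j^{d_j}$ are central. Put $Z_0=1$ and $Z_j=-(1-\epsilon_j)^{d_j}Y_jX_j+Z_{j-1}^{d_j/d_{j-1}}$ for $1\le j\le n$ (with $d_0=1$). Then: (i) The Poisson bracket of $\mathcal Z(A)$ extends uniquely to a Poisson bracket on the localization $\mathcal Z(A)[X_j^{-1},Z_j^{-1},\,1\le j\le n]$, and with it this localization is Poisson simple: it is nonzero and its only Poisson ideals (ideals $I$ such that $\{a,b\}\in I$ for all elements $a$ and all $b\in I$) are $0$ and the whole algebra. (ii) Up to associates, the Poisson prime elements of $\mathcal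 Z(A)$ are $Z_1,\dots,Z_n$: an element of $\mathcal Z(A)$ is Poisson prime if and only if it is an associate of some $Z_j$. Here $f\in\mathcal Z(A)$ is Poisson prime if it is a prime element and there is a derivation $\partial$ of the $T$-algebra $\mathcal Z(A)$ with $\partial\{a,b\}=\{\partial a,b\}+\{a,\partial b\}$ for all $a,b$, and $\{f,a\}=f\,\partial(a)$ for all $a$. -/

import Mathlib

noncomputable section

/-! ### Poisson algebras -/

section Poisson

variable (T : Type*) {P : Type*} [CommRing T] [CommRing P] [Algebra T P]

/-- `br` makes the commutative `T`-algebra `P` a Poisson algebra: it is a `T`-bilinear Lie bracket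
which is a derivation in each argument. (Linearity and the Leibniz rule in the other argument
follow from the alternating property.) -/
structure IsPoissonBracket (br : P → P → P) : Prop where
  add_left : ∀ a b c, br (a + b) c = br a c + br b c
  smul_left : ∀ (t : T) (a b : P), br (t • a) b = t • br a b
  alternating : ∀ a, br a a = 0
  jacobi : ∀ a b c, br a (br b c) + br b (br c a) + br c (br a b) = 0
  leibniz : ∀ a b c, br a (b * c) = br a b * c + b * br a c

/-- A Poisson derivation: a derivation of the associative and of the Lie structure. -/
def IsPoissonDerivation (br : P → P → P) (D : Derivation T P P) : Prop :=
  ∀ x y, D (br x y) = br (D x) y + br x (D y)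

/-- `a` is Poisson normal: `{a, x} = a ∂(x)` for some Poisson derivation `∂`. -/
def IsPoissonNormal (br : P → P → P) (a : P) : Prop :=
  ∃ D : Derivation T P P, IsPoissonDerivation T br D ∧ ∀ x, br a x = a * D x

/-- A Poisson prime element: a prime element which is Poisson normal. -/
def IsPoissonPrime (br : P → P → P) (p : P) : Prop :=
  Prime p ∧ IsPoissonNormal T br p

/-- A Poisson ideal: an ideal `I` with `{P, I} ⊆ I`. -/
def IsPoissonIdeal (br : P → P → P) (I : Ideal P) : Prop :=
  ∀ a, ∀ b ∈ I, br a b ∈ I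

/-- Poisson simple: nonzero, and without Poisson ideals other than `0` and the whole algebra. -/
def IsPoissonSimple (br : P → P → P) : Prop :=
  Nontrivial P ∧ ∀ I : Ideal P, IsPoissonIdeal br I → I = ⊥ ∨ I = ⊤

/-- `br'` is a Poisson bracket on the localization of `P` at `M` which extends the bracket `br`
of `P`. -/
def IsLocalizedPoissonBracket (br : P → P → P) (M : Submonoid P)
    (br' : Localization M → Localization M → Localization M) : Prop :=
  IsPoissonBracket T br' ∧
    ∀ a b : P, br' (algebraMap P (Localization M) a) (algebraMap P (Localization M) b) =
      algebraMap P (Localization M) (br a b)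

end Poisson

/-! ### Multiparameter quantized Weyl algebras -/

section Weyl

variable {n : ℕ}

/-- The defining relations; `Sum.inl j` stands for `x_j` and `Sum.inr j` for `y_j`. -/
inductive QWeylRel (R : Type*) [CommRing R] (E : Fin n → Rˣ) (B : Fin n → Fin n → Rˣ) :
    FreeAlgebra R (Fin n ⊕ Fin n) → FreeAlgebra R (Fin n ⊕ Fin n) → Prop
  | yy (j k : Fin n) : QWeylRel R E B
      (FreeAlgebra.ι R (Sum.inr j) * FreeAlgebra.ι R (Sum.inr k))
      ((B j k : R) • (FreeAlgebra.ι R (Sum.inr k) * FreeAlgebra.ι R (Sum.inr j)))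
  | xx (j k : Fin n) (h : j < k) : QWeylRel R E B
      (FreeAlgebra.ι R (Sum.inl j) * FreeAlgebra.ι R (Sum.inl k))
      ((E j * B j k : R) • (FreeAlgebra.ι R (Sum.inl k) * FreeAlgebra.ι R (Sum.inl j)))
  | xy_lt (j k : Fin n) (h : j < k) : QWeylRel R E B
      (FreeAlgebra.ι R (Sum.inl j) * FreeAlgebra.ι R (Sum.inr k))
      ((B k j : R) • (FreeAlgebra.ι R (Sum.inr k) * FreeAlgebra.ι R (Sum.inl j)))
  | xy_gt (j k : Fin n) (h : k < j) : QWeylRel R E B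
      (FreeAlgebra.ι R (Sum.inl j) * FreeAlgebra.ι R (Sum.inr k))
      ((E k * B k j : R) • (FreeAlgebra.ι R (Sum.inr k) * FreeAlgebra.ι R (Sum.inl j)))
  | xy_eq (j : Fin n) : QWeylRel R E B
      (FreeAlgebra.ι R (Sum.inl j) * FreeAlgebra.ι R (Sum.inr j) -
        (E j : R) • (FreeAlgebra.ι R (Sum.inr j) * FreeAlgebra.ι R (Sum.inl j)))
      (1 + ∑ i ∈ Finset.Iio j,
        ((E i : R) - 1) • (FreeAlgebra.ι R (Sum.inr i) * FreeAlgebra.ι R (Sum.inl i)))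

/-- The quantized Weyl algebra over `R` with parameters `E = (ε_j)` and `B = (β_{jk})`. -/
def QWeyl (R : Type*) [CommRing R] (E : Fin n → Rˣ) (B : Fin n → Fin n → Rˣ) : Type _ :=
  RingQuot (QWeylRel R E B)

namespace QWeyl

variable {R : Type*} [CommRing R] {E : Fin n → Rˣ} {B : Fin n → Fin n → Rˣ}

instance : Ring (QWeyl R E B) := inferInstanceAs (Ring (RingQuot (QWeylRel R E B)))

instance : Algebra R (QWeyl R E B) := inferInstanceAs (Algebra R (RingQuot (QWeylRel R E B)))

/-- The projection from the free algebra. -/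
def mk (R : Type*) [CommRing R] (E : Fin n → Rˣ) (B : Fin n → Fin n → Rˣ) :
    FreeAlgebra R (Fin n ⊕ Fin n) →ₐ[R] QWeyl R E B :=
  RingQuot.mkAlgHom R (QWeylRel R E B)

/-- The generator `x_j`. -/
def x (R : Type*) [CommRing R] (E : Fin n → Rˣ) (B : Fin n → Fin n → Rˣ) (j : Fin n) :
    QWeyl R E B :=
  mk R E B (FreeAlgebra.ι R (Sum.inl j))

/-- The generator `y_j`. -/
def y (R : Type*) [CommRing R] (E : Fin n → Rˣ) (B : Fin n → Fin n → Rˣ) (j : Fin n) :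
    QWeyl R E B :=
  mk R E B (FreeAlgebra.ι R (Sum.inr j))

theorem mk_eq_of_rel {a b : FreeAlgebra R (Fin n ⊕ Fin n)} (h : QWeylRel R E B a b) :
    mk R E B a = mk R E B b :=
  RingQuot.mkAlgHom_rel R h

section BaseChange

variable {S : Type*} [CommRing S] {E' : Fin n → Sˣ} {B' : Fin n → Fin n → Sˣ}

/-- The ring homomorphism from the free algebra over `R` to a quantized Weyl algebra over `S`
which is `f` on scalars and sends generators to the corresponding generators. -/
def freeMap (f : R →+* S) (E' : Fin n → Sˣ) (B' : Fin n → Fin n → Sˣ) :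
    FreeAlgebra R (Fin n ⊕ Fin n) →+* QWeyl S E' B' :=
  letI : Algebra R (QWeyl S E' B') := Algebra.compHom (QWeyl S E' B') f
  (FreeAlgebra.lift R (Sum.elim (x S E' B') (y S E' B'))).toRingHom

theorem freeMap_inl (f : R →+* S) (j : Fin n) :
    freeMap f E' B' (FreeAlgebra.ι R (Sum.inl j)) = x S E' B' j := by
  let _ : Algebra R (QWeyl S E' B') := Algebra.compHom (QWeyl S E' B') f
  exact FreeAlgebra.lift_ι_apply (R := R) (Sum.elim (x S E' B') (y S E' B')) (Sum.inl j)

theorem freeMap_inr (f : R →+* S) (j : Fin n) :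
    freeMap f E' B' (FreeAlgebra.ι R (Sum.inr j)) = y S E' B' j := by
  let _ : Algebra R (QWeyl S E' B') := Algebra.compHom (QWeyl S E' B') f
  exact FreeAlgebra.lift_ι_apply (R := R) (Sum.elim (x S E' B') (y S E' B')) (Sum.inr j)

theorem freeMap_smul (f : R →+* S) (r : R) (a : FreeAlgebra R (Fin n ⊕ Fin n)) :
    freeMap f E' B' (r • a) = f r • freeMap f E' B' a := by
  let _ : Algebra R (QWeyl S E' B') := Algebra.compHom (QWeyl S E' B') f
  exact map_smul (FreeAlgebra.lift R (Sum.elim (x S E' B') (y S E' B'))) r a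

theorem freeMap_rel (f : R →+* S) (hE : ∀ j, f (E j) = E' j) (hB : ∀ j k, f (B j k) = B' j k)
    {a b : FreeAlgebra R (Fin n ⊕ Fin n)} (h : QWeylRel R E B a b) :
    freeMap f E' B' a = freeMap f E' B' b := by
  cases h with
  | yy j k =>
    simpa [freeMap_smul, freeMap_inl, freeMap_inr, hE, hB, x, y] using
      mk_eq_of_rel (QWeylRel.yy (R := S) (E := E') (B := B') j k)
  | xx j k h =>
    simpa [freeMap_smul, freeMap_inl, freeMap_inr, hE, hB, x, y] using
      mk_eq_of_rel (QWeylRel.xx (R := S) (E := E') (B := B') j k h)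
  | xy_lt j k h =>
    simpa [freeMap_smul, freeMap_inl, freeMap_inr, hE, hB, x, y] using
      mk_eq_of_rel (QWeylRel.xy_lt (R := S) (E := E') (B := B') j k h)
  | xy_gt j k h =>
    simpa [freeMap_smul, freeMap_inl, freeMap_inr, hE, hB, x, y] using
      mk_eq_of_rel (QWeylRel.xy_gt (R := S) (E := E') (B := B') j k h)
  | xy_eq j =>
    simpa [freeMap_smul, freeMap_inl, freeMap_inr, hE, hB, x, y] using
      mk_eq_of_rel (QWeylRel.xy_eq (R := S) (E := E') (B := B') j)

/-- Change of scalars along `f : R → S`, for parameters that correspond under `f`. -/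
def map (f : R →+* S) (hE : ∀ j, f (E j) = E' j) (hB : ∀ j k, f (B j k) = B' j k) :
    QWeyl R E B →+* QWeyl S E' B' :=
  RingQuot.lift ⟨freeMap f E' B', fun _ _ h => freeMap_rel f hE hB h⟩

theorem map_mk (f : R →+* S) (hE : ∀ j, f (E j) = E' j) (hB : ∀ j k, f (B j k) = B' j k)
    (a : FreeAlgebra R (Fin n ⊕ Fin n)) :
    map f hE hB (mk R E B a) = freeMap f E' B' a := by
  have h : mk R E B a = RingQuot.mkRingHom (QWeylRel R E B) a := by
    rw [← RingQuot.mkAlgHom_coe R]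
    rfl
  rw [h]
  exact RingQuot.lift_mkRingHom_apply _ _ _

end BaseChange

end QWeyl

end Weyl

/-! ### Parameters that are powers of one unit -/

/-- The integers which encode the parameters
`ε_j = exp(2π√-1 m_j / d_j)` and `β_{jk} = exp(2π√-1 m_{jk} / d_{jk})`:
`m j`, `d j`, `mm j k`, `dd j k` stand for `m_j`, `d_j`, `m_{jk}`, `d_{jk}`. -/
structure RootData (n : ℕ) where
  m : Fin n → ℕ
  d : Fin n → ℕ
  mm : Fin n → Fin n → ℤ
  dd : Fin n → Fin n → ℕ
  m_pos : ∀ j, 0 < m j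
  d_pos : ∀ j, 0 < d j
  dd_pos : ∀ j k, 0 < dd j k
  coprime : ∀ j, Nat.Coprime (m j) (d j)
  coprime' : ∀ j k, Int.gcd (mm j k) (dd j k) = 1
  dd_symm : ∀ j k, dd j k = dd k j
  mm_skew : ∀ j k, mm j k = -mm k j

namespace RootData

variable {n : ℕ} (p : RootData n)

/-- `D(E,B)`, the least common multiple of all `d_j` and all `d_{jk}`. -/
def D : ℕ :=
  Nat.lcm (Finset.univ.lcm p.d) (Finset.univ.lcm fun jk : Fin n × Fin n => p.dd jk.1 jk.2)

/-- The parameters `ε_j = u ^ (D m_j / d_j)` for a unit `u` in the place of `exp(2π√-1 / D)`. -/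
def eps {R : Type*} [CommRing R] (u : Rˣ) (j : Fin n) : Rˣ :=
  u ^ (p.D / p.d j * p.m j)

/-- The parameters `β_{jk} = u ^ (D m_{jk} / d_{jk})`. -/
def beta {R : Type*} [CommRing R] (u : Rˣ) (j k : Fin n) : Rˣ :=
  u ^ (((p.D / p.dd j k : ℕ) : ℤ) * p.mm j k)

/-- The quantized Weyl algebra over `R` with parameters `p.eps u` and `p.beta u`. -/
abbrev Weyl {R : Type*} [CommRing R] (u : Rˣ) : Type _ :=
  QWeyl R (p.eps u) (p.beta u)

/-- The divisibility condition: `d_j ∣ d_l` and `d_{jk} ∣ d_l` for all `j ≤ l` and all `k`. -/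
def Divisibility : Prop :=
  ∀ j l : Fin n, j ≤ l → p.d j ∣ p.d l ∧ ∀ k, p.dd j k ∣ p.d l

variable {T : Type*} [CommRing T]

/-- The sequence `Z_0, …, Z_n` with `Z_0 = 1` and
`Z_j = -(1 - ε_j)^{d_j} Y_j X_j + Z_{j-1}^{d_j / d_{j-1}}`, where `ε_j = p.eps u j`.
The index `j : Fin n` is zero-based, so it stands for `j + 1`. The value of `d_0` is immaterial,
as `Z_0 = 1`. -/
def Zseq {C : Type*} [CommRing C] [Algebra T C] (u : Tˣ) (X Y : Fin n → C) : ℕ → C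
  | 0 => 1
  | j + 1 =>
    if h : j < n then
      -((1 - (p.eps u ⟨j, h⟩ : T)) ^ p.d ⟨j, h⟩ • (Y ⟨j, h⟩ * X ⟨j, h⟩)) +
        Zseq u X Y j ^ (p.d ⟨j, h⟩ / p.d ⟨j - 1, by omega⟩)
    else 1

/-! ### Specialization and the induced Poisson bracket -/

/-- The indeterminate `q` as a unit of `T[q, q⁻¹]`. -/
def q (T : Type*) [CommRing T] : (LaurentPolynomial T)ˣ where
  val := LaurentPolynomial.T 1
  inv := LaurentPolynomial.T (-1)
  val_inv := by rw [← LaurentPolynomial.T_add]; simp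
  inv_val := by rw [← LaurentPolynomial.T_add]; simp

/-- Evaluation `T[q, q⁻¹] → T` at a unit. -/
def evalAt (u : Tˣ) : LaurentPolynomial T →+* T :=
  LaurentPolynomial.eval₂ (RingHom.id T) u

theorem map_q (u : Tˣ) : Units.map (evalAt u : LaurentPolynomial T →* T) (q T) = u := by
  ext
  simp [evalAt, q, LaurentPolynomial.eval₂_T]

/-- The specialization `σ` at `q = u`, a ring homomorphism from the quantized Weyl algebra over
`T[q, q⁻¹]` with parameters `q ^ (D m_j / d_j)`, `q ^ (D m_{jk} / d_{jk})` to the one over `T` with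
parameters `u ^ (D m_j / d_j)`, `u ^ (D m_{jk} / d_{jk})`. -/
def sigma (u : Tˣ) : p.Weyl (q T) →+* p.Weyl u :=
  QWeyl.map (evalAt u)
    (fun j => by
      have h := congrArg Units.val
        (map_pow (Units.map (evalAt u : LaurentPolynomial T →* T)) (q T) (p.D / p.d j * p.m j))
      rw [map_q] at h
      exact h)
    (fun j k => by
      have h := congrArg Units.val
        (map_zpow (Units.map (evalAt u : LaurentPolynomial T →* T)) (q T)
          (((p.D / p.dd j k : ℕ) : ℤ) * p.mm j k))
      rw [map_q] at h
      exact h)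

/-- The element `q - u` of `T[q, q⁻¹]`. -/
def qSub (u : Tˣ) : LaurentPolynomial T :=
  (q T : LaurentPolynomial T) - LaurentPolynomial.C (u : T)

/-- The center of the quantized Weyl algebra. -/
abbrev Center (u : Tˣ) : Type _ :=
  Subalgebra.center T (p.Weyl u)

/-- `w = σ((c₁ c₂ - c₂ c₁) / (q - u))` for some `c₁ ∈ σ⁻¹(z₁)` and `c₂ ∈ σ⁻¹(z₂)`. -/
def IsBracketValue (u : Tˣ) (z₁ z₂ w : p.Center u) : Prop :=
  ∃ c₁ c₂ c : p.Weyl (q T), p.sigma u c₁ = z₁ ∧ p.sigma u c₂ = z₂ ∧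
    c₁ * c₂ - c₂ * c₁ = qSub u • c ∧ p.sigma u c = w

/-- The bracket `{z₁, z₂} = σ((c₁ c₂ - c₂ c₁) / (q - u))` on the center. -/
def bracket (u : Tˣ) (z₁ z₂ : p.Center u) : p.Center u :=
  Classical.epsilon (p.IsBracketValue u z₁ z₂)

/-- The bracket on the center does not depend on choices: any two lifts have a commutator that
is divisible by `q - u`, and every quotient specializes to the bracket. -/
def BracketWellDefined (u : Tˣ) : Prop :=
  ∀ (z₁ z₂ : p.Center u) (c₁ c₂ : p.Weyl (q T)), p.sigma u c₁ = z₁ → p.sigma u c₂ = z₂ →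
    (∃ c : p.Weyl (q T), c₁ * c₂ - c₂ * c₁ = qSub u • c) ∧
      ∀ c : p.Weyl (q T), c₁ * c₂ - c₂ * c₁ = qSub u • c → p.sigma u c = p.bracket u z₁ z₂

end RootData

end

noncomputable section

/-! ### Derivations and Poisson brackets on localizations -/

section DerivationLocalization

variable {T P L : Type*} [CommRing T] [CommRing P] [CommRing L] [Algebra T L] [Algebra P L]
  (M : Submonoid P) [IsLocalization M L]

/-! Put z_0 = 1 and z_i = 1 + ∑_{k ≤ i} (ε_k - 1) y_k x_k. The z_i commute with each other, x_j z_i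
= ε_j z_i x_j for j ≤ i, and x_j z_i = z_i x_j for j > i. Since (ε_j - 1) y_j x_j = z_j - z_{j-1},
the algebra maps to the quantum torus on the z_i and x_j by y_j ↦ (ε_j - 1)⁻¹ (z_j - z_{j-1}) x_j⁻¹
(`rho`). If z_i has weight i, then y^a x^b has leading monomial z^a x^{b-a}. These are distinct, so
the ordered monomials, which span by straightening, form a basis and the map is injective
(`linearIndependent_mon`, `rho_injective`). Over the fraction field of T[q, q⁻¹] the same embedding
shows that A_q has no (q - ε)-torsion, and comparison of bases gives ker σ = (q - ε) A_q. The
bracket is therefore well defined, and its axioms are commutator identities divided by powers of q -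
ε.

In the torus, monomials commute up to powers of ε, so centrality is divisibility by D of values of
an integral form. Under the divisibility hypothesis a monomial is central exactly when d_j divides
both its exponents at each index j; removing leading terms one by one shows that the center is the
polynomial algebra in the X_j, Y_j (`centerEquiv`). Factoring a^d - b^d over d-th roots of unity
gives (1 - ε_j)^{d_j} Y_j X_j = z_{j-1}^{d_j} - z_j^{d_j}, hence Z_j = z_j^{d_j} (`coe_Zseq_succ`).

If c₁ c₂ = q^N c₂ c₁ with ε^N = 1, the derivative of q^N at ε gives {z₁, z₂} = N ε⁻¹ z₁ z₂. Hence
the X_j and Z_j form a log-canonical system: the Z_j commute under the bracket, and {X_j, Z_k} is a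
scalar multiple of X_j Z_k, nonzero exactly for j ≤ k. This triangular shape makes the coefficient
matrix nondegenerate in characteristic 0. After inverting X_j, each Y_j is a polynomial in the Z's
divided by X_j, so the localization is spanned by Laurent monomials which the Hamiltonians separate.
A nonzero Poisson ideal then contains a monomial, a unit (`isPoissonSimple_of_logCanonical`).

A Poisson prime element generates a Poisson ideal of the localization, so it becomes a unit there
and divides a product of X's and Z's. It is not associated to X_j, because {X_j, Y_j} is a nonzero
multiple of Z_j, which X_j does not divide. Conversely Z_j is Poisson normal, and it is prime
because it is linear in Y_j with coprime coefficients. Indices in the code are zero-based, so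
z_{j+1} and Z_{j+1} belong to x_j and y_j. -/

include M in
-- Write l s = a with s in M: the Leibniz rule leaves G l * s = 0 with s a unit. Additivity of G
-- plays no role, which is essential in `eq_of_extends`.
theorem eq_zero_of_leibniz_of_algebraMap {G : L → L} (hG : ∀ a b, G (a * b) = G a * b + a * G b)
    (h : ∀ a : P, G (algebraMap P L a) = 0) (l : L) : G l = 0 := by
  obtain ⟨⟨a, s⟩, hs⟩ := IsLocalization.surj M l
  have h₁ := hG l (algebraMap P L s)
  rw [hs, h, h, mul_zero, add_zero] at h₁
  exact ((IsLocalization.map_units L s).mul_left_eq_zero).1 h₁.symm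

include M in
theorem Derivation.eq_of_eq_on_algebraMap {D₁ D₂ : Derivation T L L}
    (h : ∀ a : P, D₁ (algebraMap P L a) = D₂ (algebraMap P L a)) : D₁ = D₂ := by
  ext l
  rw [← sub_eq_zero]
  refine eq_zero_of_leibniz_of_algebraMap M (G := fun l => D₁ l - D₂ l) (fun a b => ?_)
    (fun a => sub_eq_zero.2 (h a)) l
  simp only [Derivation.leibniz, smul_eq_mul]
  ring

variable [Algebra T P] [IsScalarTower T P L]

include M in
-- A derivation is a ring homomorphism a ↦ a + δ(a) ε into the dual numbers over L. It sends M to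
-- units, because a dual number is a unit as soon as its first component is, so the universal
-- property of the localization extends it.
theorem Derivation.exists_extension (δ : Derivation T P L) :
    ∃ δ' : Derivation T L L, ∀ a, δ' (algebraMap P L a) = δ a := by
  let f : P →+* TrivSqZeroExt L L :=
    { toFun := fun a => TrivSqZeroExt.inl (algebraMap P L a) + TrivSqZeroExt.inr (δ a)
      map_one' := by ext <;> simp
      map_zero' := by ext <;> simp
      map_add' := fun a b => by ext <;> simp
      map_mul' := fun a b => by
        ext
        · simp
        · simp only [TrivSqZeroExt.snd_mul, TrivSqZeroExt.snd_add, TrivSqZeroExt.snd_inl,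
            TrivSqZeroExt.snd_inr, TrivSqZeroExt.fst_add, TrivSqZeroExt.fst_inl,
            TrivSqZeroExt.fst_inr, δ.leibniz, Algebra.smul_def, zero_add, add_zero,
            op_smul_eq_smul, Algebra.algebraMap_self, RingHom.id_apply] }
  have hf1 : ∀ a, (f a).fst = algebraMap P L a := fun a => by simp [f]
  have hf2 : ∀ a, (f a).snd = δ a := fun a => by simp [f]
  have hf : ∀ s : M, IsUnit (f s) := fun s => by
    rw [TrivSqZeroExt.isUnit_iff_isUnit_fst]
    rw [hf1]
    exact IsLocalization.map_units L s
  let g : L →+* TrivSqZeroExt L L := IsLocalization.lift hf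
  have hg : ∀ a, g (algebraMap P L a) = f a := IsLocalization.lift_eq hf
  have hfst : ∀ l, (g l).fst = l := by
    have : (TrivSqZeroExt.fstHom L L L).toRingHom.comp g = RingHom.id L := by
      apply IsLocalization.ringHom_ext M
      ext a
      change (g (algebraMap P L a)).fst = _
      rw [hg, hf1]
      rfl
    intro l
    exact congrArg (fun h : L →+* L => h l) this
  have hsnd : ∀ a b, (g (a * b)).snd = a * (g b).snd + b * (g a).snd := fun a b => by
    rw [map_mul, TrivSqZeroExt.snd_mul, hfst, hfst, smul_eq_mul, op_smul_eq_smul, smul_eq_mul]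
  have hsmul : ∀ (t : T) (l : L), (g (t • l)).snd = t • (g l).snd := fun t l => by
    have h0 : (f (algebraMap T P t)).snd = 0 := by
      rw [hf2, δ.map_algebraMap]
    rw [Algebra.smul_def, Algebra.smul_def, hsnd, IsScalarTower.algebraMap_apply T P L, hg, h0,
      mul_zero, add_zero]
  have hadd : ∀ a b, (g (a + b)).snd = (g a).snd + (g b).snd := fun a b => by
    rw [map_add, TrivSqZeroExt.snd_add]
  refine ⟨Derivation.mk' { toFun := fun l => (g l).snd, map_add' := hadd, map_smul' := hsmul }
    (fun a b => hsnd a b), fun a => ?_⟩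
  change (g (algebraMap P L a)).snd = _
  rw [hg, hf2]

end DerivationLocalization

/-! ### Existence and uniqueness of the extension of a Poisson bracket to a localization. -/

namespace IsPoissonBracket

section Basic

variable {T P : Type*} [CommRing T] [CommRing P] [Algebra T P] {br : P → P → P}
  (h : IsPoissonBracket T br) (hanti : ∀ a b, br a b = -br b a)

include h hanti

/-- The bracket axioms give additivity only on the left, from which the alternating property does
not directly yield antisymmetry. Antisymmetry is therefore carried as the separate hypothesis
`hanti`. -/
theorem add_right (a b c : P) : br a (b + c) = br a b + br a c := by
  rw [hanti, h.add_left, hanti b, hanti c]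
  ring

theorem smul_right (t : T) (a b : P) : br a (t • b) = t • br a b := by
  rw [hanti, h.smul_left, hanti b, smul_neg, neg_neg]

theorem neg_right (a b : P) : br a (-b) = -br a b := by
  simpa using h.smul_right hanti (-1) a b

/-- The Hamiltonian derivation `{a, ·}`. -/
def hamiltonian (a : P) : Derivation T P P :=
  Derivation.mk' { toFun := br a, map_add' := h.add_right hanti a,
                   map_smul' := fun t b => h.smul_right hanti t a b } fun b c => by
    simp [h.leibniz, mul_comm, add_comm]

theorem hamiltonian_apply (a b : P) : h.hamiltonian hanti a b = br a b := rfl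

theorem leibniz_left (a b c : P) : br (a * b) c = a * br b c + br a c * b := by
  rw [hanti, h.leibniz, hanti c, hanti c]
  ring

end Basic

section Extension

variable {T P L : Type*} [CommRing T] [CommRing P] [Algebra T P] [CommRing L] [Algebra T L]
  [Algebra P L] [IsScalarTower T P L] (M : Submonoid P) [IsLocalization M L] {br : P → P → P}
  (h : IsPoissonBracket T br) (hanti : ∀ a b, br a b = -br b a)

include M h hanti

/-- The arguments are extended one at a time: `E a` extends {a, ·} to L, and then `F w` extends the
derivation a ↦ `E a w` from P to L. Antisymmetry and the Jacobi identity compare expressions that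
are derivations in each argument, so they spread from P to L. -/
theorem exists_extension : ∃ br' : L → L → L, IsPoissonBracket T br' ∧
    (∀ a b, br' a b = -br' b a) ∧
    ∀ a b : P, br' (algebraMap P L a) (algebraMap P L b) = algebraMap P L (br a b) := by
  have hE : ∀ a : P, ∃ δ : Derivation T L L,
      ∀ b, δ (algebraMap P L b) = algebraMap P L (br a b) := fun a =>
    Derivation.exists_extension M ((Algebra.linearMap P L).compDer (h.hamiltonian hanti a))
  choose E hE using hE
  have hEadd : ∀ a b, E (a + b) = E a + E b := fun a b =>
    Derivation.eq_of_eq_on_algebraMap M fun c => by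
      simp only [Derivation.add_apply, hE, h.add_left, map_add]
  have hEsmul : ∀ (t : T) a, E (t • a) = t • E a := fun t a =>
    Derivation.eq_of_eq_on_algebraMap M fun c => by
      rw [Derivation.smul_apply, hE, hE, h.smul_left, Algebra.smul_def, Algebra.smul_def, map_mul,
        ← IsScalarTower.algebraMap_apply]
  have hEmul : ∀ a b, E (a * b) = algebraMap P L a • E b + algebraMap P L b • E a := fun a b =>
    Derivation.eq_of_eq_on_algebraMap M fun c => by
      simp only [Derivation.add_apply, Derivation.smul_apply, hE, h.leibniz_left hanti, map_add,
        map_mul, smul_eq_mul]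
      ring
  have hF : ∀ w : L, ∃ δ : Derivation T L L, ∀ a, δ (algebraMap P L a) = E a w := fun w =>
    Derivation.exists_extension M (Derivation.mk'
      { toFun := fun a => E a w
        map_add' := fun a b => by rw [hEadd, Derivation.add_apply]
        map_smul' := fun t a => by rw [hEsmul, Derivation.smul_apply, RingHom.id_apply] }
      fun a b => by
        change E (a * b) w = a • E b w + b • E a w
        simp [hEmul, Algebra.smul_def])
  choose F hF using hF
  have hFadd : ∀ v w, F (v + w) = F v + F w := fun v w =>
    Derivation.eq_of_eq_on_algebraMap M fun c => by
      simp only [Derivation.add_apply, hF, map_add]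
  have hFsmul : ∀ (t : T) v, F (t • v) = t • F v := fun t v =>
    Derivation.eq_of_eq_on_algebraMap M fun c => by
      simp only [Derivation.smul_apply, hF, Derivation.map_smul]
  have hFmul : ∀ v w, F (v * w) = v • F w + w • F v := fun v w =>
    Derivation.eq_of_eq_on_algebraMap M fun c => by
      simp only [Derivation.add_apply, Derivation.smul_apply, hF, Derivation.leibniz]
  have hEF : ∀ a, E a = -F (algebraMap P L a) := fun a =>
    Derivation.eq_of_eq_on_algebraMap M fun c => by
      rw [Derivation.neg_apply, hF, hE, hE, hanti, map_neg]
  have hanti' : ∀ l w, F w l = -F l w := fun l w => by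
    let G : Derivation T L L := Derivation.mk'
      { toFun := fun l => F l w
        map_add' := fun a b => by rw [hFadd, Derivation.add_apply]
        map_smul' := fun t a => by rw [hFsmul, Derivation.smul_apply, RingHom.id_apply] }
      fun a b => by
        change F (a * b) w = a • F b w + b • F a w
        simp [hFmul]
    have : F w = -G := Derivation.eq_of_eq_on_algebraMap M fun a => by
      rw [hF, hEF]
      rfl
    rw [this]
    rfl
  have hleib : ∀ a b c, F (b * c) a = F b a * c + b * F c a := fun a b c => by
    rw [hFmul, Derivation.add_apply, Derivation.smul_apply, Derivation.smul_apply, smul_eq_mul,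
      smul_eq_mul]
    ring
  have hleib' : ∀ a b c, F a (b * c) = F a b * c + b * F a c := fun a b c => by
    rw [Derivation.leibniz, smul_eq_mul, smul_eq_mul]
    ring
  have hP : ∀ a b : P, F (algebraMap P L b) (algebraMap P L a) = algebraMap P L (br a b) :=
    fun a b => by rw [hF, hE]
  refine ⟨fun l w => F w l, ⟨fun a b c => map_add _ a b, fun t a b => Derivation.map_smul _ t a,
    fun l => ?_, ?_, hleib⟩, hanti', hP⟩
  -- Antisymmetry alone gives only 2 {l, l} = 0. Expanding {l s, l s} = 0 instead, the cross terms
  -- cancel and s² {l, l} = 0 remains.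
  · obtain ⟨⟨a, s⟩, hs⟩ := IsLocalization.surj M l
    dsimp only at hs
    have h₁ := hP a a
    rw [h.alternating, map_zero, ← hs, hleib, hleib', hleib', hP, h.alternating, map_zero,
      hanti' (algebraMap P L s) l] at h₁
    have hu := (IsLocalization.map_units L s)
    refine (hu.mul_left_eq_zero).1 ((hu.mul_left_eq_zero).1 ?_)
    linear_combination h₁
  -- The Jacobiator is a derivation in its first argument and cyclically invariant, hence a
  -- derivation in every argument; the arguments are moved from P to L one after the other.
  · let J : L → L → L → L := fun a b c => F (F c b) a + F (F a c) b + F (F b a) c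
    have hJ : ∀ b c, ∀ x y, J (x * y) b c = J x b c * y + x * J y b c := fun b c x y => by
      simp only [J, hleib', hFadd, hFmul, Derivation.add_apply, Derivation.smul_apply, smul_eq_mul]
      linear_combination (F y c) * hanti' x b + (F x c) * hanti' y b
    have hcyc : ∀ a b c, J a b c = J b c a := fun a b c => by simp only [J]; ring
    have hPPP : ∀ a b c : P, J (algebraMap P L a) (algebraMap P L b) (algebraMap P L c) = 0 :=
      fun a b c => by simp only [J, hP, ← map_add, h.jacobi, map_zero]
    have hLPP : ∀ (a : L) (b c : P), J a (algebraMap P L b) (algebraMap P L c) = 0 :=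
      fun a b c => eq_zero_of_leibniz_of_algebraMap M (G := fun a => J a _ _) (hJ _ _)
        (fun a => hPPP a b c) a
    have hLLP : ∀ (a b : L) (c : P), J a b (algebraMap P L c) = 0 := fun a b c => by
      rw [hcyc]
      exact eq_zero_of_leibniz_of_algebraMap M (G := fun b => J b _ _) (hJ _ _)
        (fun b => by rw [hcyc, hcyc]; exact hLPP a b c) b
    exact fun a b c => by
      change J a b c = 0
      rw [← hcyc]
      exact eq_zero_of_leibniz_of_algebraMap M (G := fun c => J c _ _) (hJ _ _)
        (fun c => by rw [hcyc]; exact hLLP a b c) c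

end Extension

section Uniqueness

variable {T P L : Type*} [CommRing T] [CommRing P] [CommRing L] [IsDomain L]
  [Algebra T L] [Algebra P L] (M : Submonoid P) [IsLocalization M L]
  {br : P → P → P} {br₁ br₂ : L → L → L}

include M

/-- Additivity of the bracket in the second argument is not assumed: it follows from the Jacobi
identity once the bracket of `P` is nonzero. -/
theorem eq_of_extends (h2 : (2 : L) ≠ 0) (h₁ : IsPoissonBracket T br₁)
    (hanti : ∀ a b, br₁ a b = -br₁ b a) (h₂ : IsPoissonBracket T br₂)
    (hP₁ : ∀ a b : P, br₁ (algebraMap P L a) (algebraMap P L b) = algebraMap P L (br a b))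
    (hP₂ : ∀ a b : P, br₂ (algebraMap P L a) (algebraMap P L b) = algebraMap P L (br a b))
    (hne : ∃ a b, algebraMap P L (br a b) ≠ 0) : br₂ = br₁ := by
  have hleib : ∀ l a b, br₂ l (a * b) - br₁ l (a * b) =
      (br₂ l a - br₁ l a) * b + a * (br₂ l b - br₁ l b) := fun l a b => by
    rw [h₁.leibniz, h₂.leibniz]
    ring
  have hPL : ∀ (a : P) (l : L), br₂ (algebraMap P L a) l = br₁ (algebraMap P L a) l := fun a l =>
    sub_eq_zero.1 (eq_zero_of_leibniz_of_algebraMap M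
      (G := fun l => br₂ (algebraMap P L a) l - br₁ (algebraMap P L a) l) (hleib (algebraMap P L a))
      (fun b => by rw [hP₁, hP₂, sub_self]) l)
  funext l w
  set G : L → L := fun b => br₂ l b - br₁ l b with hGdef
  have hG : ∀ a b, G (a * b) = G a * b + a * G b := hleib l
  -- The two brackets agree once the first entry lies in P. Subtracting their Jacobi identities at
  -- (l, b, c) leaves G {b, c} = {G b, c}.
  have hGbr : ∀ b c : P, G (br₁ (algebraMap P L b) (algebraMap P L c)) =
      br₁ (G (algebraMap P L b)) (algebraMap P L c) := fun b c => by
    have j₁ := h₁.jacobi l (algebraMap P L b) (algebraMap P L c)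
    have j₂ := h₂.jacobi l (algebraMap P L b) (algebraMap P L c)
    rw [hPL b, hPL c, hPL c, hPL b] at j₂
    have e : br₂ l (algebraMap P L b) = G (algebraMap P L b) + br₁ l (algebraMap P L b) := by
      simp [hGdef]
    rw [e, h₁.add_right hanti] at j₂
    rw [hanti (G _)]
    simp only [hGdef] at j₂ ⊢
    linear_combination j₂ - j₁
  -- G of {b, c²} = 2 c {b, c} is computed in two ways. The term G 2 survives because G is not known
  -- to be additive.
  have hsq : ∀ b c : P, algebraMap P L (br b c) ≠ 0 →
      G 2 * algebraMap P L c + 2 * G (algebraMap P L c) = 0 := fun b c hbc => by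
    have e₁ := hGbr b (c * c)
    rw [map_mul, h₁.leibniz, h₁.leibniz, ← hGbr b c,
      show br₁ (algebraMap P L b) (algebraMap P L c) * algebraMap P L c +
        algebraMap P L c * br₁ (algebraMap P L b) (algebraMap P L c) =
        2 * (algebraMap P L c * br₁ (algebraMap P L b) (algebraMap P L c)) by ring, hG, hG] at e₁
    rw [← hP₁] at hbc
    refine (mul_eq_zero.1 ?_).resolve_left hbc
    linear_combination e₁
  have hnon : ∀ b c : P, algebraMap P L (br b c) ≠ 0 → G (algebraMap P L c) = 0 :=
    fun b c hbc => by
    have hc : algebraMap P L c ≠ 0 := fun hc => hbc (by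
      rw [← hP₁, hc, hanti]
      simpa using h₁.smul_left 0 0 (algebraMap P L b))
    -- The relations for c and for c² together eliminate G 2 and leave 2 c G(c) = 0.
    have e₁ := hsq b c hbc
    have e₂ := hsq b (c * c) (by
      rw [← hP₁, map_mul, h₁.leibniz, hP₁]
      have : algebraMap P L (br b c) * algebraMap P L c + algebraMap P L c * algebraMap P L (br b c)
        = 2 * algebraMap P L c * algebraMap P L (br b c) := by ring
      rw [this]
      exact mul_ne_zero (mul_ne_zero h2 hc) hbc)
    rw [map_mul, hG] at e₂
    refine (mul_eq_zero.1 (?_ : 2 * algebraMap P L c * G (algebraMap P L c) = 0)).resolve_left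
      (mul_ne_zero h2 hc)
    linear_combination e₂ - algebraMap P L c * e₁
  have hGP : ∀ c : P, G (algebraMap P L c) = 0 := fun c => by
    by_cases hc : ∃ b, algebraMap P L (br b c) ≠ 0
    · obtain ⟨b, hb⟩ := hc
      exact hnon b c hb
    -- If c brackets to zero with all of P, it is multiplied by some b with {a, b} ≠ 0: both b and c
    -- b are covered by `hnon`, and the Leibniz rule gives G(c) b = 0.
    · push Not at hc
      obtain ⟨a, b, hab⟩ := hne
      have hb : algebraMap P L b ≠ 0 := fun hb => hab (by
        rw [← hP₁, hb, hanti]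
        simpa using h₁.smul_left 0 0 (algebraMap P L a))
      by_cases hc0 : algebraMap P L c = 0
      · have := hG 0 0
        rw [hc0]
        simpa using this
      have e := hnon a (c * b) (by
        rw [← hP₁, map_mul, h₁.leibniz, hP₁, hP₁, hc, zero_mul, zero_add]
        exact mul_ne_zero hc0 hab)
      rw [map_mul, hG, hnon a b hab, mul_zero, add_zero] at e
      exact (mul_eq_zero.1 e).resolve_right hb
  exact sub_eq_zero.1 (eq_zero_of_leibniz_of_algebraMap M hG hGP w)

end Uniqueness

end IsPoissonBracket
end

noncomputable section

/-! ### Log-canonical brackets -/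

section LogCanonical

variable {T L ι : Type*} [Field T] [CommRing L] [Algebra T L] [Fintype ι]

open MvPolynomial in
-- Monomials are eigenvectors of this derivation; the eigenvalues are what allows Hamiltonians to
-- separate monomials.
theorem MvPolynomial.coeff_mkDerivation_smul_X (w : ι → T) (p : MvPolynomial ι T) (s : ι →₀ ℕ) :
    coeff s (mkDerivation T (fun i => w i • (X i : MvPolynomial ι T)) p) =
      (∑ i, w i * s i) * coeff s p := by
  classical
  induction p using MvPolynomial.induction_on' with
  | monomial u a =>
    have h : mkDerivation T (fun i => w i • (X i : MvPolynomial ι T)) (monomial u a) =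
        (∑ i, w i * u i) • monomial u a := by
      rw [mkDerivation_monomial, Finsupp.sum_fintype _ _ (by simp), Finset.smul_sum,
        Finset.sum_smul]
      refine Finset.sum_congr rfl fun i _ => ?_
      rcases Nat.eq_zero_or_pos (u i) with h0 | h0
      · simp [h0]
      · have hu : u - Finsupp.single i 1 + Finsupp.single i 1 = u :=
          tsub_add_cancel_of_le (Finsupp.single_le_iff.2 h0)
        rw [smul_eq_mul, mul_smul_comm, X, monomial_mul, hu, mul_one, smul_monomial, smul_monomial,
          smul_monomial]
        simp only [smul_eq_mul]
        congr 1
        ring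
    rw [h, coeff_smul, smul_eq_mul, coeff_monomial]
    split_ifs with hs
    · rw [hs]
    · simp
  | add p q hp hq => rw [map_add, coeff_add, coeff_add, hp, hq, mul_add]

open MvPolynomial in
/-- A log-canonical bracket with a nondegenerate coefficient matrix is Poisson simple on any
algebra which is generated by the given units and their inverses. -/
theorem isPoissonSimple_of_logCanonical [Nontrivial L] {br : L → L → L}
    (h : IsPoissonBracket T br) (hanti : ∀ a b, br a b = -br b a) (g : ι → L)
    (hg : ∀ i, IsUnit (g i)) (w : ι → ι → T) (hw : ∀ i k, br (g i) (g k) = w i k • (g i * g k))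
    (hnd : ∀ s t : ι →₀ ℕ, s ≠ t → ∃ i, ∑ k, w i k * s k ≠ ∑ k, w i k * t k)
    (hgen : ∀ l : L, ∃ (u : L) (p : MvPolynomial ι T), IsUnit u ∧ u * l = aeval g p) :
    IsPoissonSimple br := by
  classical
  refine ⟨inferInstance, fun I hI => ?_⟩
  have hder : ∀ i (p : MvPolynomial ι T), br (g i) (aeval g p) =
      g i * aeval g (mkDerivation T (fun k => w i k • (X k : MvPolynomial ι T)) p) := by
    intro i p
    induction p using MvPolynomial.induction_on with
    | C a =>
      have : br (g i) (algebraMap T L a) = 0 := (h.hamiltonian hanti (g i)).map_algebraMap a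
      simpa using this
    | add p q hp hq => rw [map_add, h.add_right hanti, hp, hq, map_add, map_add, mul_add]
    | mul_X p k hp =>
      rw [map_mul, h.leibniz, hp, aeval_X, hw, Derivation.leibniz, mkDerivation_X]
      simp only [smul_eq_mul, map_add, map_mul, aeval_X, Algebra.smul_def, AlgHom.commutes]
      ring
  -- Induction on the number of monomials. Up to the unit g_i, the Hamiltonian of g_i acts
  -- diagonally; subtracting its eigenvalue at t deletes t and keeps s. Everything happens on the
  -- polynomial p, so algebraic independence of the g_i is not needed.
  have key : ∀ (N : ℕ) (p : MvPolynomial ι T), p.support.card ≤ N → p ≠ 0 → aeval g p ∈ I →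
      I = ⊤ := by
    intro N
    induction N with
    | zero =>
      intro p hp hp0 _
      exact absurd (support_eq_empty.1 (Finset.card_eq_zero.1 (Nat.le_zero.1 hp))) hp0
    | succ N ih =>
      intro p hp hp0 hpI
      obtain ⟨t, ht⟩ := (support_nonempty (p := p)).2 hp0
      by_cases hs : ∃ s ∈ p.support, s ≠ t
      · obtain ⟨s, hs, hst⟩ := hs
        obtain ⟨i, hi⟩ := hnd s t hst
        set p' := mkDerivation T (fun k => w i k • (X k : MvPolynomial ι T)) p -
          (∑ k, w i k * t k) • p with hp'
        have hcoeff : ∀ r, coeff r p' = (∑ k, w i k * r k - ∑ k, w i k * t k) * coeff r p := by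
          intro r
          rw [hp', coeff_sub, coeff_mkDerivation_smul_X, coeff_smul, smul_eq_mul, sub_mul]
        refine ih p' ?_ ?_ ?_
        · have hsub : p'.support ⊂ p.support := by
            refine Finset.ssubset_iff_subset_ne.2 ⟨fun r hr => ?_, fun he => ?_⟩
            · rw [mem_support_iff] at hr ⊢
              intro h0
              exact hr (by rw [hcoeff, h0, mul_zero])
            · rw [← he, mem_support_iff, hcoeff] at ht
              simp at ht
          have := Finset.card_lt_card hsub
          omega
        · refine ne_zero_iff.2 ⟨s, ?_⟩
          rw [hcoeff]
          exact mul_ne_zero (sub_ne_zero.2 hi) (mem_support_iff.1 hs)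
        · have h1 : g i * aeval g p' ∈ I := by
            have : g i * aeval g p' = br (g i) (aeval g p) -
                (g i * algebraMap T L (∑ k, w i k * t k)) * aeval g p := by
              rw [hder, hp', map_sub, map_smul, Algebra.smul_def]
              ring
            rw [this]
            exact I.sub_mem (hI _ _ hpI) (I.mul_mem_left _ hpI)
          exact (I.unit_mul_mem_iff_mem (hg i)).1 h1
      · push Not at hs
        have hpt : p = monomial t (coeff t p) := by
          ext r
          rw [coeff_monomial]
          split_ifs with hr
          · rw [hr]
          · by_contra hc
            exact hr (hs r (mem_support_iff.2 hc)).symm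
        rw [hpt, aeval_monomial] at hpI
        refine I.eq_top_of_isUnit_mem hpI (IsUnit.mul ?_ ?_)
        · exact (IsUnit.mk0 _ (mem_support_iff.1 ht)).map (algebraMap T L)
        · rw [Finsupp.prod]
          exact IsUnit.prod_iff.2 fun i _ => (hg i).pow _
  by_cases hbot : I = ⊥
  · exact Or.inl hbot
  · right
    obtain ⟨l, hl, hl0⟩ := Submodule.exists_mem_ne_zero_of_ne_bot hbot
    obtain ⟨u, p, hu, hup⟩ := hgen l
    refine key _ p le_rfl ?_ (hup ▸ I.mul_mem_left u hl)
    rintro rfl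
    rw [map_zero] at hup
    exact hl0 ((hu.mul_right_eq_zero).1 hup)

end LogCanonical

/-! ### Poisson normal elements of a domain. -/

section Normal

variable {T P : Type*} [CommRing T] [CommRing P] [IsDomain P] [Algebra T P] {br : P → P → P}
  (h : IsPoissonBracket T br) (hanti : ∀ a b, br a b = -br b a)

include h hanti

/-- The derivation is ∂ = {f, ·} / f. Divided by f, the Jacobi identity says that ∂ respects the
bracket: the two cross terms f ∂(a) ∂(b) cancel. -/
theorem isPoissonNormal_of_dvd {f : P} (hf : f ≠ 0) (hdvd : ∀ a, f ∣ br f a) :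
    IsPoissonNormal T br f := by
  choose D hD using hdvd
  have hc : ∀ {a b : P}, f * a = f * b → a = b := fun e => mul_left_cancel₀ hf e
  refine ⟨Derivation.mk' { toFun := D, map_add' := fun a b => ?_, map_smul' := fun t a => ?_ }
    fun a b => ?_, fun a b => ?_, hD⟩
  · apply hc
    rw [← hD, h.add_right hanti, hD, hD, mul_add]
  · apply hc
    rw [← hD, h.smul_right hanti, hD, mul_smul_comm, RingHom.id_apply]
  · apply hc
    change f * D (a * b) = f * (a * D b + b * D a)
    rw [← hD, h.leibniz, hD, hD]
    ring
  · apply hc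
    change f * D (br a b) = f * (br (D a) b + br a (D b))
    have j := h.jacobi f a b
    rw [hanti b f, h.neg_right hanti, hanti b (br f a), hD a, hD b, h.leibniz,
      h.leibniz_left hanti, hanti a f, hD a, hD b, hD (br a b)] at j
    linear_combination j

end Normal

/-! ### The center as an abstract Poisson polynomial algebra; primality of the Z_j. -/

section WeylCenter

open MvPolynomial

/-- A commutative algebra with a Poisson bracket that behaves as the center of a quantized Weyl
algebra at a root of unity: a polynomial algebra on `X_j, Y_j`, with distinguished elements
`Z_i` that form a log-canonical system together with the `X_j`. -/
structure WeylCenterData (T : Type*) [Field T] (n : ℕ) (S : Type*) [CommRing S] [Algebra T S] where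
  br : S → S → S
  isPoisson : IsPoissonBracket T br
  anti : ∀ a b, br a b = -br b a
  equiv : MvPolynomial (Fin n ⊕ Fin n) T ≃ₐ[T] S
  Z : ℕ → S
  c : Fin n → T
  e : Fin n → ℕ
  c_ne : ∀ j, c j ≠ 0
  Z_zero : Z 0 = 1
  Z_succ : ∀ j : Fin n,
    Z (j + 1) = -(c j • (equiv (X (Sum.inr j)) * equiv (X (Sum.inl j)))) + Z j ^ e j
  wXX : Fin n → Fin n → T
  wXZ : Fin n → Fin n → T
  br_X_X : ∀ j k, br (equiv (X (Sum.inl j))) (equiv (X (Sum.inl k))) =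
    wXX j k • (equiv (X (Sum.inl j)) * equiv (X (Sum.inl k)))
  br_X_Z : ∀ j k : Fin n, br (equiv (X (Sum.inl j))) (Z (k + 1)) =
    wXZ j k • (equiv (X (Sum.inl j)) * Z (k + 1))
  br_Z_Z : ∀ j k : Fin n, br (Z (j + 1)) (Z (k + 1)) = 0
  wXZ_eq_zero : ∀ j k : Fin n, k < j → wXZ j k = 0
  wXZ_ne_zero : ∀ j k : Fin n, j ≤ k → wXZ j k ≠ 0

namespace WeylCenterData

variable {T : Type*} [Field T] {n : ℕ} {S : Type*} [CommRing S] [Algebra T S]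
  (W : WeylCenterData T n S)

/-- The polynomial generator `X_j`. -/
def x (j : Fin n) : S := W.equiv (X (Sum.inl j))

/-- The polynomial generator `Y_j`. -/
def y (j : Fin n) : S := W.equiv (X (Sum.inr j))

include W in
theorem isDomain : IsDomain S := W.equiv.symm.toMulEquiv.isDomain _

theorem prime_x (j : Fin n) : Prime (W.x j) :=
  (MulEquiv.prime_iff W.equiv).2 (X_prime)

/-- Evaluation at the origin. -/
def atZero : S →ₐ[T] T := (aeval fun _ => (0 : T)).comp W.equiv.symm.toAlgHom

theorem atZero_x (j : Fin n) : W.atZero (W.x j) = 0 := by simp [atZero, x]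

theorem atZero_Z (i : ℕ) (hi : i ≤ n) : W.atZero (W.Z i) = 1 := by
  induction i with
  | zero => simp [W.Z_zero]
  | succ i ih =>
    have := W.Z_succ ⟨i, hi⟩
    simp only at this
    rw [this, map_add, map_neg, map_smul, map_mul, map_pow, ih (by omega)]
    have h0 := W.atZero_x ⟨i, hi⟩
    rw [x] at h0
    simp [h0]

/-- Z_i has constant term 1, whereas X_j vanishes at the origin. -/
theorem not_x_dvd_Z (j : Fin n) (i : ℕ) (hi : i ≤ n) : ¬ W.x j ∣ W.Z i := by
  rintro ⟨a, ha⟩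
  have := congrArg W.atZero ha
  rw [W.atZero_Z i hi, map_mul, W.atZero_x, zero_mul] at this
  exact one_ne_zero this

theorem vars_Z (i : ℕ) (hi : i ≤ n) :
    W.equiv.symm (W.Z i) ∈
      supported T {s : Fin n ⊕ Fin n | ((Sum.elim id id s : Fin n) : ℕ) < i} := by
  induction i with
  | zero => rw [W.Z_zero, map_one]; exact one_mem _
  | succ i ih =>
    have h₁ := W.Z_succ ⟨i, hi⟩
    simp only at h₁
    have hmono := supported_mono (R := T)
      (show {s : Fin n ⊕ Fin n | ((Sum.elim id id s : Fin n) : ℕ) < i} ⊆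
        {s : Fin n ⊕ Fin n | ((Sum.elim id id s : Fin n) : ℕ) < i + 1} from
          fun s hs => Nat.lt_succ_of_lt hs)
    rw [h₁, map_add, map_neg, map_smul, map_mul, map_pow, AlgEquiv.symm_apply_apply,
      AlgEquiv.symm_apply_apply]
    refine add_mem (neg_mem (Subalgebra.smul_mem _ (mul_mem ?_ ?_) _))
      (pow_mem (hmono (ih (by omega))) _)
    · exact X_mem_supported.2 (by simp)
    · exact X_mem_supported.2 (by simp)

/-- As a polynomial in Y_j this is linear, with leading coefficient a scalar times X_j and constant
term a power of Z_j, which involves only variables of smaller index. X_j does not divide Z_j, so the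
two coefficients are coprime, and a primitive linear polynomial is irreducible. -/
theorem prime_Z (j : Fin n) : Prime (W.Z (j + 1)) := by
  have := W.isDomain
  rw [← W.equiv.apply_symm_apply (W.Z (j + 1)), MulEquiv.prime_iff W.equiv,
    ← irreducible_iff_prime]
  have h₁ : W.equiv.symm (W.Z (j + 1)) =
      ((-W.c j) • X (Sum.inl j)) * X (Sum.inr j) + W.equiv.symm (W.Z j) ^ W.e j := by
    rw [W.Z_succ, map_add, map_neg, map_smul, map_mul, map_pow, AlgEquiv.symm_apply_apply,
      AlgEquiv.symm_apply_apply, smul_mul_assoc, neg_smul, mul_comm]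
  rw [h₁]
  have hnv : ∀ k, Sum.elim id id k = j → k ∉ (W.equiv.symm (W.Z j) ^ W.e j).vars := by
    intro k hk hk'
    have h2 := mem_supported.1 (pow_mem (W.vars_Z j j.2.le) (W.e j)) hk'
    simp [hk] at h2
  have hC : ((-W.c j) • X (Sum.inl j) : MvPolynomial (Fin n ⊕ Fin n) T) =
      C (-W.c j) * X (Sum.inl j) := by rw [smul_eq_C_mul]
  have hu : IsUnit (C (-W.c j) : MvPolynomial (Fin n ⊕ Fin n) T) :=
    (IsUnit.mk0 _ (neg_ne_zero.2 (W.c_ne j))).map C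
  refine irreducible_mul_X_add _ _ _ ?_ ?_ (hnv _ rfl) ?_
  · rw [hC]
    exact mul_ne_zero hu.ne_zero (X_ne_zero _)
  · rw [hC]
    intro h2
    have h3 := vars_mul _ _ h2
    simp at h3
  · rw [hC]
    have hirr : Irreducible (C (-W.c j) * X (Sum.inl j) : MvPolynomial (Fin n ⊕ Fin n) T) :=
      (irreducible_isUnit_mul hu).2 (X_prime).irreducible
    refine (hirr.isRelPrime_iff_not_dvd).2 fun h2 => ?_
    have h3 : (X (Sum.inl j) : MvPolynomial (Fin n ⊕ Fin n) T) ∣ W.equiv.symm (W.Z j) :=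
      (X_prime).dvd_of_dvd_pow ((dvd_mul_left _ _).trans h2)
    apply W.not_x_dvd_Z j j j.2.le
    have := map_dvd W.equiv h3
    rwa [AlgEquiv.apply_symm_apply] at this

end WeylCenterData

end WeylCenter
end

/-! ### Simplicity of the localization and Poisson primes of the abstract center. -/

noncomputable section

namespace WeylCenterData

open MvPolynomial

variable {T : Type*} [Field T] {n : ℕ} {S : Type*} [CommRing S] [Algebra T S]
  (W : WeylCenterData T n S)

/-- The log-canonical system `X_j, Z_{j+1}`. -/
def gen : Fin n ⊕ Fin n → S := Sum.elim W.x fun j => W.Z (j + 1)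

/-- The coefficient matrix of the log-canonical system. -/
def weight : Fin n ⊕ Fin n → Fin n ⊕ Fin n → T
  | Sum.inl j, Sum.inl k => W.wXX j k
  | Sum.inl j, Sum.inr k => W.wXZ j k
  | Sum.inr k, Sum.inl j => -W.wXZ j k
  | Sum.inr _, Sum.inr _ => 0

theorem br_gen (s t : Fin n ⊕ Fin n) :
    W.br (W.gen s) (W.gen t) = W.weight s t • (W.gen s * W.gen t) := by
  rcases s with j | j <;> rcases t with k | k
  · exact W.br_X_X j k
  · exact W.br_X_Z j k
  · rw [W.anti]
    refine (congrArg Neg.neg (W.br_X_Z k j)).trans ?_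
    simp only [weight, gen, Sum.elim_inl, Sum.elim_inr, neg_smul, mul_comm, x]
  · exact (W.br_Z_Z j k).trans (zero_smul _ _).symm

/-- The matrix has a zero ZZ-block and triangular off-diagonal blocks with nonzero diagonal. The
rows of the Z's therefore detect the X-exponents (look at the smallest index of disagreement), and
the rows of the X's then detect the Z-exponents (look at the largest). Characteristic 0 makes
equality of exponents in T equality in ℕ. -/
theorem weight_nondegenerate [CharZero T] (s t : Fin n ⊕ Fin n →₀ ℕ) (hst : s ≠ t) :
    ∃ i, ∑ k, W.weight i k * s k ≠ ∑ k, W.weight i k * t k := by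
  classical
  by_contra! hall
  have hinl : ∀ j, s (Sum.inl j) = t (Sum.inl j) := by
    by_contra! hne
    obtain ⟨j, hj, hmin⟩ : ∃ j, s (Sum.inl j) ≠ t (Sum.inl j) ∧
        ∀ k < j, s (Sum.inl k) = t (Sum.inl k) := by
      have hne' : (Finset.univ.filter fun j => s (Sum.inl j) ≠ t (Sum.inl j)).Nonempty := by
        obtain ⟨j, hj⟩ := hne
        exact ⟨j, by simpa using hj⟩
      refine ⟨_, (Finset.mem_filter.1 (Finset.min'_mem _ hne')).2, fun k hk => ?_⟩
      by_contra hk'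
      exact absurd (Finset.min'_le _ k (by simpa using hk')) (not_le.2 hk)
    have h := hall (Sum.inr j)
    rw [Fintype.sum_sum_type, Fintype.sum_sum_type, ← sub_eq_zero] at h
    simp only [weight, zero_mul, Finset.sum_const_zero, add_zero] at h
    rw [← Finset.sum_sub_distrib, Finset.sum_eq_single j] at h
    · rw [← mul_sub] at h
      rcases mul_eq_zero.1 h with h | h
      · exact W.wXZ_ne_zero j j le_rfl (neg_eq_zero.1 h)
      · exact hj (Nat.cast_injective (sub_eq_zero.1 h))
    · intro k _ hk
      rcases lt_or_gt_of_ne hk with hk | hk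
      · rw [hmin k hk, sub_self]
      · rw [W.wXZ_eq_zero k j hk]; simp
    · simp
  have hinr : ∀ j, s (Sum.inr j) = t (Sum.inr j) := by
    by_contra! hne
    obtain ⟨j, hj, hmax⟩ : ∃ j, s (Sum.inr j) ≠ t (Sum.inr j) ∧
        ∀ k > j, s (Sum.inr k) = t (Sum.inr k) := by
      have hne' : (Finset.univ.filter fun j => s (Sum.inr j) ≠ t (Sum.inr j)).Nonempty := by
        obtain ⟨j, hj⟩ := hne
        exact ⟨j, by simpa using hj⟩
      refine ⟨_, (Finset.mem_filter.1 (Finset.max'_mem _ hne')).2, fun k hk => ?_⟩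
      by_contra hk'
      exact absurd (Finset.le_max' _ k (by simpa using hk')) (not_le.2 hk)
    have h := hall (Sum.inl j)
    rw [Fintype.sum_sum_type, Fintype.sum_sum_type, ← sub_eq_zero] at h
    simp only [weight, hinl, add_sub_add_left_eq_sub] at h
    rw [← Finset.sum_sub_distrib, Finset.sum_eq_single j] at h
    · rw [← mul_sub] at h
      rcases mul_eq_zero.1 h with h | h
      · exact W.wXZ_ne_zero j j le_rfl h
      · exact hj (Nat.cast_injective (sub_eq_zero.1 h))
    · intro k _ hk
      rcases lt_or_gt_of_ne hk with hk | hk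
      · rw [W.wXZ_eq_zero j k hk]; simp
      · rw [hmax k hk, sub_self]
    · simp
  exact hst (Finsupp.ext fun i => by rcases i with j | j; exacts [hinl j, hinr j])

theorem gen_ne_zero (s : Fin n ⊕ Fin n) : W.gen s ≠ 0 := by
  rcases s with j | j
  · exact (W.prime_x j).ne_zero
  · exact (W.prime_Z j).ne_zero

/-- The submonoid generated by all `X_j` and `Z_j`. -/
abbrev denominators : Submonoid S :=
  Submonoid.closure (Set.range W.x ∪ Set.range fun j : Fin n => W.Z (j + 1))

theorem gen_mem (s : Fin n ⊕ Fin n) : W.gen s ∈ W.denominators := by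
  apply Submonoid.subset_closure
  rw [← Set.Sum.elim_range]
  exact ⟨s, rfl⟩

theorem denominators_le_nonZeroDivisors : W.denominators ≤ nonZeroDivisors S := by
  have := W.isDomain
  refine Submonoid.closure_le.2 fun a ha => ?_
  rw [← Set.Sum.elim_range] at ha
  obtain ⟨s, rfl⟩ := ha
  exact mem_nonZeroDivisors_of_ne_zero (W.gen_ne_zero s)

theorem denominators_le_range {a : S} (ha : a ∈ W.denominators) :
    ∃ p : MvPolynomial (Fin n ⊕ Fin n) T, a = aeval W.gen p := by
  induction ha using Submonoid.closure_induction with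
  | mem a ha =>
    rw [← Set.Sum.elim_range] at ha
    obtain ⟨s, rfl⟩ := ha
    exact ⟨X s, by rw [aeval_X]; rfl⟩
  | one => exact ⟨1, by simp⟩
  | mul a b _ _ ha hb =>
    obtain ⟨p, rfl⟩ := ha
    obtain ⟨q, rfl⟩ := hb
    exact ⟨p * q, by simp⟩

theorem x_mul_y (j : Fin n) : W.x j * W.y j = (W.c j)⁻¹ • (W.Z j ^ W.e j - W.Z (j + 1)) := by
  rw [W.Z_succ, sub_add_cancel_right, neg_neg, smul_smul, inv_mul_cancel₀ (W.c_ne j), one_smul,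
    mul_comm]
  rfl

/-- By `x_mul_y`, multiplication by X_j turns Y_j into a polynomial in the Z's, so enough factors
X_j remove every Y_j. -/
theorem exists_mul_eq_aeval_gen (a : S) :
    ∃ m ∈ W.denominators, ∃ p : MvPolynomial (Fin n ⊕ Fin n) T, m * a = aeval W.gen p := by
  obtain ⟨f, rfl⟩ := W.equiv.surjective a
  induction f using MvPolynomial.induction_on with
  | C t =>
    refine ⟨1, one_mem _, C t, ?_⟩
    rw [one_mul, algHom_C, ← algebraMap_eq, AlgEquiv.commutes]
  | add f g hf hg =>
    obtain ⟨m₁, hm₁, p₁, h₁⟩ := hf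
    obtain ⟨m₂, hm₂, p₂, h₂⟩ := hg
    obtain ⟨q₁, hq₁⟩ := W.denominators_le_range hm₁
    obtain ⟨q₂, hq₂⟩ := W.denominators_le_range hm₂
    refine ⟨m₁ * m₂, mul_mem hm₁ hm₂, q₂ * p₁ + q₁ * p₂, ?_⟩
    rw [map_add, map_add, map_mul, map_mul, ← h₁, ← h₂, ← hq₁, ← hq₂]
    ring
  | mul_X f s hf =>
    obtain ⟨m, hm, p, h⟩ := hf
    rcases s with j | j
    · refine ⟨m, hm, p * X (Sum.inl j), ?_⟩
      rw [map_mul, map_mul, ← mul_assoc, h, aeval_X]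
      rfl
    · have hZ : ∃ r : MvPolynomial (Fin n ⊕ Fin n) T, W.Z j = aeval W.gen r := by
        obtain ⟨i, hi⟩ := j
        cases i with
        | zero => exact ⟨1, by simp [W.Z_zero]⟩
        | succ i => exact ⟨X (Sum.inr ⟨i, by omega⟩), by rw [aeval_X]; rfl⟩
      obtain ⟨r, hr⟩ := hZ
      refine ⟨m * W.x j, mul_mem hm (W.gen_mem (Sum.inl j)),
        p * ((W.c j)⁻¹ • (r ^ W.e j - X (Sum.inr j))), ?_⟩
      rw [map_mul, map_mul, map_smul, map_sub, map_pow, ← hr, aeval_X]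
      change _ = _ * ((W.c j)⁻¹ • (W.Z j ^ W.e j - W.Z (j + 1)))
      rw [← x_mul_y, ← h]
      simp only [y]
      ring

theorem br_ne_zero (j : Fin n) : W.br (W.x j) (W.Z (j + 1)) ≠ 0 := by
  have := W.isDomain
  have h := W.br_X_Z j j
  change W.br (W.x j) _ = _ at h
  rw [h]
  exact smul_ne_zero (W.wXZ_ne_zero j j le_rfl) (mul_ne_zero (W.prime_x j).ne_zero
    (W.prime_Z j).ne_zero)

theorem exists_localized_bracket :
    ∃ br : Localization W.denominators → Localization W.denominators → Localization W.denominators,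
      IsLocalizedPoissonBracket T W.br W.denominators br ∧ (∀ a b, br a b = -br b a) := by
  obtain ⟨br, h₁, h₂, h₃⟩ := W.isPoisson.exists_extension (L := Localization W.denominators)
    W.denominators W.anti
  exact ⟨br, ⟨h₁, h₃⟩, h₂⟩

theorem isPoissonSimple_localization [CharZero T]
    {br : Localization W.denominators → Localization W.denominators → Localization W.denominators}
    (h : IsLocalizedPoissonBracket T W.br W.denominators br) (hanti : ∀ a b, br a b = -br b a) :
    IsPoissonSimple br := by
  have := W.isDomain
  have : IsDomain (Localization W.denominators) :=
    IsLocalization.isDomain_localization W.denominators_le_nonZeroDivisors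
  refine isPoissonSimple_of_logCanonical h.1 hanti
    (fun s => algebraMap S (Localization W.denominators) (W.gen s))
    (fun s => IsLocalization.map_units _ (⟨_, W.gen_mem s⟩ : W.denominators)) W.weight
    (fun s t => ?_) W.weight_nondegenerate fun l => ?_
  · rw [h.2, br_gen, Algebra.smul_def, Algebra.smul_def, map_mul, map_mul,
      ← IsScalarTower.algebraMap_apply]
  · obtain ⟨⟨a, m⟩, hm⟩ := IsLocalization.surj W.denominators l
    obtain ⟨m', hm', p, hp⟩ := W.exists_mul_eq_aeval_gen a
    refine ⟨algebraMap S _ (m * m'), p, IsLocalization.map_units _ (m * ⟨m', hm'⟩), ?_⟩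
    have : aeval (fun s => algebraMap S (Localization W.denominators) (W.gen s)) p =
        algebraMap S (Localization W.denominators) (aeval W.gen p) :=
      (aeval_algebraMap_apply (Localization W.denominators) W.gen p)
    rw [this, ← hp, map_mul, map_mul, ← hm]
    ring

/-- Positivity of n provides a nonzero bracket, that of the first X and the first Z, without which
`eq_of_extends` does not apply. -/
theorem exists_unique_localized_bracket [CharZero T] (hn : 0 < n) :
    ∃ br, IsLocalizedPoissonBracket T W.br W.denominators br ∧
      (∀ br', IsLocalizedPoissonBracket T W.br W.denominators br' → br' = br) ∧
      IsPoissonSimple br := by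
  have := W.isDomain
  have : IsDomain (Localization W.denominators) :=
    IsLocalization.isDomain_localization W.denominators_le_nonZeroDivisors
  obtain ⟨br, hbr, hanti⟩ := W.exists_localized_bracket
  refine ⟨br, hbr, fun br' hbr' => ?_, W.isPoissonSimple_localization hbr hanti⟩
  refine IsPoissonBracket.eq_of_extends W.denominators ?_ hbr.1 hanti hbr'.1 hbr.2 hbr'.2
    ⟨W.x ⟨0, hn⟩, W.Z (((⟨0, hn⟩ : Fin n) : ℕ) + 1), fun h0 => W.br_ne_zero ⟨0, hn⟩ ?_⟩
  · have : algebraMap T (Localization W.denominators) 2 ≠ 0 :=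
      (map_ne_zero_iff _ (algebraMap T _).injective).2 two_ne_zero
    rwa [map_ofNat] at this
  · exact (map_eq_zero_iff _ (IsLocalization.injective _ W.denominators_le_nonZeroDivisors)).1 h0

/-- X_k Y_k is a polynomial in the Z's, so it has bracket 0 with Z_{j+1}. Hence {Z_{j+1}, Y_k} is
determined by {Z_{j+1}, X_k} after cancelling X_k, and is again a scalar multiple of Z_{j+1} Y_k.
Divisibility on the generators suffices. -/
theorem isPoissonNormal_Z (j : Fin n) : IsPoissonNormal T W.br (W.Z (j + 1)) := by
  have := W.isDomain
  have hX : ∀ k, W.Z (j + 1) ∣ W.br (W.Z (j + 1)) (W.x k) := fun k => by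
    have h := W.br_gen (Sum.inr j) (Sum.inl k)
    simp only [gen, Sum.elim_inr, Sum.elim_inl] at h
    rw [h]
    exact dvd_smul_of_dvd _ (dvd_mul_right _ _)
  have hZ : ∀ i ≤ n, W.br (W.Z (j + 1)) (W.Z i) = 0 := fun i hi => by
    cases i with
    | zero =>
      rw [W.Z_zero]
      exact (W.isPoisson.hamiltonian W.anti _).map_one_eq_zero
    | succ i => exact W.br_Z_Z j ⟨i, hi⟩
  have hY : ∀ k, W.Z (j + 1) ∣ W.br (W.Z (j + 1)) (W.y k) := fun k => by
    have h := W.isPoisson.leibniz (W.Z (j + 1)) (W.x k) (W.y k)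
    have h0 : W.br (W.Z (j + 1)) (W.x k * W.y k) = 0 := by
      rw [x_mul_y, ← W.isPoisson.hamiltonian_apply W.anti, Derivation.map_smul, map_sub,
        Derivation.leibniz_pow, W.isPoisson.hamiltonian_apply, W.isPoisson.hamiltonian_apply,
        hZ _ k.2.le, hZ _ k.2]
      simp
    rw [h0] at h
    have h1 := W.br_gen (Sum.inr j) (Sum.inl k)
    simp only [gen, Sum.elim_inr, Sum.elim_inl] at h1
    rw [h1] at h
    have hx := (W.prime_x k).ne_zero
    refine ⟨-(W.weight (Sum.inr j) (Sum.inl k) • W.y k), mul_left_cancel₀ hx ?_⟩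
    rw [Algebra.smul_def] at h ⊢
    linear_combination -h
  refine isPoissonNormal_of_dvd W.isPoisson W.anti (W.prime_Z j).ne_zero fun a => ?_
  obtain ⟨f, rfl⟩ := W.equiv.surjective a
  induction f using MvPolynomial.induction_on with
  | C t =>
    have : W.br (W.Z (j + 1)) (W.equiv (C t)) = 0 := by
      rw [← algebraMap_eq, AlgEquiv.commutes]
      exact (W.isPoisson.hamiltonian W.anti _).map_algebraMap t
    rw [this]
    exact dvd_zero _
  | add f g hf hg =>
    rw [map_add, W.isPoisson.add_right W.anti]
    exact dvd_add hf hg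
  | mul_X f s hf =>
    rw [map_mul, W.isPoisson.leibniz]
    refine dvd_add (hf.mul_right _) (Dvd.dvd.mul_left ?_ _)
    rcases s with k | k
    exacts [hX k, hY k]

/-- Units of a polynomial algebra over a field are scalars, so the Poisson derivation that serves
Z_{j+1} serves every associate. -/
theorem isPoissonPrime_of_associated {f : S} {j : Fin n} (h : Associated f (W.Z (j + 1))) :
    IsPoissonPrime T W.br f := by
  have := W.isDomain
  refine ⟨h.symm.prime (W.prime_Z j), ?_⟩
  obtain ⟨D, hD, hbr⟩ := W.isPoissonNormal_Z j
  obtain ⟨u, hu⟩ := h.symm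
  have hu' : IsUnit (W.equiv.symm u) := u.isUnit.map W.equiv.symm
  obtain ⟨t, -, ht⟩ := isUnit_iff_eq_C_of_isReduced.1 hu'
  have hut : (u : S) = algebraMap T S t := by
    rw [← W.equiv.commutes, algebraMap_eq, ← ht, AlgEquiv.apply_symm_apply]
  refine ⟨D, hD, fun a => ?_⟩
  rw [← hu, hut, mul_comm, ← Algebra.smul_def, W.isPoisson.smul_left, hbr, smul_mul_assoc]

/-- Bracketing X_j with X_j Y_j = c⁻¹ (Z_j^e - Z_{j+1}), where {X_j, Z_j} = 0, shows that {X_j, Y_j}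
is a nonzero scalar multiple of Z_{j+1}. Normality would make it divisible by X_j. -/
theorem not_isPoissonNormal_x (j : Fin n) {f : S} (hf : Associated f (W.x j)) :
    ¬ IsPoissonNormal T W.br f := by
  have := W.isDomain
  rintro ⟨D, -, hD⟩
  obtain ⟨u, hu⟩ := hf
  have hdvd : W.x j ∣ W.br (W.x j) (W.y j) := by
    have h1 : W.x j ∣ f := ⟨↑u⁻¹, by rw [← hu]; simp⟩
    have h2 := W.isPoisson.leibniz_left W.anti f u (W.y j)
    rw [hu] at h2
    rw [h2, hD, mul_assoc, ← mul_add]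
    exact h1.mul_right _
  have hZ0 : ∀ i : Fin n, (i : ℕ) ≤ j → W.br (W.x j) (W.Z i) = 0 := fun i hi => by
    obtain ⟨i, hi'⟩ := i
    cases i with
    | zero =>
      simp only [W.Z_zero]
      exact (W.isPoisson.hamiltonian W.anti _).map_one_eq_zero
    | succ i =>
      have h := W.br_X_Z j ⟨i, by omega⟩
      rw [W.wXZ_eq_zero _ _ (Fin.lt_def.2 (Nat.lt_of_succ_le hi)), zero_smul] at h
      exact h
  have h3 : W.x j * W.br (W.x j) (W.y j) =
      W.x j * (-((W.c j)⁻¹ • (W.wXZ j j • W.Z (j + 1)))) := by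
    have h4 : W.br (W.x j) (W.x j * W.y j) = W.x j * W.br (W.x j) (W.y j) := by
      rw [W.isPoisson.leibniz, W.isPoisson.alternating, zero_mul, zero_add]
    have h5 : W.br (W.x j) (W.Z (j + 1)) = W.wXZ j j • (W.x j * W.Z (j + 1)) := W.br_X_Z j j
    rw [← h4, x_mul_y, ← W.isPoisson.hamiltonian_apply W.anti, Derivation.map_smul, map_sub,
      Derivation.leibniz_pow, W.isPoisson.hamiltonian_apply, W.isPoisson.hamiltonian_apply,
      hZ0 _ le_rfl, h5]
    simp
  rw [mul_left_cancel₀ (W.prime_x j).ne_zero h3, dvd_neg, smul_smul] at hdvd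
  refine W.not_x_dvd_Z j (j + 1) j.2 ?_
  have hc : (W.c j)⁻¹ * W.wXZ j j ≠ 0 :=
    mul_ne_zero (inv_ne_zero (W.c_ne j)) (W.wXZ_ne_zero j j le_rfl)
  have h6 := dvd_smul_of_dvd ((W.c j)⁻¹ * W.wXZ j j)⁻¹ hdvd
  rwa [smul_smul, inv_mul_cancel₀ hc, one_smul] at h6

/-- Normality makes the ideal of f in the localization a Poisson ideal; by simplicity f becomes a
unit, so f divides a product of X's and Z's and, being prime, is associated to one factor. -/
theorem isPoissonPrime_iff [CharZero T] (f : S) :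
    IsPoissonPrime T W.br f ↔ ∃ j : Fin n, Associated f (W.Z (j + 1)) := by
  have := W.isDomain
  refine ⟨fun ⟨hp, hnorm⟩ => ?_, fun ⟨j, hj⟩ => W.isPoissonPrime_of_associated hj⟩
  obtain ⟨br, hbr, hanti⟩ := W.exists_localized_bracket
  obtain ⟨-, hsimple⟩ := W.isPoissonSimple_localization hbr hanti
  let L := Localization W.denominators
  obtain ⟨D, hDP, hD⟩ := hnorm
  have hinj : Function.Injective (algebraMap S L) :=
    IsLocalization.injective _ W.denominators_le_nonZeroDivisors
  have hext : ∀ l : L, algebraMap S L f ∣ br (algebraMap S L f) l := fun l => by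
    obtain ⟨⟨a, m⟩, hm⟩ := IsLocalization.surj W.denominators l
    have h1 := hbr.1.leibniz (algebraMap S L f) l (algebraMap S L m)
    rw [hm, hbr.2, hbr.2, hD, hD, map_mul, map_mul] at h1
    have hu : IsUnit (algebraMap S L m) := IsLocalization.map_units L m
    refine (hu.dvd_mul_right).1 ⟨algebraMap S L (D a) - l * algebraMap S L (D m), ?_⟩
    linear_combination -h1
  have hideal : IsPoissonIdeal br (Ideal.span {algebraMap S L f}) := fun a b hb => by
    rw [Ideal.mem_span_singleton] at hb ⊢
    obtain ⟨c, rfl⟩ := hb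
    rw [hbr.1.leibniz, hanti a]
    exact dvd_add (Dvd.dvd.mul_right ((dvd_neg).2 (hext a)) _) (dvd_mul_right _ _)
  rcases hsimple _ hideal with h | h
  · rw [Ideal.span_singleton_eq_bot, map_eq_zero_iff _ hinj] at h
    exact absurd h hp.ne_zero
  · rw [Ideal.span_singleton_eq_top] at h
    obtain ⟨v, hv⟩ := h.exists_right_inv
    obtain ⟨⟨a, m⟩, hm⟩ := IsLocalization.surj W.denominators v
    have hfa : f * a = m := hinj (by
      rw [map_mul, ← hm, ← mul_assoc, hv, one_mul])
    have hdm : f ∣ (m : S) := ⟨a, hfa.symm⟩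
    have hall : ∀ m ∈ W.denominators, f ∣ m → ∃ s, f ∣ W.gen s := by
      intro m hm
      induction hm using Submonoid.closure_induction with
      | mem a ha =>
        rw [← Set.Sum.elim_range] at ha
        obtain ⟨s, rfl⟩ := ha
        exact fun h => ⟨s, h⟩
      | one => exact fun h => absurd (isUnit_of_dvd_one h) hp.not_isUnit
      | mul a b _ _ ha hb => exact fun h => (hp.dvd_or_dvd h).elim ha hb
    obtain ⟨s, hs⟩ := hall m m.2 hdm
    rcases s with j | j
    · exact absurd ⟨D, hDP, hD⟩ (W.not_isPoissonNormal_x j (hp.associated_of_dvd (W.prime_x j) hs))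
    · exact ⟨j, hp.associated_of_dvd (W.prime_Z j) hs⟩

end WeylCenterData
end

noncomputable section

/-! ### A representation of the quantized Weyl algebra by a quantum torus -/

namespace RootData

variable {n : ℕ} (p : RootData n)

/-- The exponent of `ε_j`. -/
def epsExp (j : Fin n) : ℤ := ((p.D / p.d j * p.m j : ℕ) : ℤ)

/-- The exponent of `β_{jk}`. -/
def betaExp (j k : Fin n) : ℤ := ((p.D / p.dd j k : ℕ) : ℤ) * p.mm j k

theorem eps_eq {R : Type*} [CommRing R] (u : Rˣ) (j : Fin n) : p.eps u j = u ^ p.epsExp j := by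
  rw [epsExp, zpow_natCast]
  rfl

theorem beta_eq {R : Type*} [CommRing R] (u : Rˣ) (j k : Fin n) :
    p.beta u j k = u ^ p.betaExp j k := rfl

theorem betaExp_skew (j k : Fin n) : p.betaExp j k = -p.betaExp k j := by
  rw [betaExp, betaExp, p.dd_symm, p.mm_skew, mul_neg]

theorem betaExp_self (j : Fin n) : p.betaExp j j = 0 := by
  have := p.betaExp_skew j j
  omega

/-- Exponents `(v, c)` of the monomials `z^v x^c` of the quantum torus. -/
abbrev Lattice (n : ℕ) : Type := (Fin n → ℤ) × (Fin n → ℤ)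

/-- The bilinear form with `z^v x^c * z^{v'} x^{c'} = u^{form} z^{v+v'} x^{c+c'}`. -/
def form (α β : Lattice n) : ℤ :=
  -- Moving x_j to the right past z_{k+1} costs ε_j when j ≤ k. Moving it past x_k with k < j costs
  -- the inverse of ε_k β_{kj}, since the x's are normally ordered by increasing index.
  ∑ j, ∑ k, α.2 j * ((if j ≤ k then p.epsExp j else 0) * β.1 k +
    (if k < j then -(p.epsExp k + p.betaExp k j) else 0) * β.2 k)

theorem form_add_left (α α' β : Lattice n) : p.form (α + α') β = p.form α β + p.form α' β := by
  simp only [form, ← Finset.sum_add_distrib, Prod.snd_add, Pi.add_apply, add_mul]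

theorem form_add_right (α β β' : Lattice n) : p.form α (β + β') = p.form α β + p.form α β' := by
  simp only [form, ← Finset.sum_add_distrib, Prod.snd_add, Prod.fst_add, Pi.add_apply]
  refine Finset.sum_congr rfl fun j _ => Finset.sum_congr rfl fun k _ => ?_
  ring

theorem form_zero_left (β : Lattice n) : p.form 0 β = 0 := by simp [form]

theorem form_zero_right (α : Lattice n) : p.form α 0 = 0 := by simp [form]

theorem form_neg_left (α β : Lattice n) : p.form (-α) β = -p.form α β := by
  have := p.form_add_left α (-α) β
  rw [add_neg_cancel, form_zero_left] at this
  omega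

theorem form_neg_right (α β : Lattice n) : p.form α (-β) = -p.form α β := by
  have := p.form_add_right α β (-β)
  rw [add_neg_cancel, form_zero_right] at this
  omega

/-- The exponent of `z_i`, where `z_0 = 1`. -/
def zv (i : ℕ) : Lattice n := (fun k => if (k : ℕ) + 1 = i then 1 else 0, 0)

/-- The exponent of `x_j`. -/
def xv (j : Fin n) : Lattice n := (0, Pi.single j 1)

theorem zv_zero : (zv 0 : Lattice n) = 0 := by
  ext <;> simp [zv]

theorem form_zv_left (i : ℕ) (β : Lattice n) : p.form (zv i) β = 0 := by simp [form, zv]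

theorem form_xv_zv (j : Fin n) (i : ℕ) (hi : i ≤ n) :
    p.form (xv j) (zv i) = if (j : ℕ) < i then p.epsExp j else 0 := by
  classical
  rw [form, Finset.sum_eq_single j (fun k _ hk => by simp [xv, hk]) (by simp)]
  cases i with
  | zero => simp [zv]
  | succ i =>
    rw [Finset.sum_eq_single ⟨i, hi⟩]
    · simp [xv, zv, Fin.le_def]
    · intro k _ hk
      have : (k : ℕ) ≠ i := fun h => hk (Fin.ext h)
      simp [zv, this]
    · simp

theorem form_xv_xv (j k : Fin n) :
    p.form (xv j) (xv k) = if k < j then -(p.epsExp k + p.betaExp k j) else 0 := by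
  classical
  rw [form, Finset.sum_eq_single j (fun l _ hl => by simp [xv, hl]) (by simp),
    Finset.sum_eq_single k (fun l _ hl => by simp [xv, hl]) (by simp)]
  simp [xv]

/-- The algebra of endomorphisms of the space with the monomials of the quantum torus as basis. -/
def TorusEnd (K : Type*) [CommRing K] (n : ℕ) : Type _ := Module.End K (Lattice n →₀ K)

namespace TorusEnd

variable {K : Type*} [CommRing K]

instance : Ring (TorusEnd K n) := inferInstanceAs (Ring (Module.End K (Lattice n →₀ K)))

instance : Algebra K (TorusEnd K n) := inferInstanceAs (Algebra K (Module.End K (Lattice n →₀ K)))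

/-- The action on the space with the monomials of the quantum torus as basis. -/
def act : TorusEnd K n →ₗ[K] (Lattice n →₀ K) →ₗ[K] (Lattice n →₀ K) where
  toFun a := a
  map_add' _ _ := rfl
  map_smul' _ _ := rfl

theorem act_mul (a b : TorusEnd K n) (v : Lattice n →₀ K) : act (a * b) v = act a (act b v) := rfl

theorem act_one (v : Lattice n →₀ K) : act 1 v = v := rfl

theorem ext_single {a b : TorusEnd K n}
    (h : ∀ γ c, act a (Finsupp.single γ c) = act b (Finsupp.single γ c)) : a = b :=
  Finsupp.lhom_ext h

end TorusEnd

open TorusEnd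

section Torus

variable {K : Type*} [CommRing K] (u : Kˣ)

/-- Left multiplication by a monomial of the quantum torus. -/
def op (α : Lattice n) : TorusEnd K n :=
  Finsupp.linearCombination K fun β => Finsupp.single (α + β) ((u ^ p.form α β : Kˣ) : K)

theorem op_single (α β : Lattice n) (c : K) :
    act (p.op u α) (Finsupp.single β c) =
      Finsupp.single (α + β) (c * (u ^ p.form α β : Kˣ)) := by
  refine (Finsupp.linearCombination_single K c β).trans ?_
  rw [Finsupp.smul_single, smul_eq_mul]

/-- Bilinearity of `form` is the cocycle condition. Since the monomials are realized as operators,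
associativity of the torus is automatic. -/
theorem op_mul (α β : Lattice n) :
    p.op u α * p.op u β = ((u ^ p.form α β : Kˣ) : K) • p.op u (α + β) := by
  refine ext_single fun γ c => ?_
  rw [act_mul, op_single, op_single, map_smul, LinearMap.smul_apply, op_single,
    Finsupp.smul_single, add_assoc, smul_eq_mul, form_add_right, form_add_left, zpow_add, zpow_add]
  push_cast
  congr 1
  ring

theorem op_zero : p.op u 0 = 1 := by
  refine ext_single fun γ c => ?_
  rw [op_single, zero_add, form_zero_left, act_one]
  simp

theorem op_comm (α β : Lattice n) :
    p.op u α * p.op u β =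
      ((u ^ (p.form α β - p.form β α) : Kˣ) : K) • (p.op u β * p.op u α) := by
  rw [op_mul, op_mul, smul_smul, ← Units.val_mul, ← zpow_add, sub_add_cancel, add_comm]

theorem isUnit_op (α : Lattice n) : IsUnit (p.op u α) := by
  have h : ∀ α, p.op u α * p.op u (-α) = ((u ^ p.form α (-α) : Kˣ) : K) • 1 := fun α => by
    rw [op_mul, add_neg_cancel, op_zero]
  refine isUnit_iff_exists.2 ⟨((u ^ (-p.form α (-α)) : Kˣ) : K) • p.op u (-α), ?_, ?_⟩
  · rw [mul_smul_comm, h, smul_smul, ← Units.val_mul, ← zpow_add, neg_add_cancel, zpow_zero,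
      Units.val_one, one_smul]
  · have h' := h (-α)
    rw [neg_neg] at h'
    rw [smul_mul_assoc, h', smul_smul, ← Units.val_mul, ← zpow_add, form_neg_left, form_neg_right,
      neg_add_cancel, zpow_zero, Units.val_one, one_smul]

end Torus

section Representation

variable {K : Type*} [Field K] (u : Kˣ)

/-- The image of `y_j` in the quantum torus. -/
def yOp (j : Fin n) : TorusEnd K n :=
  -- Forced by (ε_j - 1) y_j x_j = z_{j+1} - z_j and invertibility of x_j; the monomials are z_{j+1}
  -- x_j⁻¹ and z_j x_j⁻¹.
  ((p.eps u j : K) - 1)⁻¹ • (p.op u (zv (j + 1) - xv j) - p.op u (zv j - xv j))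

theorem op_comm_zpow {α β : Lattice n} {N : ℤ} (h : p.form α β - p.form β α = N) :
    p.op u α * p.op u β = ((u ^ N : Kˣ) : K) • (p.op u β * p.op u α) := by
  rw [op_comm, h]

theorem form_sub_left (α α' β : Lattice n) : p.form (α - α') β = p.form α β - p.form α' β := by
  rw [sub_eq_add_neg, form_add_left, form_neg_left, sub_eq_add_neg]

theorem form_sub_right (α β β' : Lattice n) : p.form α (β - β') = p.form α β - p.form α β' := by
  rw [sub_eq_add_neg, form_add_right, form_neg_right, sub_eq_add_neg]

/-- Each y is a difference of two monomials, and all four products commute with the same scalar: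
x_j⁻¹ meets only z_b with b > j, and x_k⁻¹ only z_a with a ≤ k. -/
theorem yOp_comm_of_lt {j k : Fin n} (hjk : j < k) :
    p.yOp u j * p.yOp u k = (p.beta u j k : K) • (p.yOp u k * p.yOp u j) := by
  have key : ∀ a b : ℕ, a ≤ k → (j : ℕ) < b → b ≤ n →
      p.op u (zv a - xv j) * p.op u (zv b - xv k) =
        (p.beta u j k : K) • (p.op u (zv b - xv k) * p.op u (zv a - xv j)) := by
    intro a b ha hb hbn
    rw [beta_eq]
    apply op_comm_zpow
    simp only [form_sub_left, form_sub_right, form_zv_left]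
    rw [form_xv_zv _ _ _ hbn, form_xv_zv _ _ _ (ha.trans k.2.le), form_xv_xv, form_xv_xv,
      if_pos hb, if_neg (not_lt.2 hjk.le), if_pos hjk, if_neg (not_lt.2 ha)]
    ring
  have hjk' : (j : ℕ) < k := hjk
  simp only [yOp, smul_mul_assoc, mul_smul_comm, mul_sub, sub_mul]
  rw [key (j + 1) (k + 1) hjk' (by omega) k.2, key (j + 1) k hjk' (by omega) k.2.le,
    key j (k + 1) hjk'.le (by omega) k.2, key j k hjk'.le (by omega) k.2.le]
  module

theorem xOp_yOp_comm_of_lt {j k : Fin n} (hjk : j < k) :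
    p.op u (xv j) * p.yOp u k = (p.beta u k j : K) • (p.yOp u k * p.op u (xv j)) := by
  have key : ∀ b : ℕ, (j : ℕ) < b → b ≤ n →
      p.op u (xv j) * p.op u (zv b - xv k) =
        (p.beta u k j : K) • (p.op u (zv b - xv k) * p.op u (xv j)) := by
    intro b hb hbn
    rw [beta_eq]
    apply op_comm_zpow
    simp only [form_sub_left, form_sub_right, form_zv_left]
    rw [form_xv_zv _ _ _ hbn, form_xv_xv, form_xv_xv, if_pos hb, if_neg (not_lt.2 hjk.le),
      if_pos hjk, p.betaExp_skew k j]
    ring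
  have hjk' : (j : ℕ) < k := hjk
  simp only [yOp, smul_mul_assoc, mul_smul_comm, mul_sub, sub_mul]
  rw [key (k + 1) (by omega) k.2, key k (by omega) k.2.le]
  module

theorem xOp_yOp_comm_of_gt {j k : Fin n} (hjk : k < j) :
    p.op u (xv j) * p.yOp u k =
      (p.eps u k * p.beta u k j : K) • (p.yOp u k * p.op u (xv j)) := by
  have key : ∀ b : ℕ, b ≤ j →
      p.op u (xv j) * p.op u (zv b - xv k) =
        (p.eps u k * p.beta u k j : K) • (p.op u (zv b - xv k) * p.op u (xv j)) := by
    intro b hb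
    rw [beta_eq, eps_eq, ← Units.val_mul, ← zpow_add]
    apply op_comm_zpow
    simp only [form_sub_left, form_sub_right, form_zv_left]
    rw [form_xv_zv _ _ _ (hb.trans j.2.le), form_xv_xv, form_xv_xv, if_neg (by omega), if_pos hjk,
      if_neg (not_lt.2 hjk.le)]
    ring
  have hjk' : (k : ℕ) < j := hjk
  simp only [yOp, smul_mul_assoc, mul_smul_comm, mul_sub, sub_mul]
  rw [key (k + 1) (by omega), key k (by omega)]
  module

theorem xOp_comm_of_lt {j k : Fin n} (hjk : j < k) :
    p.op u (xv j) * p.op u (xv k) =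
      (p.eps u j * p.beta u j k : K) • (p.op u (xv k) * p.op u (xv j)) := by
  rw [beta_eq, eps_eq, ← Units.val_mul, ← zpow_add]
  apply op_comm_zpow
  rw [form_xv_xv, form_xv_xv, if_neg (not_lt.2 hjk.le), if_pos hjk]
  ring

theorem yOp_mul_xOp (j : Fin n) : p.yOp u j * p.op u (xv j) =
    ((p.eps u j : K) - 1)⁻¹ • (p.op u (zv (j + 1)) - p.op u (zv j)) := by
  have key : ∀ b : ℕ, p.op u (zv b - xv j) * p.op u (xv j) = p.op u (zv b) := fun b => by
    rw [op_mul, sub_add_cancel, form_sub_left, form_zv_left, form_xv_xv, if_neg (lt_irrefl _)]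
    simp
  rw [yOp, smul_mul_assoc, sub_mul, key, key]

theorem xOp_mul_yOp (j : Fin n) : p.op u (xv j) * p.yOp u j =
    ((p.eps u j : K) - 1)⁻¹ • ((p.eps u j : K) • p.op u (zv (j + 1)) - p.op u (zv j)) := by
  have key : ∀ b : ℕ, b ≤ n → p.op u (xv j) * p.op u (zv b - xv j) =
      ((u ^ (if (j : ℕ) < b then p.epsExp j else 0) : Kˣ) : K) • p.op u (zv b) := fun b hb => by
    rw [op_mul, add_sub_cancel, form_sub_right, form_xv_zv _ _ _ hb, form_xv_xv,
      if_neg (lt_irrefl _), sub_zero]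
  rw [yOp, mul_smul_comm, mul_sub, key (j + 1) j.2, key j j.2.le, if_pos (by omega),
    if_neg (by omega), eps_eq]
  simp

theorem filter_lt_succ {i : ℕ} (hi : i < n) :
    (Finset.univ.filter fun k : Fin n => (k : ℕ) < i + 1) =
      insert ⟨i, hi⟩ (Finset.univ.filter fun k : Fin n => (k : ℕ) < i) := by
  ext k
  simp only [Finset.mem_filter, Finset.mem_univ, true_and, Finset.mem_insert, Fin.ext_iff]
  omega

variable (hu : ∀ j, p.eps u j ≠ 1)

include hu

theorem eps_sub_one_ne_zero (j : Fin n) : (p.eps u j : K) - 1 ≠ 0 :=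
  sub_ne_zero.2 fun h => hu j (Units.ext h)

theorem sum_yOp_mul_xOp (i : ℕ) (hi : i ≤ n) :
    1 + ∑ k ∈ Finset.univ.filter (fun k : Fin n => (k : ℕ) < i),
      ((p.eps u k : K) - 1) • (p.yOp u k * p.op u (xv k)) = p.op u (zv i) := by
  induction i with
  | zero => simp [zv_zero, op_zero]
  | succ i ih =>
    rw [filter_lt_succ hi, Finset.sum_insert (by simp), add_left_comm, ih (by omega), yOp_mul_xOp,
      smul_smul, mul_inv_cancel₀ (p.eps_sub_one_ne_zero u hu _), one_smul]
    exact sub_add_cancel _ _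

theorem rel_op {a b : FreeAlgebra K (Fin n ⊕ Fin n)}
    (h : QWeylRel K (p.eps u) (p.beta u) a b) :
    FreeAlgebra.lift K (Sum.elim (fun j => p.op u (xv j)) (p.yOp u)) a =
      FreeAlgebra.lift K (Sum.elim (fun j => p.op u (xv j)) (p.yOp u)) b := by
  cases h with
  | yy j k =>
    simp only [map_mul, map_smul, FreeAlgebra.lift_ι_apply, Sum.elim_inr]
    rcases lt_trichotomy j k with h | h | h
    · exact p.yOp_comm_of_lt u h
    · subst h
      rw [beta_eq, betaExp_self, zpow_zero, Units.val_one, one_smul]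
    · rw [p.yOp_comm_of_lt u h, smul_smul, beta_eq, beta_eq, ← Units.val_mul, ← zpow_add,
        p.betaExp_skew j k, neg_add_cancel, zpow_zero, Units.val_one, one_smul]
  | xx j k h =>
    simp only [map_mul, map_smul, FreeAlgebra.lift_ι_apply, Sum.elim_inl]
    exact p.xOp_comm_of_lt u h
  | xy_lt j k h =>
    simp only [map_mul, map_smul, FreeAlgebra.lift_ι_apply, Sum.elim_inl, Sum.elim_inr]
    exact p.xOp_yOp_comm_of_lt u h
  | xy_gt j k h =>
    simp only [map_mul, map_smul, FreeAlgebra.lift_ι_apply, Sum.elim_inl, Sum.elim_inr]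
    exact p.xOp_yOp_comm_of_gt u h
  | xy_eq j =>
    simp only [map_mul, map_smul, map_add, map_sub, map_sum, map_one, FreeAlgebra.lift_ι_apply,
      Sum.elim_inl, Sum.elim_inr]
    have hs : Finset.Iio j = Finset.univ.filter (fun k : Fin n => (k : ℕ) < j) := by
      ext k
      simp only [Finset.mem_Iio, Finset.mem_filter, Finset.mem_univ, true_and, Fin.lt_def]
    rw [hs, p.sum_yOp_mul_xOp u hu j j.2.le, xOp_mul_yOp, yOp_mul_xOp, smul_comm, ← smul_sub,
      show (p.eps u j : K) • p.op u (zv (j + 1)) - p.op u (zv j) -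
        (p.eps u j : K) • (p.op u (zv (j + 1)) - p.op u (zv j)) =
        ((p.eps u j : K) - 1) • p.op u (zv j) by module, smul_smul,
      inv_mul_cancel₀ (p.eps_sub_one_ne_zero u hu _), one_smul]

/-- The representation of the quantized Weyl algebra on the quantum torus. -/
def rho : p.Weyl u →ₐ[K] TorusEnd K n :=
  RingQuot.liftAlgHom K ⟨FreeAlgebra.lift K (Sum.elim (fun j => p.op u (xv j)) (p.yOp u)),
    fun _ _ h => p.rel_op u hu h⟩

theorem rho_x (j : Fin n) : p.rho u hu (QWeyl.x K _ _ j) = p.op u (xv j) := by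
  refine (RingQuot.liftAlgHom_mkAlgHom_apply _ _ _ _).trans ?_
  rw [FreeAlgebra.lift_ι_apply, Sum.elim_inl]

theorem rho_y (j : Fin n) : p.rho u hu (QWeyl.y K _ _ j) = p.yOp u j := by
  refine (RingQuot.liftAlgHom_mkAlgHom_apply _ _ _ _).trans ?_
  rw [FreeAlgebra.lift_ι_apply, Sum.elim_inr]

end Representation

/-- The normal element `z_i = 1 + ∑_{k ≤ i} (ε_k - 1) y_k x_k`. -/
def z {R : Type*} [CommRing R] (u : Rˣ) (i : ℕ) : p.Weyl u :=
  1 + ∑ k ∈ Finset.univ.filter (fun k : Fin n => (k : ℕ) < i),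
    ((p.eps u k : R) - 1) • (QWeyl.y R (p.eps u) (p.beta u) k * QWeyl.x R (p.eps u) (p.beta u) k)

theorem rho_z {K : Type*} [Field K] (u : Kˣ) (hu : ∀ j, p.eps u j ≠ 1) (i : ℕ) (hi : i ≤ n) :
    p.rho u hu (p.z u i) = p.op u (zv i) := by
  simp only [z, map_add, map_one, map_sum, map_smul, map_mul, rho_x, rho_y]
  exact p.sum_yOp_mul_xOp u hu i hi

end RootData
end

noncomputable section

/-! ### Ordered monomials span the quantized Weyl algebra -/

section OrderedMonomials

variable {R A : Type*} [CommRing R] [Ring A] [Algebra R A]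

/-- A submodule which contains `1` and is stable under right multiplication by a set contains the
subalgebra generated by this set. -/
theorem adjoin_le_of_mul_mem {s : Set A} {N : Submodule R A} (h1 : 1 ∈ N)
    (hs : ∀ w ∈ N, ∀ g ∈ s, w * g ∈ N) {a : A} (ha : a ∈ Algebra.adjoin R s) : a ∈ N := by
  suffices h : ∀ w ∈ N, w * a ∈ N by simpa using h 1 h1
  induction ha using Algebra.adjoin_induction with
  | mem g hg => exact fun w hw => hs w hw g hg
  | algebraMap r =>
    intro w hw
    rw [← Algebra.commutes, ← Algebra.smul_def]
    exact N.smul_mem r hw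
  | add a b _ _ ha hb =>
    intro w hw
    rw [mul_add]
    exact N.add_mem (ha w hw) (hb w hw)
  | mul a b _ _ ha hb =>
    intro w hw
    rw [← mul_assoc]
    exact hb _ (ha w hw)

/-- `a` and `b` commute up to a scalar. -/
def QCommute (R : Type*) {A : Type*} [CommRing R] [Ring A] [Algebra R A] (a b : A) : Prop :=
  ∃ s : R, a * b = s • (b * a)

theorem QCommute.one_left (b : A) : QCommute R 1 b := ⟨1, by simp⟩

theorem QCommute.mul_left {a b c : A} (ha : QCommute R a c) (hb : QCommute R b c) :
    QCommute R (a * b) c := by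
  obtain ⟨s, hs⟩ := ha
  obtain ⟨t, ht⟩ := hb
  refine ⟨t * s, ?_⟩
  rw [mul_assoc, ht, mul_smul_comm, ← mul_assoc, hs, smul_mul_assoc, smul_smul, mul_assoc]

theorem QCommute.pow_left {a c : A} (ha : QCommute R a c) (m : ℕ) : QCommute R (a ^ m) c := by
  induction m with
  | zero => rw [pow_zero]; exact QCommute.one_left c
  | succ m ih => rw [pow_succ]; exact ih.mul_left ha

theorem QCommute.list_prod_left {l : List A} {c : A} (h : ∀ a ∈ l, QCommute R a c) :
    QCommute R l.prod c := by
  induction l with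
  | nil => exact QCommute.one_left c
  | cons a l ih =>
    rw [List.prod_cons]
    exact (h a (by simp)).mul_left (ih fun b hb => h b (by simp [hb]))

/-- The ordered monomial `g_0 ^ a_0 ⋯ g_{n-1} ^ a_{n-1}`. -/
def ordMon {n : ℕ} (g : Fin n → A) (a : Fin n → ℕ) : A :=
  ((List.finRange n).map fun j => g j ^ a j).prod

theorem exists_list_prod_mul {ι : Type*} [DecidableEq ι] {g : ι → A}
    (hg : ∀ j k, QCommute R (g j) (g k)) (a : ι → ℕ) (k : ι) (l : List ι) (hl : l.Nodup)
    (hk : k ∈ l) : ∃ s : R, (l.map fun j => g j ^ a j).prod * g k =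
      s • (l.map fun j => g j ^ (a + Pi.single k 1 : ι → ℕ) j).prod := by
  induction l with
  | nil => simp at hk
  | cons i l ih =>
    obtain ⟨hi, hl⟩ := List.nodup_cons.1 hl
    simp only [List.map_cons, List.prod_cons]
    by_cases hik : k = i
    · subst hik
      obtain ⟨s, hs⟩ : QCommute R (l.map fun j => g j ^ a j).prod (g k) :=
        QCommute.list_prod_left fun b hb => by
          obtain ⟨j, -, rfl⟩ := List.mem_map.1 hb
          exact (hg j k).pow_left _
      refine ⟨s, ?_⟩
      have hl' : (l.map fun j => g j ^ (a + Pi.single k 1 : ι → ℕ) j) =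
          l.map fun j => g j ^ a j := by
        refine List.map_congr_left fun j hj => ?_
        have : j ≠ k := fun h => hi (h ▸ hj)
        simp [this]
      rw [hl', mul_assoc, hs, mul_smul_comm, ← mul_assoc, ← pow_succ]
      simp
    · obtain ⟨s, hs⟩ := ih hl ((List.mem_cons.1 hk).resolve_left hik)
      refine ⟨s, ?_⟩
      rw [mul_assoc, hs, mul_smul_comm]
      simp [Ne.symm hik]

theorem adjoin_le_span_ordMon {n : ℕ} {g : Fin n → A} (hg : ∀ j k, QCommute R (g j) (g k)) {w : A}
    (hw : w ∈ Algebra.adjoin R (Set.range g)) : w ∈ Submodule.span R (Set.range (ordMon g)) := by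
  refine adjoin_le_of_mul_mem (N := Submodule.span R (Set.range (ordMon g)))
    (Submodule.subset_span ⟨0, by simp [ordMon]⟩) ?_ hw
  rintro w hw _ ⟨k, rfl⟩
  induction hw using Submodule.span_induction with
  | mem w hw =>
    obtain ⟨a, rfl⟩ := hw
    obtain ⟨s, hs⟩ := exists_list_prod_mul hg a k (List.finRange n) (List.nodup_finRange n)
      (List.mem_finRange k)
    rw [ordMon, hs]
    exact Submodule.smul_mem _ _ (Submodule.subset_span ⟨_, rfl⟩)
  | zero => rw [zero_mul]; exact zero_mem _
  | add a b _ _ ha hb => rw [add_mul]; exact add_mem ha hb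
  | smul r a _ ha => rw [smul_mul_assoc]; exact Submodule.smul_mem _ _ ha

end OrderedMonomials

namespace QWeyl

variable {n : ℕ} {R : Type*} [CommRing R] {E : Fin n → Rˣ} {B : Fin n → Fin n → Rˣ}

theorem y_mul_y (j k : Fin n) :
    y R E B j * y R E B k = (B j k : R) • (y R E B k * y R E B j) := by
  simpa [x, y] using mk_eq_of_rel (QWeylRel.yy (E := E) (B := B) j k)

theorem x_mul_x {j k : Fin n} (h : j < k) :
    x R E B j * x R E B k = (E j * B j k : R) • (x R E B k * x R E B j) := by
  simpa [x, y] using mk_eq_of_rel (QWeylRel.xx (E := E) (B := B) j k h)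

theorem x_mul_y_of_lt {j k : Fin n} (h : j < k) :
    x R E B j * y R E B k = (B k j : R) • (y R E B k * x R E B j) := by
  simpa [x, y] using mk_eq_of_rel (QWeylRel.xy_lt (E := E) (B := B) j k h)

theorem x_mul_y_of_gt {j k : Fin n} (h : k < j) :
    x R E B j * y R E B k = (E k * B k j : R) • (y R E B k * x R E B j) := by
  simpa [x, y] using mk_eq_of_rel (QWeylRel.xy_gt (E := E) (B := B) j k h)

theorem x_mul_y_self (j : Fin n) :
    x R E B j * y R E B j = (E j : R) • (y R E B j * x R E B j) +
      (1 + ∑ i ∈ Finset.Iio j, ((E i : R) - 1) • (y R E B i * x R E B i)) := by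
  rw [← sub_eq_iff_eq_add']
  simpa [x, y] using mk_eq_of_rel (QWeylRel.xy_eq (E := E) (B := B) j)

theorem qCommute_x (j k : Fin n) : QCommute R (x R E B j) (x R E B k) := by
  rcases lt_trichotomy j k with h | h | h
  · exact ⟨_, x_mul_x h⟩
  · subst h
    exact ⟨1, by simp⟩
  · refine ⟨(((E k * B k j)⁻¹ : Rˣ) : R), ?_⟩
    rw [x_mul_x h, smul_smul, ← Units.val_mul, ← Units.val_mul, inv_mul_cancel, Units.val_one,
      one_smul]

theorem qCommute_y (j k : Fin n) : QCommute R (y R E B j) (y R E B k) := ⟨_, y_mul_y j k⟩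

theorem adjoin_eq_top :
    Algebra.adjoin R (Set.range (x R E B) ∪ Set.range (y R E B)) = ⊤ := by
  have h : (⊤ : Subalgebra R (QWeyl R E B)) =
      (⊤ : Subalgebra R (FreeAlgebra R _)).map (mk R E B) := by
    rw [Algebra.map_top, eq_comm, AlgHom.range_eq_top]
    exact RingQuot.mkAlgHom_surjective R _
  rw [h, ← FreeAlgebra.adjoin_range_ι, AlgHom.map_adjoin, ← Set.range_comp,
    ← Set.Sum.elim_range]
  congr 2
  ext s
  rcases s with j | j <;> rfl

/-- Straightening: the product N is stable under y's on the left and x's on the right, so it is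
enough to push one y leftward through a polynomial in the x's. -/
theorem mul_adjoin_eq_top : Subalgebra.toSubmodule (Algebra.adjoin R (Set.range (y R E B))) *
    Subalgebra.toSubmodule (Algebra.adjoin R (Set.range (x R E B))) = ⊤ := by
  set PY := Algebra.adjoin R (Set.range (y R E B))
  set PX := Algebra.adjoin R (Set.range (x R E B))
  set N := Subalgebra.toSubmodule PY * Subalgebra.toSubmodule PX with hN
  have hxX : ∀ j, x R E B j ∈ PX := fun j => Algebra.subset_adjoin ⟨j, rfl⟩
  have hyY : ∀ j, y R E B j ∈ PY := fun j => Algebra.subset_adjoin ⟨j, rfl⟩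
  have hmem : ∀ a ∈ PY, ∀ b ∈ PX, a * b ∈ N := fun a ha b hb => Submodule.mul_mem_mul ha hb
  have hright : ∀ w ∈ N, ∀ b ∈ PX, w * b ∈ N := fun w hw b hb => by
    have : w * b ∈ N * Subalgebra.toSubmodule PX := Submodule.mul_mem_mul hw hb
    rwa [hN, mul_assoc, (Subalgebra.isIdempotentElem_toSubmodule _).eq] at this
  have hleft : ∀ a ∈ PY, ∀ w ∈ N, a * w ∈ N := fun a ha w hw => by
    have : a * w ∈ Subalgebra.toSubmodule PY * N := Submodule.mul_mem_mul ha hw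
    rwa [hN, ← mul_assoc, (Subalgebra.isIdempotentElem_toSubmodule _).eq] at this
  have hXy : ∀ w ∈ PX, ∀ k, w * y R E B k ∈ N := by
    -- All y_k are treated at once, because straightening x_j y_j also produces y_i x_i with i < j.
    let Q : Submodule R (QWeyl R E B) :=
      { carrier := {w | w ∈ PX ∧ ∀ k, w * y R E B k ∈ N}
        add_mem' := fun ha hb => ⟨add_mem ha.1 hb.1, fun k => by
          rw [add_mul]; exact add_mem (ha.2 k) (hb.2 k)⟩
        zero_mem' := ⟨zero_mem _, fun k => by rw [zero_mul]; exact zero_mem _⟩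
        smul_mem' := fun r a ha => ⟨Subalgebra.smul_mem _ ha.1 r, fun k => by
          rw [smul_mul_assoc]; exact N.smul_mem r (ha.2 k)⟩ }
    intro w hw
    refine (adjoin_le_of_mul_mem (N := Q) ⟨one_mem _, fun k => ?_⟩ ?_ hw).2
    · rw [one_mul, ← mul_one (y R E B k)]
      exact hmem _ (hyY k) _ (one_mem _)
    · rintro w ⟨hwX, hw⟩ _ ⟨j, rfl⟩
      refine ⟨mul_mem hwX (hxX j), fun k => ?_⟩
      rw [mul_assoc]
      rcases lt_trichotomy j k with h | h | h
      · rw [x_mul_y_of_lt h, mul_smul_comm, ← mul_assoc]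
        exact N.smul_mem _ (hright _ (hw k) _ (hxX j))
      · subst h
        rw [x_mul_y_self, mul_add, mul_smul_comm, ← mul_assoc, mul_add, mul_one, Finset.mul_sum]
        refine add_mem (N.smul_mem _ (hright _ (hw j) _ (hxX j))) (add_mem ?_ (sum_mem fun i _ => ?_))
        · rw [← one_mul w]
          exact hmem _ (one_mem _) _ hwX
        · rw [mul_smul_comm, ← mul_assoc]
          exact N.smul_mem _ (hright _ (hw i) _ (hxX i))
      · rw [x_mul_y_of_gt h, mul_smul_comm, ← mul_assoc]
        exact N.smul_mem _ (hright _ (hw k) _ (hxX j))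
  refine eq_top_iff.2 fun w _ => ?_
  have hw : w ∈ Algebra.adjoin R (Set.range (x R E B) ∪ Set.range (y R E B)) := by
    rw [adjoin_eq_top]
    exact Algebra.mem_top
  refine adjoin_le_of_mul_mem ?_ ?_ hw
  · rw [← one_mul (1 : QWeyl R E B)]
    exact hmem _ (one_mem _) _ (one_mem _)
  · rintro w hw g (⟨j, rfl⟩ | ⟨j, rfl⟩)
    · exact hright w hw _ (hxX j)
    · induction hw using Submodule.mul_induction_on' with
      | mem_mul_mem a ha b hb =>
        rw [mul_assoc]
        exact hleft a ha _ (hXy b hb j)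
      | add a _ b _ ha hb => rw [add_mul]; exact add_mem ha hb

/-- The ordered monomial `y^a x^b`. -/
def mon (R : Type*) [CommRing R] (E : Fin n → Rˣ) (B : Fin n → Fin n → Rˣ)
    (i : (Fin n → ℕ) × (Fin n → ℕ)) : QWeyl R E B :=
  ordMon (y R E B) i.1 * ordMon (x R E B) i.2

theorem span_mon : Submodule.span R (Set.range (mon R E B)) = ⊤ := by
  rw [eq_top_iff, ← mul_adjoin_eq_top, Submodule.mul_le]
  intro a ha b hb
  have ha' := adjoin_le_span_ordMon qCommute_y ha
  have hb' := adjoin_le_span_ordMon qCommute_x hb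
  have h := Submodule.mul_mem_mul ha' hb'
  rw [Submodule.span_mul_span] at h
  refine Submodule.span_mono ?_ h
  rintro _ ⟨_, ⟨i, rfl⟩, _, ⟨k, rfl⟩, rfl⟩
  exact ⟨(i, k), rfl⟩

theorem exists_linearCombination_mon (w : QWeyl R E B) :
    ∃ c, Finsupp.linearCombination R (mon R E B) c = w := by
  have h : w ∈ Submodule.span R (Set.range (mon R E B)) := by
    rw [span_mon]
    trivial
  exact (Finsupp.mem_span_range_iff_exists_finsupp).1 h

end QWeyl
end

noncomputable section

/-! ### Leading terms in the quantum torus -/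

namespace RootData

open TorusEnd

variable {n : ℕ} (p : RootData n)

/-- The weight of a monomial of the quantum torus; the weight of `z_i` is `i`. -/
def wt : Lattice n →+ ℤ where
  toFun α := ∑ k : Fin n, (((k : ℕ) : ℤ) + 1) * α.1 k
  map_zero' := by simp
  map_add' α β := by simp [mul_add, Finset.sum_add_distrib]

theorem wt_zv (i : ℕ) (hi : i ≤ n) : wt (zv i : Lattice n) = i := by
  cases i with
  | zero => simp [zv_zero]
  | succ i =>
    change ∑ k : Fin n, (((k : ℕ) : ℤ) + 1) * (if (k : ℕ) + 1 = i + 1 then 1 else 0) = _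
    rw [Finset.sum_eq_single ⟨i, hi⟩]
    · simp
    · intro k _ hk
      have : (k : ℕ) ≠ i := fun h => hk (Fin.ext h)
      simp [this]
    · simp

theorem wt_xv (j : Fin n) : wt (xv j) = 0 := by
  change ∑ k : Fin n, (((k : ℕ) : ℤ) + 1) * 0 = 0
  simp

section Filtration

variable {K : Type*} [Field K] (u : Kˣ)

/-- The coefficients of an element of the quantum torus. -/
def coef : TorusEnd K n →ₗ[K] (Lattice n →₀ K) where
  toFun a := act a (Finsupp.single 0 1)
  map_add' a b := by simp
  map_smul' c a := by simp

theorem coef_op (α : Lattice n) : coef (p.op u α) = Finsupp.single α 1 := by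
  change act (p.op u α) (Finsupp.single 0 1) = _
  rw [op_single, form_zero_right, add_zero, zpow_zero, Units.val_one, mul_one]

/-- The span of the monomials of weight at most `s`. -/
def filt (s : ℤ) : Submodule K (TorusEnd K n) := Submodule.span K (p.op u '' {α | wt α ≤ s})

theorem op_mem_filt {α : Lattice n} {s : ℤ} (h : wt α ≤ s) : p.op u α ∈ p.filt u s :=
  Submodule.subset_span ⟨α, h, rfl⟩

theorem filt_mono {s t : ℤ} (h : s ≤ t) : p.filt u s ≤ p.filt u t :=
  Submodule.span_mono (Set.image_mono fun _ hα => le_trans hα h)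

theorem mul_mem_filt {a b : TorusEnd K n} {s t : ℤ} (ha : a ∈ p.filt u s) (hb : b ∈ p.filt u t) :
    a * b ∈ p.filt u (s + t) := by
  have h := Submodule.mul_mem_mul ha hb
  rw [filt, filt, Submodule.span_mul_span] at h
  refine Submodule.span_le.2 ?_ h
  rintro _ ⟨_, ⟨α, hα, rfl⟩, _, ⟨β, hβ, rfl⟩, rfl⟩
  simp only [op_mul]
  exact Submodule.smul_mem _ _ (p.op_mem_filt u (by rw [map_add]; exact add_le_add hα hβ))

theorem coef_eq_zero_of_mem_filt {a : TorusEnd K n} {s : ℤ} (ha : a ∈ p.filt u s) {α : Lattice n}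
    (hα : s < wt α) : coef a α = 0 := by
  induction ha using Submodule.span_induction with
  | mem a ha =>
    obtain ⟨β, hβ, rfl⟩ := ha
    rw [coef_op, Finsupp.single_apply, if_neg]
    rintro rfl
    exact absurd hβ (not_le.2 hα)
  | zero => simp
  | add a b _ _ ha hb => simp [ha, hb]
  | smul c a _ ha => simp [ha]

/-- The monomial with exponent `α` is the leading term of `a`. -/
def Lead (a : TorusEnd K n) (α : Lattice n) : Prop :=
  ∃ c : K, c ≠ 0 ∧ a - c • p.op u α ∈ p.filt u (wt α - 1)

variable {p u}

theorem Lead.mem_filt {a : TorusEnd K n} {α : Lattice n} (h : p.Lead u a α) :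
    a ∈ p.filt u (wt α) := by
  obtain ⟨c, -, h⟩ := h
  rw [← sub_add_cancel a (c • p.op u α)]
  exact add_mem (p.filt_mono u (by omega) h) (Submodule.smul_mem _ _ (p.op_mem_filt u le_rfl))

theorem Lead.mul {a b : TorusEnd K n} {α β : Lattice n} (ha : p.Lead u a α) (hb : p.Lead u b β) :
    p.Lead u (a * b) (α + β) := by
  have hb' := hb.mem_filt
  obtain ⟨c, hc, hca⟩ := ha
  obtain ⟨e, he, heb⟩ := hb
  refine ⟨c * e * (u ^ p.form α β : Kˣ), mul_ne_zero (mul_ne_zero hc he) (Units.ne_zero _), ?_⟩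
  have h : a * b - (c * e * (u ^ p.form α β : Kˣ)) • p.op u (α + β) =
      (a - c • p.op u α) * b + c • (p.op u α * (b - e • p.op u β)) := by
    rw [mul_smul, ← op_mul, sub_mul, mul_sub, smul_sub, mul_smul_comm, smul_mul_assoc, mul_smul]
    abel
  rw [h, map_add]
  refine add_mem ?_ (Submodule.smul_mem _ _ ?_)
  · exact p.filt_mono u (by omega) (p.mul_mem_filt u hca hb')
  · exact p.filt_mono u (by omega) (p.mul_mem_filt u (p.op_mem_filt u le_rfl) heb)

theorem lead_op (α : Lattice n) : p.Lead u (p.op u α) α :=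
  ⟨1, one_ne_zero, by rw [one_smul, sub_self]; exact zero_mem _⟩

theorem lead_one : p.Lead u 1 0 := by
  rw [← p.op_zero u]
  exact lead_op 0

theorem Lead.pow {a : TorusEnd K n} {α : Lattice n} (ha : p.Lead u a α) (m : ℕ) :
    p.Lead u (a ^ m) (m • α) := by
  induction m with
  | zero => rw [pow_zero, zero_smul]; exact lead_one
  | succ m ih => rw [pow_succ, succ_nsmul]; exact ih.mul ha

theorem lead_ordMon {g : Fin n → TorusEnd K n} {v : Fin n → Lattice n}
    (h : ∀ j, p.Lead u (g j) (v j)) (a : Fin n → ℕ) :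
    p.Lead u (ordMon g a) (∑ j, a j • v j) := by
  rw [ordMon, Fin.sum_univ_def]
  induction List.finRange n with
  | nil => exact lead_one
  | cons j l ih =>
    rw [List.map_cons, List.map_cons, List.prod_cons, List.sum_cons]
    exact ((h j).pow _).mul ih

variable (hu : ∀ j, p.eps u j ≠ 1)

include hu

theorem lead_yOp (j : Fin n) : p.Lead u (p.yOp u j) (zv (j + 1) - xv j) := by
  have hc := inv_ne_zero (p.eps_sub_one_ne_zero u hu j)
  refine ⟨_, hc, ?_⟩
  rw [yOp, smul_sub, sub_sub_cancel_left, ← smul_neg, map_sub, wt_zv _ j.2, wt_xv]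
  refine Submodule.smul_mem _ _ (neg_mem (p.op_mem_filt u ?_))
  rw [map_sub, wt_zv _ j.2.le, wt_xv]
  push_cast
  omega

/-- The exponent of the leading term of `y^a x^b`. -/
def vec (i : (Fin n → ℕ) × (Fin n → ℕ)) : Lattice n :=
  (fun j => i.1 j, fun j => (i.2 j : ℤ) - i.1 j)

omit hu in
theorem vec_injective : Function.Injective (vec : _ → Lattice n) := by
  rintro ⟨a, b⟩ ⟨a', b'⟩ h
  simp only [vec, Prod.mk.injEq] at h
  obtain ⟨h₁, h₂⟩ := h
  have ha : a = a' := funext fun j => by exact_mod_cast congrFun h₁ j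
  subst ha
  have hb : b = b' := funext fun j => by simpa using congrFun h₂ j
  rw [hb]

omit hu in
theorem vec_eq (i : (Fin n → ℕ) × (Fin n → ℕ)) :
    vec i = ∑ j, i.1 j • (zv (j + 1) - xv j) + ∑ j, i.2 j • (xv j : Lattice n) := by
  ext k
  · simp only [vec, zv, xv, Prod.fst_add, Prod.fst_sum, Prod.smul_fst, Prod.fst_sub, Pi.add_apply,
      Finset.sum_apply, Pi.smul_apply, Pi.sub_apply, Pi.zero_apply]
    rw [Finset.sum_eq_single k (fun j _ hj => by
      have : (k : ℕ) ≠ j := fun h => hj (Fin.ext h.symm)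
      simp [this]) (by simp)]
    simp
  · simp only [vec, zv, xv, Prod.snd_add, Prod.snd_sum, Prod.smul_snd, Prod.snd_sub, Pi.add_apply,
      Finset.sum_apply, Pi.smul_apply, Pi.sub_apply, Pi.zero_apply]
    rw [Finset.sum_eq_single k (fun j _ hj => by simp [Ne.symm hj]) (by simp),
      Finset.sum_eq_single k (fun j _ hj => by simp [Ne.symm hj]) (by simp)]
    simp
    ring

theorem lead_mon (i : (Fin n → ℕ) × (Fin n → ℕ)) :
    p.Lead u (p.rho u hu (QWeyl.mon K _ _ i)) (vec i) := by
  have hmap : ∀ (g : Fin n → p.Weyl u) (a : Fin n → ℕ),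
      p.rho u hu (ordMon g a) = ordMon (fun j => p.rho u hu (g j)) a := fun g a => by
    rw [ordMon, map_list_prod, List.map_map, ordMon]
    congr 2
    ext j
    simp
  rw [QWeyl.mon, map_mul, hmap, hmap, vec_eq]
  refine (lead_ordMon (fun j => ?_) _).mul (lead_ordMon (fun j => ?_) _)
  · rw [rho_y]
    exact lead_yOp hu j
  · rw [rho_x]
    exact lead_op _

/-- Choose i in the support with leading exponent of maximal weight. Any other monomial has a
different leading exponent, and its remaining terms have weight below the maximum, so it contributes
nothing at `vec i`. -/
theorem exists_coef_ne_zero {c : ((Fin n → ℕ) × (Fin n → ℕ)) →₀ K} (hc : c ≠ 0) :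
    ∃ i, c i ≠ 0 ∧
      coef (p.rho u hu (Finsupp.linearCombination K (QWeyl.mon K _ _) c)) (vec i) ≠ 0 := by
  classical
  obtain ⟨i, hi, hmax⟩ := Finset.exists_max_image c.support (fun i => wt (vec i))
    (Finsupp.support_nonempty_iff.2 hc)
  have hi0 : c i ≠ 0 := Finsupp.mem_support_iff.1 hi
  refine ⟨i, hi0, ?_⟩
  rw [Finsupp.linearCombination_apply, Finsupp.sum, map_sum, map_sum, Finsupp.finsetSum_apply,
    Finset.sum_eq_single i]
  · rw [map_smul, map_smul, Finsupp.smul_apply, smul_eq_mul]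
    refine mul_ne_zero hi0 ?_
    obtain ⟨e, he, h⟩ := lead_mon hu i
    have h0 := p.coef_eq_zero_of_mem_filt u h (α := vec i) (by omega)
    rw [map_sub, map_smul, coef_op, Finsupp.sub_apply, sub_eq_zero] at h0
    rw [h0]
    simpa using he
  · intro k hk hki
    rw [map_smul, map_smul, Finsupp.smul_apply, smul_eq_mul]
    obtain ⟨e, he, h⟩ := lead_mon hu k
    have hle := hmax k hk
    have h0 := p.coef_eq_zero_of_mem_filt u h (α := vec i) (by omega)
    rw [map_sub, map_smul, coef_op, Finsupp.sub_apply, sub_eq_zero, Finsupp.smul_apply,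
      Finsupp.single_apply, if_neg (fun h => hki (vec_injective h)), smul_zero] at h0
    rw [h0, mul_zero]
  · intro h
    exact absurd hi h

theorem linearIndependent_mon : LinearIndependent K (QWeyl.mon K (p.eps u) (p.beta u)) := by
  rw [linearIndependent_iff]
  intro c hc
  by_contra h0
  obtain ⟨i, -, hi⟩ := exists_coef_ne_zero hu h0
  rw [hc] at hi
  simp at hi

theorem rho_injective : Function.Injective (p.rho u hu) := by
  rw [injective_iff_map_eq_zero]
  intro w hw
  obtain ⟨c, rfl⟩ := QWeyl.exists_linearCombination_mon w
  by_cases hc : c = 0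
  · rw [hc, map_zero]
  · obtain ⟨i, -, hi⟩ := exists_coef_ne_zero hu hc
    rw [hw] at hi
    simp at hi

end Filtration

end RootData
end

noncomputable section

/-! ### Products of `q`-commuting elements -/

section QPowers

variable {R A : Type*} [CommRing R] [Ring A] [Algebra R A]

theorem pow_mul_of_mul_eq_smul {a b : A} {r : R} (h : a * b = r • (b * a)) (m : ℕ) :
    a ^ m * b = r ^ m • (b * a ^ m) := by
  induction m with
  | zero => simp
  | succ m ih =>
    rw [pow_succ, mul_assoc, h, mul_smul_comm, ← mul_assoc, ih, smul_mul_assoc, smul_smul,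
      mul_assoc, pow_succ, mul_comm r]

theorem mul_pow_of_mul_eq_smul {a b : A} {r : R} (h : a * b = r • (b * a)) (m : ℕ) :
    a * b ^ m = r ^ m • (b ^ m * a) := by
  induction m with
  | zero => simp
  | succ m ih =>
    rw [pow_succ, ← mul_assoc, ih, smul_mul_assoc, mul_assoc, h, mul_smul_comm, smul_smul,
      ← mul_assoc, pow_succ]

theorem pow_mul_pow_of_mul_eq_smul {a b : A} {r : R} (h : a * b = r • (b * a)) (m k : ℕ) :
    a ^ m * b ^ k = r ^ (m * k) • (b ^ k * a ^ m) := by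
  rw [mul_pow_of_mul_eq_smul (pow_mul_of_mul_eq_smul h m), pow_mul]

end QPowers

theorem IsPrimitiveRoot.pow_sub_pow_eq_prod_range {S : Type*} [CommRing S] [IsDomain S] {η : S}
    {d : ℕ} (hη : IsPrimitiveRoot η d) (hd : 0 < d) (a b : S) :
    a ^ d - b ^ d = ∏ i ∈ Finset.range d, (a - η ^ i * b) := by
  classical
  have : NeZero d := ⟨hd.ne'⟩
  have himage : Polynomial.nthRootsFinset d (1 : S) = (Finset.range d).image (η ^ ·) := by
    ext ξ
    rw [Polynomial.mem_nthRootsFinset hd, Finset.mem_image]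
    constructor
    · intro h
      obtain ⟨i, hi, rfl⟩ := hη.eq_pow_of_pow_eq_one h
      exact ⟨i, Finset.mem_range.2 hi, rfl⟩
    · rintro ⟨i, -, rfl⟩
      rw [← pow_mul, mul_comm, pow_mul, hη.pow_eq_one, one_pow]
  rw [hη.pow_sub_pow_eq_prod_sub_mul a b hd, himage, Finset.prod_image]
  exact fun i hi j hj h => hη.pow_inj (Finset.mem_range.1 hi) (Finset.mem_range.1 hj) h

/-- If `(1 - ε) y x = w - z`, where `z x = ε⁻¹ x z` and `w` commutes with `x` and `z`, and `ε` is a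
primitive `d`-th root of unity, then `(1 - ε)^d y^d x^d = w^d - z^d`. -/
theorem pow_mul_pow_eq_sub {T A : Type*} [Field T] [Ring A] [Algebra T A] {ε : T} {d : ℕ}
    (hε : IsPrimitiveRoot ε d) (hd : 0 < d) {x y z w : A} (hyx : (1 - ε) • (y * x) = w - z)
    (hzx : z * x = ε⁻¹ • (x * z)) (hwx : w * x = x * w) (hwz : Commute w z) :
    (1 - ε) ^ d • (y ^ d * x ^ d) = w ^ d - z ^ d := by
  -- Evaluation of polynomials in two variables at the commuting pair (w, z), which transports the
  -- factorization of w^d - z^d from a commutative domain.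
  let φ : Polynomial (Polynomial T) →+* A :=
    Polynomial.eval₂RingHom' (Polynomial.aeval w : Polynomial T →ₐ[T] A).toRingHom z fun a => by
      induction a using Polynomial.induction_on' with
      | add a b ha hb => rw [map_add]; exact ha.add_left hb
      | monomial m t =>
        change Commute (Polynomial.aeval w (Polynomial.monomial m t)) z
        rw [Polynomial.aeval_monomial, ← Algebra.smul_def]
        exact (hwz.pow_left m).smul_left t
  have hφz : φ Polynomial.X = z := Polynomial.eval₂_X _ _
  have hφC : ∀ a, φ (Polynomial.C a) = Polynomial.aeval w a := fun a => Polynomial.eval₂_C _ _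
  have hφw : φ (Polynomial.C Polynomial.X) = w := by rw [hφC, Polynomial.aeval_X]
  have hφt : ∀ t, φ (Polynomial.C (Polynomial.C t)) = algebraMap T A t := fun t => by
    rw [hφC, Polynomial.aeval_C]
  set η : Polynomial (Polynomial T) := Polynomial.C (Polynomial.C ε⁻¹) with hηdef
  have hη : IsPrimitiveRoot η d :=
    (hε.inv.map_of_injective Polynomial.C_injective).map_of_injective Polynomial.C_injective
  have hzpow : ∀ m, z * x ^ m = (ε⁻¹) ^ m • (x ^ m * z) := mul_pow_of_mul_eq_smul hzx
  have hwpow : ∀ m, w * x ^ m = x ^ m * w := fun m => (Commute.pow_right hwx m)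
  -- Peel off the innermost y x = (1 - ε)⁻¹ (w - z) and move it right past x^m: this replaces z by
  -- ε^{-m} z, and gives the factors w - ε^{-i} z for i < m.
  have key : ∀ m, (1 - ε) ^ m • (y ^ m * x ^ m) =
      φ (∏ i ∈ Finset.range m, (Polynomial.C Polynomial.X - η ^ i * Polynomial.X)) := by
    intro m
    induction m with
    | zero => simp
    | succ m ih =>
      have hf : φ (Polynomial.C Polynomial.X - η ^ m * Polynomial.X) = w - (ε⁻¹) ^ m • z := by
        rw [map_sub, map_mul, map_pow, hφw, hφz, hηdef, hφt, ← map_pow, ← Algebra.smul_def]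
      have hy : (1 - ε) ^ (m + 1) • (y ^ (m + 1) * x ^ (m + 1)) =
          (1 - ε) ^ m • (y ^ m * (((1 - ε) • (y * x)) * x ^ m)) := by
        rw [pow_succ y, pow_succ' x, pow_succ (1 - ε), mul_smul, smul_mul_assoc, mul_smul_comm]
        simp only [mul_assoc]
      rw [Finset.prod_range_succ, map_mul, ← ih, hf, hy, hyx, sub_mul, hzpow, hwpow,
        smul_mul_assoc, mul_assoc, mul_sub, mul_sub, mul_smul_comm, mul_smul_comm, mul_sub,
        mul_smul_comm]
  rw [key, ← hη.pow_sub_pow_eq_prod_range hd, map_sub, map_pow, map_pow, hφw, hφz]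

/-! ### Divisibility of exponents -/

namespace RootData

variable {n : ℕ} (p : RootData n)

theorem d_dvd_D (j : Fin n) : p.d j ∣ p.D :=
  (Finset.dvd_lcm (Finset.mem_univ j)).trans (Nat.dvd_lcm_left _ _)

theorem dd_dvd_D (j k : Fin n) : p.dd j k ∣ p.D :=
  (Finset.dvd_lcm (f := fun jk : Fin n × Fin n => p.dd jk.1 jk.2)
    (Finset.mem_univ (j, k))).trans (Nat.dvd_lcm_right _ _)

theorem D_pos : 0 < p.D := by
  refine Nat.lcm_pos ?_ ?_ <;> refine Nat.pos_of_ne_zero ?_ <;>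
    rw [Ne, Finset.lcm_eq_zero_iff] <;> rintro ⟨j, -, hj⟩
  · exact (p.d_pos j).ne' hj
  · exact (p.dd_pos j.1 j.2).ne' hj

/-- Divide by D / d_j and use that m_j is prime to d_j. -/
theorem D_dvd_epsExp_mul {j : Fin n} {t : ℤ} : (p.D : ℤ) ∣ p.epsExp j * t ↔ (p.d j : ℤ) ∣ t := by
  obtain ⟨e, he⟩ := p.d_dvd_D j
  have he0 : (e : ℤ) ≠ 0 := by
    have := p.D_pos
    rw [he] at this
    exact_mod_cast (Nat.pos_of_mul_pos_left this).ne'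
  have hdiv : p.D / p.d j = e := by rw [he, Nat.mul_div_cancel_left _ (p.d_pos j)]
  rw [epsExp, hdiv, he]
  push_cast
  rw [mul_comm (p.d j : ℤ), mul_assoc, mul_dvd_mul_iff_left he0]
  have hco : IsCoprime (p.d j : ℤ) (p.m j : ℤ) := Nat.isCoprime_iff_coprime.2 (p.coprime j).symm
  exact ⟨fun h => hco.dvd_of_dvd_mul_left h, fun h => h.mul_left _⟩

theorem D_dvd_betaExp_mul {j k : Fin n} {t : ℤ} (h : (p.dd j k : ℤ) ∣ t) :
    (p.D : ℤ) ∣ p.betaExp j k * t := by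
  obtain ⟨s, rfl⟩ := h
  rw [betaExp]
  have : ((p.D / p.dd j k : ℕ) : ℤ) * p.dd j k = p.D := by
    exact_mod_cast Nat.div_mul_cancel (p.dd_dvd_D j k)
  refine ⟨p.mm j k * s, ?_⟩
  rw [← this]
  ring

section Divisibility

variable {p} (hdiv : p.Divisibility)

include hdiv

/-- Only the x-part of the left exponent enters `form`. The pairs k < j pair the exponent of x_j
with ε_k and β_{kj}, and this is where d_k ∣ d_j and d_{kj} ∣ d_j are needed. -/
theorem D_dvd_form_left {α : Lattice n} (h : ∀ k, (p.d k : ℤ) ∣ α.2 k) (β : Lattice n) :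
    (p.D : ℤ) ∣ p.form α β := by
  refine Finset.dvd_sum fun j _ => Finset.dvd_sum fun k _ => ?_
  rw [mul_add]
  refine dvd_add ?_ ?_
  · split_ifs with hjk
    · rw [← mul_assoc, mul_comm (α.2 j)]
      exact (p.D_dvd_epsExp_mul.2 (h j)).mul_right _
    · simp
  · split_ifs with hkj
    · rw [← mul_assoc, mul_comm (α.2 j), neg_mul, neg_mul, dvd_neg, add_mul]
      refine Dvd.dvd.mul_right (dvd_add (p.D_dvd_epsExp_mul.2 ?_) (p.D_dvd_betaExp_mul ?_)) _
      · exact (Int.natCast_dvd_natCast.2 (hdiv k j hkj.le).1).trans (h j)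
      · exact (Int.natCast_dvd_natCast.2 ((hdiv k j hkj.le).2 j)).trans (h j)
    · simp

theorem D_dvd_form_right {α : Lattice n} (h : ∀ k, (p.d k : ℤ) ∣ α.1 k)
    (h' : ∀ k, (p.d k : ℤ) ∣ α.2 k) (β : Lattice n) : (p.D : ℤ) ∣ p.form β α := by
  refine Finset.dvd_sum fun j _ => Finset.dvd_sum fun k _ => Dvd.dvd.mul_left (dvd_add ?_ ?_) _
  · split_ifs with hjk
    · exact p.D_dvd_epsExp_mul.2 ((Int.natCast_dvd_natCast.2 (hdiv j k hjk).1).trans (h k))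
    · simp
  · split_ifs with hkj
    · rw [neg_mul, dvd_neg, add_mul]
      refine dvd_add (p.D_dvd_epsExp_mul.2 (h' k)) (p.D_dvd_betaExp_mul ?_)
      exact (Int.natCast_dvd_natCast.2 ((hdiv k k le_rfl).2 j)).trans (h' k)
    · simp

/-- The system is triangular. Commuting with z_{k+1} involves the x-exponents of index at most k,
which gives the x-part by upward induction. Commuting with x_k then involves the z-exponents of
index at least k, which gives the z-part by downward induction. -/
theorem d_dvd_of_D_dvd_form {α : Lattice n}
    (hz : ∀ k : Fin n, (p.D : ℤ) ∣ p.form α (zv (k + 1)) - p.form (zv (k + 1)) α)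
    (hx : ∀ k : Fin n, (p.D : ℤ) ∣ p.form α (xv k) - p.form (xv k) α) :
    (∀ k, (p.d k : ℤ) ∣ α.1 k) ∧ ∀ k, (p.d k : ℤ) ∣ α.2 k := by
  classical
  have h₂ : ∀ k, (p.d k : ℤ) ∣ α.2 k := by
    intro k
    induction k using WellFoundedLT.induction with
    | _ k ih =>
      have h := hz k
      rw [form_zv_left, sub_zero, form] at h
      have hrw : ∀ j, (∑ l, α.2 j * ((if j ≤ l then p.epsExp j else 0) * (zv (k + 1) : Lattice n).1 l +
          (if l < j then -(p.epsExp l + p.betaExp l j) else 0) * (zv (k + 1) : Lattice n).2 l)) =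
          if j ≤ k then p.epsExp j * α.2 j else 0 := by
        intro j
        rw [Finset.sum_eq_single k]
        · simp only [zv, if_true, Pi.zero_apply, mul_zero, mul_one, add_zero]
          split_ifs
          · ring
          · ring
        · intro l _ hl
          have : (l : ℕ) ≠ k := fun h => hl (Fin.ext h)
          simp [zv, this]
        · simp
      rw [Finset.sum_congr rfl fun j _ => hrw j, ← Finset.add_sum_erase _ _ (Finset.mem_univ k),
        if_pos le_rfl] at h
      rw [← p.D_dvd_epsExp_mul]
      refine (dvd_add_left (Finset.dvd_sum fun j hj => ?_)).1 h
      split_ifs with hjk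
      · exact p.D_dvd_epsExp_mul.2 (ih j (lt_of_le_of_ne hjk (Finset.ne_of_mem_erase hj)))
      · simp
  refine ⟨fun k => ?_, h₂⟩
  induction k using WellFoundedGT.induction with
  | _ k ih =>
    have h := (dvd_sub_right (D_dvd_form_left hdiv h₂ (xv k))).1 (hx k)
    have hrw : p.form (xv k) α = ∑ l, ((if k ≤ l then p.epsExp k else 0) * α.1 l +
        (if l < k then -(p.epsExp l + p.betaExp l k) else 0) * α.2 l) := by
      rw [form, Finset.sum_eq_single k (fun j _ hj => by simp [xv, hj]) (by simp)]
      simp [xv]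
    rw [hrw, ← Finset.add_sum_erase _ _ (Finset.mem_univ k), if_pos le_rfl,
      if_neg (lt_irrefl k), zero_mul, add_zero] at h
    rw [← p.D_dvd_epsExp_mul]
    refine (dvd_add_left (Finset.dvd_sum fun l hl => dvd_add ?_ ?_)).1 h
    · split_ifs with hkl
      · refine p.D_dvd_epsExp_mul.2 ((Int.natCast_dvd_natCast.2 (hdiv k l hkl).1).trans (ih l ?_))
        exact lt_of_le_of_ne hkl (Finset.ne_of_mem_erase hl).symm
      · simp
    · split_ifs with hlk
      · rw [neg_mul, dvd_neg, add_mul]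
        refine dvd_add (p.D_dvd_epsExp_mul.2 (h₂ l)) (p.D_dvd_betaExp_mul ?_)
        exact (Int.natCast_dvd_natCast.2 ((hdiv l l le_rfl).2 k)).trans (h₂ l)
      · simp

end Divisibility

end RootData
end

noncomputable section

/-! ### Change of scalars and the ordered monomial basis -/

namespace QWeyl

variable {n : ℕ} {R S : Type*} [CommRing R] [CommRing S] {E : Fin n → Rˣ} {B : Fin n → Fin n → Rˣ}
  {E' : Fin n → Sˣ} {B' : Fin n → Fin n → Sˣ} (f : R →+* S) (hE : ∀ j, f (E j) = E' j)
  (hB : ∀ j k, f (B j k) = B' j k)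

theorem map_x (j : Fin n) : map f hE hB (x R E B j) = x S E' B' j := by
  rw [x, map_mk, freeMap_inl]

theorem map_y (j : Fin n) : map f hE hB (y R E B j) = y S E' B' j := by
  rw [y, map_mk, freeMap_inr]

theorem map_smul' (r : R) (a : QWeyl R E B) : map f hE hB (r • a) = f r • map f hE hB a := by
  obtain ⟨w, rfl⟩ := RingQuot.mkAlgHom_surjective R (QWeylRel R E B) a
  change map f hE hB (r • mk R E B w) = f r • map f hE hB (mk R E B w)
  rw [← map_smul, map_mk, map_mk, freeMap_smul]

theorem map_mon (i : (Fin n → ℕ) × (Fin n → ℕ)) :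
    map f hE hB (mon R E B i) = mon S E' B' i := by
  simp only [mon, ordMon, map_mul, map_list_prod, List.map_map]
  congr 3
  · ext j
    simp [map_y]
  · ext j
    simp [map_x]

theorem map_linearCombination_mon (c : ((Fin n → ℕ) × (Fin n → ℕ)) →₀ R) :
    map f hE hB (Finsupp.linearCombination R (mon R E B) c) =
      Finsupp.linearCombination S (mon S E' B') (c.mapRange f (map_zero f)) := by
  rw [Finsupp.linearCombination_apply, Finsupp.linearCombination_apply,
    Finsupp.sum_mapRange_index (by simp), Finsupp.sum, Finsupp.sum, map_sum]
  exact Finset.sum_congr rfl fun i _ => by rw [map_smul', map_mon]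

theorem map_injective (hf : Function.Injective f) (h : LinearIndependent S (mon S E' B')) :
    Function.Injective (map f hE hB) := by
  rw [injective_iff_map_eq_zero]
  intro a ha
  obtain ⟨c, rfl⟩ := exists_linearCombination_mon a
  rw [map_linearCombination_mon] at ha
  have h0 := linearIndependent_iff.1 h _ ha
  have hc : c = 0 := by
    ext i
    have := DFunLike.congr_fun h0 i
    rw [Finsupp.mapRange_apply, Finsupp.zero_apply, map_eq_zero_iff f hf] at this
    exact this
  rw [hc, map_zero]

end QWeyl

namespace RootData

open TorusEnd

variable {n : ℕ} (p : RootData n) {R K : Type*} [CommRing R] [Field K] (f : R →+* K) (u : Rˣ)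

theorem map_eps {R S : Type*} [CommRing R] [CommRing S] (f : R →+* S) (u : Rˣ) (j : Fin n) :
    f (p.eps u j) = p.eps (Units.map (f : R →* S) u) j :=
  congrArg Units.val (map_pow (Units.map (f : R →* S)) u _)

theorem map_beta {R S : Type*} [CommRing R] [CommRing S] (f : R →+* S) (u : Rˣ) (j k : Fin n) :
    f (p.beta u j k) = p.beta (Units.map (f : R →* S) u) j k :=
  congrArg Units.val (map_zpow (Units.map (f : R →* S)) u _)

theorem map_z {R S : Type*} [CommRing R] [CommRing S] (f : R →+* S) {u : Rˣ} {v : Sˣ}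
    (hE : ∀ j, f (p.eps u j) = p.eps v j) (hB : ∀ j k, f (p.beta u j k) = p.beta v j k) (i : ℕ) :
    QWeyl.map f hE hB (p.z u i) = p.z v i := by
  simp only [z, map_add, map_one, map_sum]
  refine congrArg _ (Finset.sum_congr rfl fun k _ => ?_)
  rw [QWeyl.map_smul', map_mul, QWeyl.map_x, QWeyl.map_y, map_sub, map_one, hE]

variable (hu : ∀ j, p.eps (Units.map (f : R →* K) u) j ≠ 1)

/-- The representation on a quantum torus over a field that contains the ring of scalars. -/
def rep : p.Weyl u →+* TorusEnd K n :=
  (p.rho _ hu).toRingHom.comp (QWeyl.map f (p.map_eps f u) (p.map_beta f u))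

theorem rep_x (j : Fin n) :
    p.rep f u hu (QWeyl.x R _ _ j) = p.op (Units.map (f : R →* K) u) (xv j) := by
  change p.rho _ hu (QWeyl.map f _ _ _) = _
  rw [QWeyl.map_x, rho_x]

theorem rep_z (i : ℕ) (hi : i ≤ n) :
    p.rep f u hu (p.z u i) = p.op (Units.map (f : R →* K) u) (zv i) := by
  change p.rho _ hu (QWeyl.map f _ _ _) = _
  rw [map_z, rho_z _ _ _ _ hi]

theorem rep_smul (r : R) (a : p.Weyl u) : p.rep f u hu (r • a) = f r • p.rep f u hu a := by
  change p.rho _ hu (QWeyl.map f _ _ _) = _ • p.rho _ hu (QWeyl.map f _ _ _)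
  rw [QWeyl.map_smul', map_smul]

theorem rep_injective (hf : Function.Injective f) : Function.Injective (p.rep f u hu) :=
  (rho_injective hu).comp (QWeyl.map_injective _ _ _ hf (linearIndependent_mon hu))

variable {p f u}

include hu

/-- Commutation relations over R are verified in the torus over K. This serves both the algebra at ζ
and the generic one over T[q, q⁻¹]. -/
theorem mul_eq_smul_of_rep (hf : Function.Injective f) {a b : p.Weyl u} {α β : Lattice n}
    (ha : p.rep f u hu a = p.op (Units.map (f : R →* K) u) α)
    (hb : p.rep f u hu b = p.op (Units.map (f : R →* K) u) β) :
    a * b = ((u ^ (p.form α β - p.form β α) : Rˣ) : R) • (b * a) := by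
  apply p.rep_injective f u hu hf
  rw [rep_smul, map_mul, map_mul, ha, hb, op_comm, ← map_zpow]
  rfl

theorem x_mul_z (hf : Function.Injective f) (j : Fin n) (i : ℕ) (hi : i ≤ n) :
    QWeyl.x R (p.eps u) (p.beta u) j * p.z u i =
      ((u ^ (if (j : ℕ) < i then p.epsExp j else 0) : Rˣ) : R) •
        (p.z u i * QWeyl.x R (p.eps u) (p.beta u) j) := by
  rw [mul_eq_smul_of_rep hu hf (p.rep_x f u hu j) (p.rep_z f u hu i hi), form_zv_left, sub_zero,
    form_xv_zv _ _ _ hi]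

theorem z_mul_z (hf : Function.Injective f) (i k : ℕ) (hi : i ≤ n) (hk : k ≤ n) :
    p.z u i * p.z u k = p.z u k * p.z u i := by
  rw [mul_eq_smul_of_rep hu hf (p.rep_z f u hu i hi) (p.rep_z f u hu k hk), form_zv_left,
    form_zv_left, sub_zero, zpow_zero, Units.val_one, one_smul]

omit hu in
theorem one_sub_smul_y_mul_x (j : Fin n) :
    (1 - (p.eps u j : R)) • (QWeyl.y R (p.eps u) (p.beta u) j * QWeyl.x R (p.eps u) (p.beta u) j) =
      p.z u j - p.z u (j + 1) := by
  rw [z, z, filter_lt_succ j.2, Finset.sum_insert (by simp)]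
  module

omit hu in
theorem z_zero : p.z u 0 = 1 := by simp [z]

end RootData
end

noncomputable section

/-! ### The center at a root of unity -/

namespace RootData

open TorusEnd

variable {n : ℕ} {p : RootData n}

theorem form_nsmul_left (m : ℕ) (α β : Lattice n) : p.form (m • α) β = m * p.form α β := by
  induction m with
  | zero => simp [form_zero_left]
  | succ m ih =>
    rw [succ_nsmul, form_add_left, ih]
    push_cast
    ring

theorem form_nsmul_right (m : ℕ) (α β : Lattice n) : p.form β (m • α) = m * p.form β α := by
  induction m with
  | zero => simp [form_zero_right]
  | succ m ih =>
    rw [succ_nsmul, form_add_right, ih]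
    push_cast
    ring

section TorusSpan

variable {K : Type*} [Field K] {u : Kˣ}

theorem filt_le_span (s : ℤ) : p.filt u s ≤ Submodule.span K (Set.range (p.op u)) :=
  Submodule.span_mono (Set.image_subset_range _ _)

theorem rho_mem_span (hu : ∀ j, p.eps u j ≠ 1) (a : p.Weyl u) :
    p.rho u hu a ∈ Submodule.span K (Set.range (p.op u)) := by
  obtain ⟨c, rfl⟩ := QWeyl.exists_linearCombination_mon a
  rw [Finsupp.linearCombination_apply, Finsupp.sum, map_sum]
  refine sum_mem fun i _ => ?_
  rw [map_smul]
  exact Submodule.smul_mem _ _ (filt_le_span _ (lead_mon hu i).mem_filt)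

/-- With `coef_mul_op`, commuting with a monomial can be tested on one coefficient at a time. -/
theorem coef_op_mul {a : TorusEnd K n} (ha : a ∈ Submodule.span K (Set.range (p.op u)))
    (α β : Lattice n) :
    coef (p.op u β * a) (α + β) = ((u ^ p.form β α : Kˣ) : K) * coef a α := by
  induction ha using Submodule.span_induction with
  | mem a ha =>
    obtain ⟨γ, rfl⟩ := ha
    rw [op_mul, map_smul, coef_op, coef_op, Finsupp.smul_apply, add_comm β, smul_eq_mul]
    by_cases h : γ = α
    · subst h
      simp
    · rw [Finsupp.single_eq_of_ne' (by simpa using h), Finsupp.single_eq_of_ne' h, mul_zero,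
        mul_zero]
  | zero => simp
  | add a b _ _ ha hb => rw [mul_add, map_add coef, map_add coef, Finsupp.add_apply,
      ha, hb, Finsupp.add_apply, mul_add]
  | smul c a _ ha =>
    rw [mul_smul_comm, map_smul, map_smul, Finsupp.smul_apply, Finsupp.smul_apply, ha,
      smul_eq_mul, smul_eq_mul, mul_left_comm]

theorem coef_mul_op {a : TorusEnd K n} (ha : a ∈ Submodule.span K (Set.range (p.op u)))
    (α β : Lattice n) :
    coef (a * p.op u β) (α + β) = ((u ^ p.form α β : Kˣ) : K) * coef a α := by
  induction ha using Submodule.span_induction with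
  | mem a ha =>
    obtain ⟨γ, rfl⟩ := ha
    rw [op_mul, map_smul, coef_op, coef_op, Finsupp.smul_apply, smul_eq_mul]
    by_cases h : γ = α
    · subst h
      simp
    · rw [Finsupp.single_eq_of_ne' (by simpa using h), Finsupp.single_eq_of_ne' h, mul_zero,
        mul_zero]
  | zero => simp
  | add a b _ _ ha hb => rw [add_mul, map_add coef, map_add coef, Finsupp.add_apply,
      ha, hb, Finsupp.add_apply, mul_add]
  | smul c a _ ha =>
    rw [smul_mul_assoc, map_smul, map_smul, Finsupp.smul_apply, Finsupp.smul_apply, ha,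
      smul_eq_mul, smul_eq_mul, mul_left_comm]

theorem mem_center_of_commute (hu : ∀ j, p.eps u j ≠ 1) {w : p.Weyl u}
    (h : ∀ β, p.rho u hu w * p.op u β = p.op u β * p.rho u hu w) :
    w ∈ Subalgebra.center K (p.Weyl u) := by
  rw [Subalgebra.mem_center_iff]
  intro b
  apply rho_injective hu
  rw [map_mul, map_mul]
  have hb := rho_mem_span hu b
  generalize p.rho u hu b = a at hb
  induction hb using Submodule.span_induction with
  | mem a ha =>
    obtain ⟨β, rfl⟩ := ha
    exact (h β).symm
  | zero => simp
  | add a b _ _ ha hb => rw [add_mul, mul_add, ha, hb]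
  | smul c a _ ha => rw [smul_mul_assoc, mul_smul_comm, ha]

end TorusSpan

/-- Multiplication of exponents by the integers `d_j`. -/
def scale (p : RootData n) (s : Fin n ⊕ Fin n →₀ ℕ) : (Fin n → ℕ) × (Fin n → ℕ) :=
  (fun j => p.d j * s (Sum.inr j), fun j => p.d j * s (Sum.inl j))

theorem scale_injective : Function.Injective p.scale := by
  intro s t h
  simp only [scale, Prod.mk.injEq] at h
  ext i
  rcases i with j | j
  · exact Nat.eq_of_mul_eq_mul_left (p.d_pos j) (congrFun h.2 j)
  · exact Nat.eq_of_mul_eq_mul_left (p.d_pos j) (congrFun h.1 j)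

variable {T : Type*} [Field T] {ζ : Tˣ} (hζ : IsPrimitiveRoot ζ p.D)

include hζ

theorem isPrimitiveRoot_eps (j : Fin n) : IsPrimitiveRoot (p.eps ζ j : T) (p.d j) := by
  have key : ∀ t : ℕ, (p.eps ζ j : T) ^ t = 1 ↔ p.d j ∣ t := fun t => by
    rw [← Units.val_pow_eq_pow_val, Units.val_eq_one, eps_eq, ← zpow_natCast, ← zpow_mul,
      hζ.zpow_eq_one_iff_dvd, D_dvd_epsExp_mul, Int.natCast_dvd_natCast]
  exact ⟨(key _).2 dvd_rfl, fun t ht => (key t).1 ht⟩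

variable (hdiv : p.Divisibility)

include hdiv

theorem zpow_form_pow_eq_one {α : Lattice n} {m : ℕ} (h₁ : ∀ k, (p.d k : ℤ) ∣ (m • α).1 k)
    (h₂ : ∀ k, (p.d k : ℤ) ∣ (m • α).2 k) (β : Lattice n) :
    (ζ ^ (p.form α β - p.form β α)) ^ m = 1 := by
  rw [← zpow_natCast, ← zpow_mul, hζ.zpow_eq_one_iff_dvd, sub_mul]
  refine dvd_sub ?_ ?_
  · rw [mul_comm, ← form_nsmul_left]
    exact D_dvd_form_left hdiv h₂ β
  · rw [mul_comm, ← form_nsmul_right]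
    exact D_dvd_form_right hdiv h₁ h₂ β

theorem zpow_form_xv_pow_eq_one (j : Fin n) (β : Lattice n) :
    (ζ ^ (p.form (xv j) β - p.form β (xv j))) ^ p.d j = 1 := by
  classical
  refine zpow_form_pow_eq_one hζ hdiv (fun k => by simp [xv]) (fun k => ?_) β
  rcases eq_or_ne k j with rfl | hk
  · simp [xv]
  · simp [xv, hk]

theorem zpow_form_zv_pow_eq_one (j : Fin n) (β : Lattice n) :
    (ζ ^ (p.form (zv (j + 1)) β - p.form β (zv (j + 1)))) ^ p.d j = 1 := by
  refine zpow_form_pow_eq_one hζ hdiv (fun k => ?_) (fun k => by simp [zv]) β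
  rcases eq_or_ne k j with rfl | hk
  · simp [zv]
  · have : (k : ℕ) ≠ j := fun h => hk (Fin.ext h)
    simp [zv, this]

variable (hu : ∀ j, p.eps ζ j ≠ 1)

include hu

theorem x_pow_mem_center (j : Fin n) :
    QWeyl.x T (p.eps ζ) (p.beta ζ) j ^ p.d j ∈ Subalgebra.center T (p.Weyl ζ) := by
  refine mem_center_of_commute hu fun β => ?_
  rw [map_pow, rho_x, pow_mul_of_mul_eq_smul (p.op_comm ζ _ β), ← Units.val_pow_eq_pow_val,
    zpow_form_xv_pow_eq_one hζ hdiv, Units.val_one, one_smul]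

theorem z_pow_mem_center (j : Fin n) :
    p.z ζ (j + 1) ^ p.d j ∈ Subalgebra.center T (p.Weyl ζ) := by
  refine mem_center_of_commute hu fun β => ?_
  rw [map_pow, rho_z _ _ _ _ j.2, pow_mul_of_mul_eq_smul (p.op_comm ζ _ β),
    ← Units.val_pow_eq_pow_val, zpow_form_zv_pow_eq_one hζ hdiv, Units.val_one, one_smul]

omit hdiv in
theorem smul_y_pow_mul_x_pow (j : Fin n) :
    (1 - (p.eps ζ j : T)) ^ p.d j • (QWeyl.y T (p.eps ζ) (p.beta ζ) j ^ p.d j *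
      QWeyl.x T (p.eps ζ) (p.beta ζ) j ^ p.d j) = p.z ζ j ^ p.d j - p.z ζ (j + 1) ^ p.d j := by
  have hu' : ∀ j, p.eps (Units.map ((RingHom.id T : T →+* T) : T →* T) ζ) j ≠ 1 := hu
  have hf : Function.Injective (RingHom.id T) := fun _ _ h => h
  refine pow_mul_pow_eq_sub (isPrimitiveRoot_eps hζ j) (p.d_pos j) (one_sub_smul_y_mul_x j) ?_ ?_
    (z_mul_z hu' hf _ _ j.2.le j.2)
  · rw [x_mul_z hu' hf j _ j.2, if_pos (Nat.lt_succ_self _), smul_smul, ← eps_eq,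
      inv_mul_cancel₀ (Units.ne_zero _), one_smul]
  · rw [x_mul_z hu' hf j _ j.2.le, if_neg (lt_irrefl _), zpow_zero, Units.val_one, one_smul]

/-- Y X is central because it is a scalar multiple of z_j^{d_j} - z_{j+1}^{d_j}; the first power is
central since the preceding d divides d_j. X is central and invertible in the torus, so it can be
cancelled. -/
theorem y_pow_mem_center (j : Fin n) :
    QWeyl.y T (p.eps ζ) (p.beta ζ) j ^ p.d j ∈ Subalgebra.center T (p.Weyl ζ) := by
  have hX := x_pow_mem_center hζ hdiv hu j
  set X := QWeyl.x T (p.eps ζ) (p.beta ζ) j ^ p.d j with hXdef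
  set Y := QWeyl.y T (p.eps ζ) (p.beta ζ) j ^ p.d j
  have hprev : p.z ζ j ^ p.d j ∈ Subalgebra.center T (p.Weyl ζ) := by
    obtain ⟨i, hi⟩ := j
    cases i with
    | zero => rw [show p.z ζ ((⟨0, hi⟩ : Fin n) : ℕ) = 1 from z_zero, one_pow]; exact one_mem _
    | succ i =>
      obtain ⟨e, he⟩ := (hdiv ⟨i, by omega⟩ ⟨i + 1, hi⟩ (Fin.le_def.2 (Nat.le_succ i))).1
      rw [he, pow_mul]
      exact pow_mem (z_pow_mem_center hζ hdiv hu ⟨i, by omega⟩) _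
  have hc : (1 - (p.eps ζ j : T)) ^ p.d j ≠ 0 := pow_ne_zero _ (by
    rw [← neg_sub]
    exact neg_ne_zero.2 (p.eps_sub_one_ne_zero ζ hu j))
  have hYX : Y * X ∈ Subalgebra.center T (p.Weyl ζ) := by
    have h := smul_y_pow_mul_x_pow hζ hu j
    rw [← inv_smul_smul₀ hc (Y * X), h]
    exact Subalgebra.smul_mem _ (sub_mem hprev (z_pow_mem_center hζ hdiv hu j)) _
  rw [Subalgebra.mem_center_iff] at hX hYX ⊢
  intro b
  apply rho_injective hu
  have hunit : IsUnit (p.rho ζ hu X) := by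
    rw [hXdef, map_pow, rho_x]
    exact (p.isUnit_op ζ _).pow _
  apply hunit.mul_right_cancel
  rw [← map_mul, ← map_mul, mul_assoc, hYX, mul_assoc, mul_assoc, hX]

/-- The central element `X_j = x_j ^ d_j`. -/
def centerX (j : Fin n) : p.Center ζ := ⟨_, x_pow_mem_center hζ hdiv hu j⟩

/-- The central element `Y_j = y_j ^ d_j`. -/
def centerY (j : Fin n) : p.Center ζ := ⟨_, y_pow_mem_center hζ hdiv hu j⟩

/-- By `smul_y_pow_mul_x_pow` the first summand of Z_{j+1} is z_{j+1}^{d_j} - z_j^{d_j}, and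
inductively the second one, a power of the preceding Z, is z_j^{d_j}. -/
theorem coe_Zseq_succ (j : Fin n) :
    ((p.Zseq ζ (centerX hζ hdiv hu) (centerY hζ hdiv hu) (j + 1) : p.Center ζ) : p.Weyl ζ) =
      p.z ζ (j + 1) ^ p.d j := by
  obtain ⟨i, hi⟩ := j
  induction i with
  | zero =>
    have h := smul_y_pow_mul_x_pow hζ hu ⟨0, hi⟩
    simp only [Zseq, dif_pos hi, one_pow]
    simp only [z_zero, one_pow] at h
    change -((1 - (p.eps ζ ⟨0, hi⟩ : T)) ^ p.d ⟨0, hi⟩ • _) + 1 = _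
    refine (congrArg (fun a => -a + 1) h).trans ?_
    abel
  | succ i ih =>
    have h := smul_y_pow_mul_x_pow hζ hu ⟨i + 1, hi⟩
    have ih' := ih (by omega)
    simp only at ih' h ⊢
    rw [Zseq, dif_pos hi]
    have hd : p.d ⟨i, by omega⟩ ∣ p.d ⟨i + 1, hi⟩ :=
      (hdiv ⟨i, by omega⟩ ⟨i + 1, hi⟩ (Fin.le_def.2 (Nat.le_succ i))).1
    have e : ((p.Zseq ζ (centerX hζ hdiv hu) (centerY hζ hdiv hu) (i + 1) ^
        (p.d ⟨i + 1, hi⟩ / p.d ⟨i + 1 - 1, by omega⟩) : p.Center ζ) : p.Weyl ζ) =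
        p.z ζ (i + 1) ^ p.d ⟨i + 1, hi⟩ := by
      rw [SubmonoidClass.coe_pow, ih', ← pow_mul]
      simp only [Nat.add_sub_cancel]
      rw [Nat.mul_div_cancel' hd]
    change -((1 - (p.eps ζ ⟨i + 1, hi⟩ : T)) ^ p.d ⟨i + 1, hi⟩ • _) + _ = _
    refine (congrArg₂ (fun a b => -a + b) h e).trans ?_
    abel

/-- The map from the polynomial algebra to the center. -/
def toCenter : MvPolynomial (Fin n ⊕ Fin n) T →ₐ[T] p.Center ζ :=
  MvPolynomial.aeval (Sum.elim (centerX hζ hdiv hu) (centerY hζ hdiv hu))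

theorem coe_toCenter_monomial (s : Fin n ⊕ Fin n →₀ ℕ) (t : T) :
    ((toCenter hζ hdiv hu (MvPolynomial.monomial s t) : p.Center ζ) : p.Weyl ζ) =
      t • QWeyl.mon T (p.eps ζ) (p.beta ζ) (p.scale s) := by
  have hord : ∀ (g : Fin n → p.Center ζ) (a : Fin n → ℕ),
      ((∏ j, g j ^ a j : p.Center ζ) : p.Weyl ζ) = ordMon (fun j => (g j : p.Weyl ζ)) a := by
    intro g a
    rw [Fin.prod_univ_def, ordMon]
    refine (map_list_prod (Subalgebra.center T (p.Weyl ζ)).val _).trans ?_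
    rw [List.map_map]
    rfl
  rw [toCenter, MvPolynomial.aeval_monomial, ← Algebra.smul_def,
    Finsupp.prod_fintype _ _ (fun _ => pow_zero _), Fintype.prod_sum_type, mul_comm]
  simp only [Sum.elim_inl, Sum.elim_inr]
  change t • (((∏ j, _ : p.Center ζ) : p.Weyl ζ) * ((∏ j, _ : p.Center ζ) : p.Weyl ζ)) = _
  rw [hord, hord, QWeyl.mon]
  simp only [ordMon, scale, pow_mul]
  rfl

theorem toCenter_injective : Function.Injective (toCenter hζ hdiv hu) := by
  rw [injective_iff_map_eq_zero]
  intro f hf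
  have hli := (linearIndependent_mon hu).comp p.scale scale_injective
  have h : ∑ s ∈ f.support, MvPolynomial.coeff s f •
      (QWeyl.mon T (p.eps ζ) (p.beta ζ) ∘ p.scale) s = 0 := by
    rw [f.as_sum, map_sum] at hf
    have h' := congrArg (Subalgebra.center T (p.Weyl ζ)).val hf
    rw [map_sum, map_zero] at h'
    rw [← h']
    exact Finset.sum_congr rfl fun s _ => (coe_toCenter_monomial hζ hdiv hu s _).symm
  by_contra hf0
  obtain ⟨s, hs⟩ := MvPolynomial.support_nonempty.2 hf0
  exact MvPolynomial.mem_support_iff.1 hs (linearIndependent_iff'.1 hli _ _ h s hs)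

/-- A nonzero coefficient of a central element in the torus sits at an exponent that itself commutes
with all z's and x's. Applied to the leading exponent, this shows that the leading monomial is a
monomial in the X's and Y's; subtract it and induct on the number of terms. -/
theorem toCenter_surjective : Function.Surjective (toCenter hζ hdiv hu) := by
  classical
  have key : ∀ (N : ℕ) (c : ((Fin n → ℕ) × (Fin n → ℕ)) →₀ T), c.support.card ≤ N →
      Finsupp.linearCombination T (QWeyl.mon T (p.eps ζ) (p.beta ζ)) c ∈
        Subalgebra.center T (p.Weyl ζ) →
      ∃ f, ((toCenter hζ hdiv hu f : p.Center ζ) : p.Weyl ζ) =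
        Finsupp.linearCombination T (QWeyl.mon T (p.eps ζ) (p.beta ζ)) c := by
    intro N
    induction N with
    | zero =>
      intro c hc _
      have : c = 0 := Finsupp.support_eq_empty.1 (Finset.card_eq_zero.1 (Nat.le_zero.1 hc))
      exact ⟨0, by rw [this, map_zero, map_zero]; rfl⟩
    | succ N ih =>
      intro c hc hcen
      by_cases hc0 : c = 0
      · exact ⟨0, by rw [hc0, map_zero, map_zero]; rfl⟩
      obtain ⟨i, hi, hcoef⟩ := exists_coef_ne_zero hu hc0
      set w := Finsupp.linearCombination T (QWeyl.mon T (p.eps ζ) (p.beta ζ)) c with hw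
      have hD : ∀ (b : p.Weyl ζ) (β : Lattice n), p.rho ζ hu b = p.op ζ β →
          (p.D : ℤ) ∣ p.form (vec i) β - p.form β (vec i) := by
        intro b β hb
        have h1 := (Subalgebra.mem_center_iff.1 hcen) b
        have h2 := congrArg (fun a => coef (p.rho ζ hu a) (vec i + β)) h1
        simp only [map_mul, hb] at h2
        rw [coef_op_mul (rho_mem_span hu w), coef_mul_op (rho_mem_span hu w)] at h2
        have h3 := Units.ext (mul_right_cancel₀ hcoef h2)
        rw [← hζ.zpow_eq_one_iff_dvd, zpow_sub, h3, mul_inv_cancel]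
      obtain ⟨h₁, h₂⟩ := d_dvd_of_D_dvd_form hdiv (fun k => hD _ _ (p.rho_z ζ hu _ k.2))
        (fun k => hD _ _ (p.rho_x ζ hu k))
      have h₁' : ∀ k, p.d k ∣ i.1 k := fun k => Int.natCast_dvd_natCast.1 (h₁ k)
      -- The x-part of `vec i` is the difference of the exponents of x_k and y_k, and the latter is
      -- already divisible.
      have h₂' : ∀ k, p.d k ∣ i.2 k := fun k => by
        have h := (dvd_sub_left (h₁ k)).1 (h₂ k)
        exact_mod_cast h
      choose a ha using h₁'
      choose b hb using h₂'
      let s : Fin n ⊕ Fin n →₀ ℕ := Finsupp.equivFunOnFinite.symm (Sum.elim b a)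
      have hs : p.scale s = i := by
        refine Prod.ext (funext fun j => ?_) (funext fun j => ?_)
        · exact (ha j).symm
        · exact (hb j).symm
      have hmon := coe_toCenter_monomial hζ hdiv hu s (c i)
      rw [hs] at hmon
      have herase : Finsupp.linearCombination T (QWeyl.mon T (p.eps ζ) (p.beta ζ)) (c.erase i) =
          w - c i • QWeyl.mon T (p.eps ζ) (p.beta ζ) i := by
        rw [hw, eq_sub_iff_add_eq, ← Finsupp.linearCombination_single, ← map_add,
          Finsupp.erase_add_single]
      obtain ⟨f, hf⟩ := ih (c.erase i) (by
        rw [Finsupp.support_erase, Finset.card_erase_of_mem (Finsupp.mem_support_iff.2 hi)]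
        omega) (by
        rw [herase, ← hmon]
        exact sub_mem hcen (Subtype.property _))
      refine ⟨f + MvPolynomial.monomial s (c i), ?_⟩
      rw [map_add]
      refine (congrArg₂ (· + ·) hf hmon).trans ?_
      rw [herase, sub_add_cancel]
  rintro ⟨w, hw⟩
  obtain ⟨c, rfl⟩ := QWeyl.exists_linearCombination_mon w
  obtain ⟨f, hf⟩ := key _ c le_rfl hw
  exact ⟨f, Subtype.ext hf⟩

/-- The center is a polynomial algebra in the elements `X_j` and `Y_j`. -/
def centerEquiv : MvPolynomial (Fin n ⊕ Fin n) T ≃ₐ[T] p.Center ζ :=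
  AlgEquiv.ofBijective (toCenter hζ hdiv hu)
    ⟨toCenter_injective hζ hdiv hu, toCenter_surjective hζ hdiv hu⟩

theorem centerEquiv_inl (j : Fin n) :
    centerEquiv hζ hdiv hu (MvPolynomial.X (Sum.inl j)) = centerX hζ hdiv hu j :=
  MvPolynomial.aeval_X _ _

theorem centerEquiv_inr (j : Fin n) :
    centerEquiv hζ hdiv hu (MvPolynomial.X (Sum.inr j)) = centerY hζ hdiv hu j :=
  MvPolynomial.aeval_X _ _

end RootData
end

noncomputable section

/-! ### The Poisson bracket of the center -/

namespace RootData

variable {n : ℕ} {p : RootData n} {T : Type*} [Field T]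

section Laurent

variable (ζ : Tˣ)

theorem evalAt_C (t : T) : evalAt ζ (LaurentPolynomial.C t) = t := by
  simp [evalAt]

theorem evalAt_q_zpow (N : ℤ) :
    evalAt ζ ((q T ^ N : (LaurentPolynomial T)ˣ) : LaurentPolynomial T) =
    ((ζ ^ N : Tˣ) : T) := by
  have h := congrArg Units.val
    (map_zpow (Units.map (evalAt ζ : LaurentPolynomial T →* T)) (q T) N)
  rw [map_q] at h
  exact h

theorem evalAt_q : evalAt ζ (q T : LaurentPolynomial T) = ζ := by
  simpa using evalAt_q_zpow ζ 1

theorem qSub_dvd_of_evalAt_eq_zero {a : LaurentPolynomial T} (h : evalAt ζ a = 0) :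
    qSub ζ ∣ a := by
  obtain ⟨m, f, hf⟩ := LaurentPolynomial.exists_T_pow a
  have hq : qSub ζ = Polynomial.toLaurent (Polynomial.X - Polynomial.C (ζ : T)) := by
    rw [map_sub, Polynomial.toLaurent_X, Polynomial.toLaurent_C]
    rfl
  have hroot : Polynomial.eval (ζ : T) f = 0 := by
    have h1 : evalAt ζ (Polynomial.toLaurent f) = 0 := by rw [hf, map_mul, h, zero_mul]
    rw [← h1, evalAt, LaurentPolynomial.eval₂_toLaurent]
    rfl
  have h2 : qSub ζ ∣ a * LaurentPolynomial.T m := by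
    rw [← hf, hq]
    exact map_dvd Polynomial.toLaurent (Polynomial.dvd_iff_isRoot.2 hroot)
  exact ((LaurentPolynomial.isUnit_T m).dvd_mul_right).1 h2

theorem qSub_ne_zero : qSub ζ ≠ 0 := by
  intro h
  have h1 : Polynomial.toLaurent (Polynomial.X - Polynomial.C (ζ : T)) = 0 := by
    rw [← h, map_sub, Polynomial.toLaurent_X, Polynomial.toLaurent_C]
    rfl
  exact Polynomial.X_sub_C_ne_zero (ζ : T)
    (Polynomial.toLaurent_injective (h1.trans (map_zero _).symm))

/-- The value of g at ζ is the derivative of q^N there, N ζ^{N-1}. For positive N it is read off the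
geometric sum; negative powers reduce to q^{-m} - 1 = -q^{-m} (q^m - 1). -/
theorem exists_q_zpow_sub_one {N : ℤ} (hN : ζ ^ N = 1) : ∃ g : LaurentPolynomial T,
    ((q T ^ N : (LaurentPolynomial T)ˣ) : LaurentPolynomial T) - 1 = qSub ζ * g ∧
      evalAt ζ g = N * (ζ : T)⁻¹ := by
  have hnat : ∀ m : ℕ, ζ ^ m = 1 → ∃ g : LaurentPolynomial T,
      (q T : LaurentPolynomial T) ^ m - 1 = qSub ζ * g ∧ evalAt ζ g = m * (ζ : T)⁻¹ := by
    intro m hm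
    have hm' : (ζ : T) ^ m = 1 := by rw [← Units.val_pow_eq_pow_val, hm, Units.val_one]
    refine ⟨∑ i ∈ Finset.range m, (q T : LaurentPolynomial T) ^ i *
      (LaurentPolynomial.C (ζ : T)) ^ (m - 1 - i), ?_, ?_⟩
    · rw [qSub, mul_comm, geom_sum₂_mul, ← map_pow, hm', map_one]
    · simp only [map_sum, map_mul, map_pow, evalAt_q, evalAt_C]
      rw [geom_sum₂_self]
      rcases Nat.eq_zero_or_pos m with rfl | hpos
      · simp
      · congr 1
        exact eq_inv_of_mul_eq_one_left (by rw [← pow_succ, Nat.sub_add_cancel hpos, hm'])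
  obtain ⟨m, rfl | rfl⟩ := N.eq_nat_or_neg
  · obtain ⟨g, h₁, h₂⟩ := hnat m (by rwa [zpow_natCast] at hN)
    refine ⟨g, ?_, by rw [h₂, Int.cast_natCast]⟩
    rw [zpow_natCast, Units.val_pow_eq_pow_val, h₁]
  · have hm : ζ ^ m = 1 := by rwa [zpow_neg, inv_eq_one, zpow_natCast] at hN
    obtain ⟨g, h₁, h₂⟩ := hnat m hm
    refine ⟨-((q T ^ (-(m : ℤ)) : (LaurentPolynomial T)ˣ) : LaurentPolynomial T) * g, ?_, ?_⟩
    · have h3 : ((q T ^ (-(m : ℤ)) : (LaurentPolynomial T)ˣ) : LaurentPolynomial T) *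
          (q T : LaurentPolynomial T) ^ m = 1 := by
        rw [← Units.val_pow_eq_pow_val, ← Units.val_mul, ← zpow_natCast, ← zpow_add,
          neg_add_cancel, zpow_zero, Units.val_one]
      linear_combination h3 -
        ((q T ^ (-(m : ℤ)) : (LaurentPolynomial T)ˣ) : LaurentPolynomial T) * h₁
    · rw [map_mul, map_neg, evalAt_q_zpow, h₂, hN]
      push_cast
      ring

/-- The embedding of `T[q, q⁻¹]` into its field of fractions. -/
abbrev toFrac (T : Type*) [Field T] :
    LaurentPolynomial T →+* FractionRing (LaurentPolynomial T) := algebraMap _ _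

theorem toFrac_injective : Function.Injective (toFrac T) := IsFractionRing.injective _ _

theorem eps_q_ne_one (j : Fin n) : p.eps (Units.map
    (toFrac T : LaurentPolynomial T →* FractionRing (LaurentPolynomial T)) (q T)) j ≠ 1 := by
  intro h
  have h1 := congrArg Units.val h
  rw [← map_eps, Units.val_one, ← map_one (toFrac T)] at h1
  have h2 := toFrac_injective h1
  have hpos : 0 < p.D / p.d j * p.m j :=
    Nat.mul_pos (Nat.div_pos (Nat.le_of_dvd p.D_pos (p.d_dvd_D j)) (p.d_pos j)) (p.m_pos j)
  have h3 : (LaurentPolynomial.T 1 : LaurentPolynomial T) ^ (p.D / p.d j * p.m j) = 1 := by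
    rw [← h2, eps, Units.val_pow_eq_pow_val]
    rfl
  rw [LaurentPolynomial.T_pow, ← LaurentPolynomial.T_zero] at h3
  have h4 := congrArg LaurentPolynomial.degree h3
  rw [LaurentPolynomial.degree_T, LaurentPolynomial.degree_T] at h4
  have h5 : ((p.D / p.d j * p.m j : ℕ) : ℤ) * 1 = 0 := WithBot.coe_injective h4
  omega

end Laurent

/-- The generic algebra embeds in operators over the fraction field of T[q, q⁻¹], where q - ζ is an
invertible scalar. -/
theorem qSub_smul_cancel {ζ : Tˣ} {a b : p.Weyl (q T)} (h : qSub ζ • a = qSub ζ • b) : a = b := by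
  apply p.rep_injective (toFrac T) _ eps_q_ne_one toFrac_injective
  have h1 := congrArg (p.rep (toFrac T) _ eps_q_ne_one) h
  rw [rep_smul, rep_smul] at h1
  exact (smul_right_injective _ ((map_ne_zero_iff _ toFrac_injective).2 (qSub_ne_zero ζ))) h1

theorem sigma_smul (ζ : Tˣ) (r : LaurentPolynomial T) (a : p.Weyl (q T)) :
    p.sigma ζ (r • a) = evalAt ζ r • p.sigma ζ a := QWeyl.map_smul' _ _ _ r a

theorem sigma_linearCombination_mon (ζ : Tˣ)
    (c : ((Fin n → ℕ) × (Fin n → ℕ)) →₀ LaurentPolynomial T) :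
    p.sigma ζ (Finsupp.linearCombination _ (QWeyl.mon _ _ _) c) =
      Finsupp.linearCombination T (QWeyl.mon T (p.eps ζ) (p.beta ζ))
        (c.mapRange (evalAt ζ) (map_zero _)) :=
  QWeyl.map_linearCombination_mon _ _ _ c

theorem sigma_surjective (ζ : Tˣ) : Function.Surjective (p.sigma ζ) := by
  intro w
  obtain ⟨c, rfl⟩ := QWeyl.exists_linearCombination_mon w
  refine ⟨Finsupp.linearCombination _ (QWeyl.mon _ _ _)
    (c.mapRange LaurentPolynomial.C (map_zero _)), ?_⟩
  rw [sigma_linearCombination_mon]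
  congr 1
  ext i
  simp [evalAt_C]

section Bracket

variable {ζ : Tˣ} (hu : ∀ j, p.eps ζ j ≠ 1)

include hu

/-- Specialization acts on the coefficients of ordered monomials, which are independent at ζ. So
every coefficient vanishes at ζ, hence is divisible by q - ζ. -/
theorem exists_eq_qSub_smul {a : p.Weyl (q T)} (ha : p.sigma ζ a = 0) : ∃ b, a = qSub ζ • b := by
  obtain ⟨c, rfl⟩ := QWeyl.exists_linearCombination_mon a
  rw [sigma_linearCombination_mon] at ha
  have h0 := linearIndependent_iff.1 (linearIndependent_mon hu) _ ha
  have hdvd : ∀ i, qSub ζ ∣ c i := fun i => by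
    apply qSub_dvd_of_evalAt_eq_zero
    have := DFunLike.congr_fun h0 i
    rwa [Finsupp.mapRange_apply, Finsupp.zero_apply] at this
  choose g hg using hdvd
  refine ⟨∑ i ∈ c.support, g i • QWeyl.mon _ _ _ i, ?_⟩
  rw [Finsupp.linearCombination_apply, Finsupp.sum, Finset.smul_sum]
  exact Finset.sum_congr rfl fun i _ => by rw [smul_smul, ← hg]

theorem exists_commutator_eq {c₁ : p.Weyl (q T)} (h : p.sigma ζ c₁ ∈ Subalgebra.center T (p.Weyl ζ))
    (c₂ : p.Weyl (q T)) : ∃ c, c₁ * c₂ - c₂ * c₁ = qSub ζ • c := by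
  apply exists_eq_qSub_smul hu
  rw [map_sub, map_mul, map_mul, (Subalgebra.mem_center_iff.1 h), sub_self]

omit hu in
-- Two lifts differ by (q - ζ) a and (q - ζ) b. This changes the quotient by [c₁, b] + [a, c₂'],
-- which specializes to 0 because the specializations of c₁ and c₂' are central.
theorem sigma_eq_of_commutator_eq {c₁ c₂ c c₁' c₂' c' : p.Weyl (q T)} (hu : ∀ j, p.eps ζ j ≠ 1)
    (h₁ : p.sigma ζ c₁ ∈ Subalgebra.center T (p.Weyl ζ))
    (h₂ : p.sigma ζ c₂ ∈ Subalgebra.center T (p.Weyl ζ))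
    (e₁ : p.sigma ζ c₁' = p.sigma ζ c₁) (e₂ : p.sigma ζ c₂' = p.sigma ζ c₂)
    (hc : c₁ * c₂ - c₂ * c₁ = qSub ζ • c) (hc' : c₁' * c₂' - c₂' * c₁' = qSub ζ • c') :
    p.sigma ζ c' = p.sigma ζ c := by
  obtain ⟨a, ha⟩ := exists_eq_qSub_smul hu (a := c₁' - c₁) (by rw [map_sub, e₁, sub_self])
  obtain ⟨b, hb⟩ := exists_eq_qSub_smul hu (a := c₂' - c₂) (by rw [map_sub, e₂, sub_self])
  have h : c' = c + ((c₁ * b - b * c₁) + (a * c₂' - c₂' * a)) := by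
    apply qSub_smul_cancel (ζ := ζ)
    rw [← hc', smul_add, ← hc, smul_add, smul_sub, smul_sub, ← mul_smul_comm, ← smul_mul_assoc,
      ← smul_mul_assoc, ← mul_smul_comm, ← ha, ← hb]
    noncomm_ring
  rw [h, map_add, map_add, map_sub, map_sub, map_mul, map_mul, map_mul, map_mul, e₂,
    Subalgebra.mem_center_iff.1 h₁, Subalgebra.mem_center_iff.1 h₂]
  simp

/-- By the Jacobi identity for commutators, [c, b] = [c₁, e₂] - [c₂, e₁] where (q - ζ) e_i = [c_i,
b]; the right side specializes to 0. -/
theorem sigma_mem_center {c₁ c₂ c : p.Weyl (q T)}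
    (h₁ : p.sigma ζ c₁ ∈ Subalgebra.center T (p.Weyl ζ))
    (h₂ : p.sigma ζ c₂ ∈ Subalgebra.center T (p.Weyl ζ))
    (hc : c₁ * c₂ - c₂ * c₁ = qSub ζ • c) : p.sigma ζ c ∈ Subalgebra.center T (p.Weyl ζ) := by
  rw [Subalgebra.mem_center_iff]
  intro w
  obtain ⟨b, rfl⟩ := sigma_surjective (p := p) ζ w
  obtain ⟨e₁, he₁⟩ := exists_commutator_eq hu h₁ b
  obtain ⟨e₂, he₂⟩ := exists_commutator_eq hu h₂ b
  have h : c * b - b * c = (c₁ * e₂ - e₂ * c₁) - (c₂ * e₁ - e₁ * c₂) := by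
    apply qSub_smul_cancel (ζ := ζ)
    rw [smul_sub, smul_sub, smul_sub, smul_sub, ← smul_mul_assoc, ← mul_smul_comm, ← hc,
      ← mul_smul_comm, ← smul_mul_assoc, ← he₂, ← mul_smul_comm, ← smul_mul_assoc, ← he₁]
    noncomm_ring
  have h' := congrArg (p.sigma ζ) h
  rw [map_sub, map_sub, map_sub, map_sub, map_mul, map_mul, map_mul, map_mul, map_mul, map_mul,
    Subalgebra.mem_center_iff.1 h₁, Subalgebra.mem_center_iff.1 h₂, sub_self, sub_self,
    sub_self, sub_eq_zero] at h'
  exact h'.symm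

theorem coe_bracket {z₁ z₂ : p.Center ζ} {c₁ c₂ c : p.Weyl (q T)} (h₁ : p.sigma ζ c₁ = z₁)
    (h₂ : p.sigma ζ c₂ = z₂) (hc : c₁ * c₂ - c₂ * c₁ = qSub ζ • c) :
    p.sigma ζ c = p.bracket ζ z₁ z₂ := by
  have m₁ : p.sigma ζ c₁ ∈ Subalgebra.center T (p.Weyl ζ) := h₁ ▸ z₁.2
  have m₂ : p.sigma ζ c₂ ∈ Subalgebra.center T (p.Weyl ζ) := h₂ ▸ z₂.2
  have hex : ∃ w, p.IsBracketValue ζ z₁ z₂ w :=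
    ⟨⟨_, sigma_mem_center hu m₁ m₂ hc⟩, c₁, c₂, c, h₁, h₂, hc, rfl⟩
  obtain ⟨c₁', c₂', c', h₁', h₂', hc', hw⟩ := Classical.epsilon_spec hex
  rw [bracket, ← hw]
  exact (sigma_eq_of_commutator_eq hu m₁ m₂ (h₁'.trans h₁.symm) (h₂'.trans h₂.symm) hc hc').symm

theorem bracketWellDefined : p.BracketWellDefined ζ := fun z₁ _ _ c₂ h₁ h₂ =>
  ⟨exists_commutator_eq hu (h₁ ▸ z₁.2) c₂, fun _ hc => coe_bracket hu h₁ h₂ hc⟩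

theorem exists_lifts (z₁ z₂ : p.Center ζ) {c₁ c₂ : p.Weyl (q T)} (h₁ : p.sigma ζ c₁ = z₁)
    (h₂ : p.sigma ζ c₂ = z₂) :
    ∃ c, c₁ * c₂ - c₂ * c₁ = qSub ζ • c ∧ p.sigma ζ c = p.bracket ζ z₁ z₂ := by
  obtain ⟨c, hc⟩ := exists_commutator_eq hu (c₁ := c₁) (h₁ ▸ z₁.2) c₂
  exact ⟨c, hc, coe_bracket hu h₁ h₂ hc⟩

theorem bracket_anti (z₁ z₂ : p.Center ζ) : p.bracket ζ z₁ z₂ = -p.bracket ζ z₂ z₁ := by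
  obtain ⟨c₁, h₁⟩ := sigma_surjective (p := p) ζ z₁
  obtain ⟨c₂, h₂⟩ := sigma_surjective (p := p) ζ z₂
  obtain ⟨c, hc, e⟩ := exists_lifts hu z₁ z₂ h₁ h₂
  apply Subtype.ext
  have h := coe_bracket hu h₂ h₁ (c := -c) (by rw [smul_neg, ← hc, neg_sub])
  change _ = -(p.bracket ζ z₂ z₁ : p.Weyl ζ)
  rw [← h, map_neg, neg_neg, e]

theorem isPoissonBracket : IsPoissonBracket T (p.bracket ζ) where
  add_left a b c := by
    obtain ⟨a', ha⟩ := sigma_surjective (p := p) ζ a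
    obtain ⟨b', hb⟩ := sigma_surjective (p := p) ζ b
    obtain ⟨c', hc⟩ := sigma_surjective (p := p) ζ c
    obtain ⟨e₁, he₁, hv₁⟩ := exists_lifts hu a c ha hc
    obtain ⟨e₂, he₂, hv₂⟩ := exists_lifts hu b c hb hc
    apply Subtype.ext
    rw [← coe_bracket hu (c₁ := a' + b') (c := e₁ + e₂) (by rw [map_add, ha, hb]; rfl) hc
      (by rw [smul_add, ← he₁, ← he₂]; noncomm_ring), map_add, hv₁, hv₂]
    rfl
  smul_left t a b := by
    obtain ⟨a', ha⟩ := sigma_surjective (p := p) ζ a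
    obtain ⟨b', hb⟩ := sigma_surjective (p := p) ζ b
    obtain ⟨e, he, hv⟩ := exists_lifts hu a b ha hb
    apply Subtype.ext
    rw [← coe_bracket hu (c₁ := LaurentPolynomial.C t • a') (c := LaurentPolynomial.C t • e)
      (by rw [sigma_smul, evalAt_C, ha]; rfl) hb
      (by rw [smul_comm, ← he, smul_sub, smul_mul_assoc, mul_smul_comm]), sigma_smul, evalAt_C, hv]
    rfl
  alternating a := by
    obtain ⟨a', ha⟩ := sigma_surjective (p := p) ζ a
    apply Subtype.ext
    rw [← coe_bracket hu ha ha (c := 0) (by rw [sub_self, smul_zero]), map_zero]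
    rfl
  jacobi a b c := by
    obtain ⟨a', ha⟩ := sigma_surjective (p := p) ζ a
    obtain ⟨b', hb⟩ := sigma_surjective (p := p) ζ b
    obtain ⟨c', hc⟩ := sigma_surjective (p := p) ζ c
    obtain ⟨e₁, he₁, hv₁⟩ := exists_lifts hu b c hb hc
    obtain ⟨e₂, he₂, hv₂⟩ := exists_lifts hu c a hc ha
    obtain ⟨e₃, he₃, hv₃⟩ := exists_lifts hu a b ha hb
    obtain ⟨f₁, hf₁, hw₁⟩ := exists_lifts hu a _ ha hv₁
    obtain ⟨f₂, hf₂, hw₂⟩ := exists_lifts hu b _ hb hv₂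
    obtain ⟨f₃, hf₃, hw₃⟩ := exists_lifts hu c _ hc hv₃
    -- Each f_i is a double commutator divided by (q - ζ)², so two cancellations reduce to the
    -- Jacobi identity of the associative algebra.
    have h : f₁ + f₂ + f₃ = 0 := by
      apply qSub_smul_cancel (ζ := ζ)
      apply qSub_smul_cancel (ζ := ζ)
      simp only [smul_add, smul_zero]
      rw [← hf₁, ← hf₂, ← hf₃, smul_sub, smul_sub, smul_sub, ← mul_smul_comm, ← smul_mul_assoc,
        ← mul_smul_comm, ← smul_mul_assoc, ← mul_smul_comm, ← smul_mul_assoc, ← he₁, ← he₂, ← he₃]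
      noncomm_ring
    apply Subtype.ext
    have h' := congrArg (p.sigma ζ) h
    rw [map_add, map_add, hw₁, hw₂, hw₃, map_zero] at h'
    exact h'
  leibniz a b c := by
    obtain ⟨a', ha⟩ := sigma_surjective (p := p) ζ a
    obtain ⟨b', hb⟩ := sigma_surjective (p := p) ζ b
    obtain ⟨c', hc⟩ := sigma_surjective (p := p) ζ c
    obtain ⟨e₁, he₁, hv₁⟩ := exists_lifts hu a b ha hb
    obtain ⟨e₂, he₂, hv₂⟩ := exists_lifts hu a c ha hc
    apply Subtype.ext
    rw [← coe_bracket hu ha (c₂ := b' * c') (c := e₁ * c' + b' * e₂)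
      (by rw [map_mul, hb, hc]; rfl)
      (by rw [smul_add, ← smul_mul_assoc, ← mul_smul_comm, ← he₁, ← he₂]; noncomm_ring), map_add,
      map_mul, map_mul, hv₁, hv₂, hb, hc]
    rfl

/-- The commutator is (q^N - 1) c₂ c₁, and (q^N - 1) / (q - ζ) takes the value N ζ⁻¹ at ζ. -/
theorem bracket_of_mul_eq_smul {z₁ z₂ : p.Center ζ} {c₁ c₂ : p.Weyl (q T)}
    (h₁ : p.sigma ζ c₁ = z₁) (h₂ : p.sigma ζ c₂ = z₂) {N : ℤ} (hN : ζ ^ N = 1)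
    (h : c₁ * c₂ =
      ((q T ^ N : (LaurentPolynomial T)ˣ) : LaurentPolynomial T) • (c₂ * c₁)) :
    p.bracket ζ z₁ z₂ = ((N : T) * (ζ : T)⁻¹) • (z₁ * z₂) := by
  obtain ⟨g, hg, hev⟩ := exists_q_zpow_sub_one ζ hN
  apply Subtype.ext
  rw [← coe_bracket hu h₁ h₂ (c := g • (c₂ * c₁)) (by
    rw [h, smul_smul, ← hg, sub_smul, one_smul]), sigma_smul, hev, map_mul, h₁, h₂, mul_comm z₁]
  rfl

end Bracket

end RootData
end

noncomputable section

/-! ### The Poisson structure of the center in terms of `X_j` and `Z_j` -/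

namespace RootData

open MvPolynomial

variable {n : ℕ} {p : RootData n} {T : Type*} [Field T] {ζ : Tˣ} (hζ : IsPrimitiveRoot ζ p.D)
  (hdiv : p.Divisibility) (hu : ∀ j, p.eps ζ j ≠ 1)

theorem sigma_x (j : Fin n) :
    p.sigma ζ (QWeyl.x _ _ _ j) = QWeyl.x T (p.eps ζ) (p.beta ζ) j := QWeyl.map_x _ _ _ j

theorem sigma_z (i : ℕ) : p.sigma ζ (p.z (q T) i) = p.z ζ i := p.map_z _ _ _ i

theorem bracket_of_rep (hu : ∀ j, p.eps ζ j ≠ 1) {z₁ z₂ : p.Center ζ} {c₁ c₂ : p.Weyl (q T)}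
    {α β : Lattice n} {k l : ℕ} (h₁ : p.sigma ζ (c₁ ^ k) = z₁) (h₂ : p.sigma ζ (c₂ ^ l) = z₂)
    (r₁ : p.rep (toFrac T) (q T) eps_q_ne_one c₁ =
      p.op (Units.map (toFrac T : LaurentPolynomial T →* FractionRing (LaurentPolynomial T)) (q T)) α)
    (r₂ : p.rep (toFrac T) (q T) eps_q_ne_one c₂ =
      p.op (Units.map (toFrac T : LaurentPolynomial T →* FractionRing (LaurentPolynomial T)) (q T)) β)
    (hone : (ζ ^ (p.form α β - p.form β α)) ^ k = 1) :
    p.bracket ζ z₁ z₂ =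
      ((((p.form α β - p.form β α) * (k * l : ℕ) : ℤ) : T) * (ζ : T)⁻¹) • (z₁ * z₂) := by
  refine bracket_of_mul_eq_smul hu h₁ h₂ ?_ ?_
  · rw [zpow_mul, zpow_natCast, pow_mul, hone, one_pow]
  · have h : c₁ * c₂ = ((q T ^ (p.form α β - p.form β α) : (LaurentPolynomial T)ˣ) :
        LaurentPolynomial T) • (c₂ * c₁) :=
      mul_eq_smul_of_rep (f := toFrac T) eps_q_ne_one toFrac_injective r₁ r₂
    rw [pow_mul_pow_of_mul_eq_smul h, zpow_mul, zpow_natCast, Units.val_pow_eq_pow_val]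

theorem coe_centerEquiv_inl (j : Fin n) :
    ((centerEquiv hζ hdiv hu (X (Sum.inl j)) : p.Center ζ) : p.Weyl ζ) =
      QWeyl.x T (p.eps ζ) (p.beta ζ) j ^ p.d j := by
  rw [centerEquiv_inl]
  rfl

theorem coe_centerEquiv_inr (j : Fin n) :
    ((centerEquiv hζ hdiv hu (X (Sum.inr j)) : p.Center ζ) : p.Weyl ζ) =
      QWeyl.y T (p.eps ζ) (p.beta ζ) j ^ p.d j := by
  rw [centerEquiv_inr]
  rfl

theorem coe_Zseq_centerEquiv (j : Fin n) :
    ((p.Zseq ζ (fun j => centerEquiv hζ hdiv hu (X (Sum.inl j)))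
      (fun j => centerEquiv hζ hdiv hu (X (Sum.inr j))) (j + 1) : p.Center ζ) : p.Weyl ζ) =
      p.z ζ (j + 1) ^ p.d j := by
  simp only [centerEquiv_inl, centerEquiv_inr]
  exact coe_Zseq_succ hζ hdiv hu j

/-- The center of the quantized Weyl algebra at a root of unity. -/
def weylCenterData [CharZero T] : WeylCenterData T n (p.Center ζ) where
  br := p.bracket ζ
  isPoisson := isPoissonBracket hu
  anti := bracket_anti hu
  equiv := centerEquiv hζ hdiv hu
  Z := p.Zseq ζ (fun j => centerEquiv hζ hdiv hu (X (Sum.inl j)))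
    (fun j => centerEquiv hζ hdiv hu (X (Sum.inr j)))
  c j := (1 - (p.eps ζ j : T)) ^ p.d j
  -- For j = 0 the truncated subtraction gives exponent 1, which is harmless because Z_0 = 1.
  e j := p.d j / p.d ⟨j - 1, by omega⟩
  c_ne j := pow_ne_zero _ (sub_ne_zero.2 fun h => hu j (Units.ext h.symm))
  Z_zero := rfl
  Z_succ j := by rw [Zseq, dif_pos j.2]
  wXX j k := (((p.form (xv j) (xv k) - p.form (xv k) (xv j)) * (p.d j * p.d k : ℕ) : ℤ) : T) *
    (ζ : T)⁻¹
  wXZ j k := (((p.form (xv j) (zv (k + 1)) - p.form (zv (k + 1)) (xv j)) *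
    (p.d j * p.d k : ℕ) : ℤ) : T) * (ζ : T)⁻¹
  br_X_X j k := bracket_of_rep hu
    (by rw [coe_centerEquiv_inl, map_pow, sigma_x]) (by rw [coe_centerEquiv_inl, map_pow, sigma_x])
    (p.rep_x _ _ _ j) (p.rep_x _ _ _ k) (zpow_form_xv_pow_eq_one hζ hdiv j _)
  br_X_Z j k := bracket_of_rep hu
    (by rw [coe_centerEquiv_inl, map_pow, sigma_x]) (by rw [coe_Zseq_centerEquiv, map_pow, sigma_z])
    (p.rep_x _ _ _ j) (p.rep_z _ _ _ _ k.2) (zpow_form_xv_pow_eq_one hζ hdiv j _)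
  br_Z_Z j k := by
    rw [bracket_of_rep hu (by rw [coe_Zseq_centerEquiv, map_pow, sigma_z])
      (by rw [coe_Zseq_centerEquiv, map_pow, sigma_z]) (p.rep_z _ _ _ _ j.2) (p.rep_z _ _ _ _ k.2)
      (zpow_form_zv_pow_eq_one hζ hdiv j _), form_zv_left, form_zv_left]
    simp
  wXZ_eq_zero j k hkj := by
    rw [form_zv_left, form_xv_zv _ _ _ k.2, if_neg (by simpa [Nat.lt_succ_iff] using hkj)]
    simp
  -- For j ≤ k the integer is (D m_j / d_j) d_j d_k > 0, which stays nonzero in characteristic 0.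
  wXZ_ne_zero j k hjk := by
    have hpos : 0 < p.D / p.d j * p.m j :=
      Nat.mul_pos (Nat.div_pos (Nat.le_of_dvd p.D_pos (p.d_dvd_D j)) (p.d_pos j)) (p.m_pos j)
    rw [form_zv_left, form_xv_zv _ _ _ k.2, if_pos (Nat.lt_succ_of_le hjk), sub_zero, epsExp]
    refine mul_ne_zero (Int.cast_ne_zero.2 (mul_ne_zero ?_ ?_)) (inv_ne_zero (Units.ne_zero ζ))
    · exact_mod_cast hpos.ne'
    · exact_mod_cast (Nat.mul_pos (p.d_pos j) (p.d_pos k)).ne'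

end RootData

end

theorem mainTheorem8 {T : Type*} [Field T] [CharZero T] {n : ℕ} (hn : 0 < n)
    (p : RootData n) (ζ : Tˣ) (hζ : IsPrimitiveRoot ζ p.D)
    (hε : ∀ j, p.eps ζ j ≠ 1) (hdiv : p.Divisibility) :
    -- the specialization induces a Poisson structure on the center
    Function.Surjective (p.sigma ζ) ∧ p.BracketWellDefined ζ ∧
    IsPoissonBracket T (p.bracket ζ) ∧
    -- the elements `X_j = x_j ^ d_j` and `Y_j = y_j ^ d_j` are central
    ∃ X Y : Fin n → p.Center ζ,
      (∀ j, (X j : p.Weyl ζ) = QWeyl.x T (p.eps ζ) (p.beta ζ) j ^ p.d j) ∧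
      (∀ j, (Y j : p.Weyl ζ) = QWeyl.y T (p.eps ζ) (p.beta ζ) j ^ p.d j) ∧
      -- the localization at all `X_j` and `Z_j` has a unique Poisson structure extending that of
      -- the center, and is Poisson simple
      (∃ br, IsLocalizedPoissonBracket T (p.bracket ζ)
          (Submonoid.closure
            (Set.range X ∪ Set.range fun j : Fin n => p.Zseq ζ X Y (j + 1))) br ∧
        (∀ br', IsLocalizedPoissonBracket T (p.bracket ζ)
          (Submonoid.closure
            (Set.range X ∪ Set.range fun j : Fin n => p.Zseq ζ X Y (j + 1))) br' → br' = br) ∧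
        IsPoissonSimple br) ∧
      -- up to associates, the Poisson prime elements of the center are `Z_1, …, Z_n`
      ∀ f : p.Center ζ, IsPoissonPrime T (p.bracket ζ) f ↔
        ∃ j : Fin n, Associated f (p.Zseq ζ X Y (j + 1)) :=
  ⟨RootData.sigma_surjective ζ, RootData.bracketWellDefined hε, RootData.isPoissonBracket hε,
    (RootData.weylCenterData hζ hdiv hε).x, (RootData.weylCenterData hζ hdiv hε).y,
    RootData.coe_centerEquiv_inl hζ hdiv hε, RootData.coe_centerEquiv_inr hζ hdiv hε,
    (RootData.weylCenterData hζ hdiv hε).exists_unique_localized_bracket hn,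
    (RootData.weylCenterData hζ hdiv hε).isPoissonPrime_iff⟩
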